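/- For $m\ge 1$ let $H_m=\liminf_{n\to\infty}(p_{n+m}-p_n)$, where $p_n$ is the $n$-th prime. For each sufficiently large real $x$ let $\rho=\rho_x$ be a real-valued function on the integers of $[x,2x]$. We say that the family $(\rho_x)$ has exponent of distribution $\theta$ to smooth moduli if for every $\epsilon>0$ there is a $\delta>0$ (independent of $x$) such that for every $A>0$, every large $x$, every $P$ which is a product of distinct primes smaller than $x^\delta$, and every integer $a$ with $(a,P)=1$, $$\sum_{\substack{q\le x^{\theta-\epsilon}\\ q\mid P}}\left|\sum_{\substack{x\le n\le 2x\\ n\equiv a\ (\mathrm{mod}\ q)}}\rho_x(n)-\frac1{\varphi(q)}\sum_{\substack{x\le n\le 2x\\ (n,q)=1}}\rho_x(n)\right|\ll x(\log x)^{-A},$$ where the implied constant, and how large $x$ has to be, may depend on $\epsilon$ and $A$ but not on $x$, $P$, $a$. Lemma. Let $\theta>0$, $c_1<1$ and $\xi>0$ be fixed real numbers. Suppose that for all large real $x$ there is a function $\rho=\rho_x$ from the integers of $[x,2x]$ to $\mathbb R$ such that: 1. $\rho(n)\le 1$ if $n$ is prime, and $\rho(n)\le 0$ otherwise; 2. if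 $\rho(n)\neq 0$ then all prime factors of $n$ exceed $x^\xi$; 3. the family $(\rho_x)$ has exponent of distribution $\theta$ to smooth moduli; 4. $\displaystyle\sum_{x\le n\le 2x}\rho(n)=(1-c_1+o(1))\frac{x}{\log x}$ as $x\to\infty$. Then for every $c_0>\dfrac{2}{\theta(1-c_1)}$ there is a constant $C$ such that $H_m\le C\exp(c_0m)$ for all integers $m\ge 1$ (in particular every $H_m$ is finite). -/

import Mathlib

open Filter Topology

noncomputable section

/-- The integers `n` with `x ≤ n ≤ 2x` (for real `x ≥ 0`). -/
def dyadicBlock (x : ℝ) : Finset ℕ := Finset.Icc ⌈x⌉₊ ⌊2 * x⌋₊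

theorem mem_dyadicBlock {x : ℝ} (hx : 0 ≤ x) (n : ℕ) :
    n ∈ dyadicBlock x ↔ x ≤ (n : ℝ) ∧ (n : ℝ) ≤ 2 * x := by
  unfold dyadicBlock
  rw [Finset.mem_Icc, Nat.ceil_le, Nat.le_floor_iff (by linarith)]

/-- The discrepancy, in the residue class `a` modulo `q`, of a function `f` on the integers of
`[x, 2x]`: the sum of `f` over `n ≡ a (mod q)` minus `1 / φ(q)` times the sum of `f` over the `n`
coprime to `q`. -/
def discrepancy (x : ℝ) (f : ℕ → ℝ) (q : ℕ) (a : ℤ) : ℝ :=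
  (∑ n ∈ (dyadicBlock x).filter (fun n : ℕ => (n : ℤ) ≡ a [ZMOD (q : ℤ)]), f n)
    - (1 / (Nat.totient q : ℝ)) *
      (∑ n ∈ (dyadicBlock x).filter (fun n : ℕ => Nat.Coprime n q), f n)

/-- A family `f x : [x, 2x] → ℝ`, indexed by real `x`, has exponent of distribution `θ` to smooth
moduli. Only the values of `f x` at integers of `[x, 2x]` are used. The number `δ` depends on `ε`
only; the implied constant `C` (and how large `x` has to be) depends on `ε` and `A` only, and is
uniform in `x`, `P` and `a`. -/
def HasSmoothExponentOfDistribution (f : ℝ → ℕ → ℝ) (θ : ℝ) : Prop :=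
  ∀ ε : ℝ, 0 < ε → ∃ δ : ℝ, 0 < δ ∧ ∀ A : ℝ, 0 < A → ∃ C : ℝ, ∀ᶠ x : ℝ in atTop,
    ∀ P : ℕ, Squarefree P → (∀ p : ℕ, p.Prime → p ∣ P → (p : ℝ) < x ^ δ) →
      ∀ a : ℤ, IsCoprime a (P : ℤ) →
        ∑ q ∈ P.divisors with ((q : ℕ) : ℝ) ≤ x ^ (θ - ε), |discrepancy x (f x) q a|
          ≤ C * (x * (Real.log x) ^ (-A))

/-- `H_m = liminf_{n → ∞} (p_{n+m} - p_n)`, where `p_n` is the `n`-th prime, as an extended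
real number (a priori it may be `⊤`). -/
def primeGapLiminf (m : ℕ) : EReal :=
  liminf (fun n : ℕ =>
    (((Nat.nth Nat.Prime (n + m) : ℝ) - (Nat.nth Nat.Prime n : ℝ) : ℝ) : EReal)) atTop

end

/-! The argument is a Maynard–Tao sieve in which `ρ` replaces the primes. For an admissible tuple
`h` of size `k`, a nonnegative weight `w` is built on the integers `n` in a fixed class modulo `W =
primorial D₀`, chosen so that all `n + h i` are coprime to `W`. If `∑_j ∑_n ρ(n + h j) w(n)` exceeds
`m ∑_n w(n)`, then, because `ρ` is at most the indicator of the primes, some `n` has more than `m`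
primes among the `n + h j`.

The weight depends only on which primes `p` of `S`, the primes in `(D₀, N]`, divide which `n + h i`.
Such a `p` divides at most one of them, so `n` defines a colouring of `S` with colours from the
index type. The weight is the square of a combination of the products of the functions `1/p - 1_{p ∣
n + h i}`. In the model where each colour has probability `1/p` these functions are centred and
nearly orthogonal, so the coefficients play the part of Maynard's diagonalising variables. Every
quadratic-form estimate reduces to one prime at a time and is then tensorized by
`tensor_quadratic_le`. Two one-prime inequalities suffice: `residue_form_le` bounds the total mass
from above, and `lower_form_le` bounds the mass from below when `n + h j` is prime to `S`.

The coefficient of a colouring with parts `d i` is `∏ 1/(L + log (d i))`, cut off at `d i ≤ N`, at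
total product `R`, and at few prime factors. Write `I₁`, `I₂` for the sums of `1/(m (L + log m))`
and `1/(m (L + log m)^2)` over `m ≤ N` coprime to `W`. The upper bound is then `I₂^k` and the lower
bound is almost `I₂^(k-1) I₁^2`. The lower bound needs the cut at `R` to be harmless for most
tuples. This is Chebyshev's inequality for a sum of independent logarithms
(`expect_sieveWeight_ge`).

The scale is `N ≈ exp (β L)`, `R = exp (κ L)`, `x = exp (s L)`, with `β, κ, s` fixed and `L → ∞`.
The ratio of the two sides tends to `k (1 - c₁)/s · log²(1+β)(1+β)/β`, up to a small relative loss.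
Level of distribution asks for `2κ < θ s`, with a little room. Taking `κ = k log k` and `β = k^(1-η)
log k` makes the ratio about `θ (1 - c₁)/2 · log k`. So `m` may be that large, and `k` is about `exp
(2m / (θ (1 - c₁)))`. A tuple of `k` primes just above the `k`-th has diameter at most `k^(1+η)`,
which gives the bound for `H_m`.

All moduli divide `primorial N`. Since `β < δ s` they are smooth, and since `β < ξ s` the support of
`ρ` is coprime to them. Many colourings share a modulus but need different residues. They are
handled by averaging over a random colouring, which selects one residue for the whole modulus
(`sum_mul_sieveWeight_ge`); the cut on the number of prime factors keeps the cost to a power of `log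
x`.

The upper bound counts integers trivially and needs `R^2` smaller than a power of `x` below the
first, for which `θ ≤ 1` is used. This holds automatically: moduli beyond `2x` have an empty class
of `1`, which contradicts a level above `1` (`exponent_le_one`). -/

/-! ### Tensorization of quadratic inequalities. -/

/-- A family of one-factor inequalities between weighted quadratic forms tensorizes. -/
theorem tensor_quadratic_le {T S U : Type} [Fintype T] [Fintype S] [Fintype U]
    {α : Type} [Fintype α] [DecidableEq α] (m : α → S → ℝ) (hm : ∀ a s, 0 ≤ m a s)
    (m' : α → U → ℝ) (hm' : ∀ a u, 0 ≤ m' a u) (b : α → T → S → ℝ) (b' : α → T → U → ℝ)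
    (h : ∀ a, ∀ c : T → ℝ, ∑ s, m a s * (∑ t, c t * b a t s) ^ 2
      ≤ ∑ u, m' a u * (∑ t, c t * b' a t u) ^ 2) (z : (α → T) → ℝ) :
    ∑ χ : α → S, (∏ a, m a (χ a)) * (∑ d : α → T, z d * ∏ a, b a (d a) (χ a)) ^ 2
      ≤ ∑ u : α → U, (∏ a, m' a (u a)) * (∑ d : α → T, z d * ∏ a, b' a (d a) (u a)) ^ 2 := by
  classical
  rename_i _ dec
  revert m m' b b' z dec
  refine Fintype.induction_empty_option (P := fun α _ => ∀ [DecidableEq α] (m : α → S → ℝ),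
    (∀ a s, 0 ≤ m a s) → ∀ (m' : α → U → ℝ), (∀ a u, 0 ≤ m' a u) →
    ∀ (b : α → T → S → ℝ) (b' : α → T → U → ℝ), (∀ a, ∀ c : T → ℝ,
      ∑ s, m a s * (∑ t, c t * b a t s) ^ 2 ≤ ∑ u, m' a u * (∑ t, c t * b' a t u) ^ 2) →
    ∀ z : (α → T) → ℝ,
    ∑ χ : α → S, (∏ a, m a (χ a)) * (∑ d : α → T, z d * ∏ a, b a (d a) (χ a)) ^ 2
      ≤ ∑ u : α → U, (∏ a, m' a (u a)) * (∑ d : α → T, z d * ∏ a, b' a (d a) (u a)) ^ 2)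
    ?_ ?_ ?_ α
  · intro α β _ e ih _ m hm m' hm' b b' h z
    let _ : Fintype α := Fintype.ofEquiv β e.symm
    let _ : DecidableEq α := Classical.decEq α
    have key : ∀ {V : Type} [Fintype V] (μ : β → V → ℝ) (c : β → T → V → ℝ),
        ∑ χ : β → V, (∏ a, μ a (χ a)) * (∑ d : β → T, z d * ∏ a, c a (d a) (χ a)) ^ 2
        = ∑ χ : α → V, (∏ a, μ (e a) (χ a)) *
            (∑ d : α → T, z (fun y => d (e.symm y)) * ∏ a, c (e a) (d a) (χ a)) ^ 2 := by
      intro V _ μ c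
      refine (Fintype.sum_equiv (e.arrowCongr (Equiv.refl V)) _ _ fun χ => ?_).symm
      rw [← Equiv.prod_comp e]
      congr 1
      · simp
      · congr 1
        refine Fintype.sum_equiv (e.arrowCongr (Equiv.refl T)) _ _ fun d => ?_
        rw [← Equiv.prod_comp e]
        simp [Equiv.arrowCongr, Function.comp_def]
    rw [key, key]
    exact ih (fun a => m (e a)) (fun a => hm _) (fun a => m' (e a)) (fun a => hm' _)
      (fun a => b (e a)) (fun a => b' (e a)) (fun a => h _) _
  · intro _ m hm m' hm' b b' h z
    simp
  · intro α _ ih _ m hm m' hm' b b' h z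
    let _ : DecidableEq α := Classical.decEq α
    have split : ∀ {V : Type} [Fintype V] (F : (Option α → V) → ℝ),
        ∑ χ : Option α → V, F χ = ∑ χ : α → V, ∑ v : V,
          F ((Equiv.piOptionEquivProd (β := fun _ => V)).symm (v, χ)) := by
      intro V _ F
      rw [← Equiv.sum_comp (Equiv.piOptionEquivProd (β := fun _ => V)).symm,
        Fintype.sum_prod_type, Finset.sum_comm]
    rw [split, split (V := U)]
    simp only [split (V := T), Fintype.prod_option, Equiv.piOptionEquivProd_symm_apply]
    have lhs : ∀ χ : α → S, ∀ s : S,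
        ∑ d : α → T, ∑ t : T, z ((Equiv.piOptionEquivProd (β := fun _ => T)).symm (t, d)) *
          (b none t s * ∏ a, b (some a) (d a) (χ a))
        = ∑ t, (∑ d : α → T, z ((Equiv.piOptionEquivProd (β := fun _ => T)).symm (t, d)) *
            ∏ a, b (some a) (d a) (χ a)) * b none t s := by
      intro χ s
      rw [Finset.sum_comm]
      refine Finset.sum_congr rfl fun t _ => ?_
      rw [Finset.sum_mul]
      exact Finset.sum_congr rfl fun d _ => by ring
    have rhs : ∀ (χ : α → U) (u : U),
        ∑ d : α → T, ∑ t : T, z ((Equiv.piOptionEquivProd (β := fun _ => T)).symm (t, d)) *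
          (b' none t u * ∏ a, b' (some a) (d a) (χ a))
        = ∑ d : α → T, (∑ t, z ((Equiv.piOptionEquivProd (β := fun _ => T)).symm (t, d)) *
            b' none t u) * ∏ a, b' (some a) (d a) (χ a) := by
      intro χ u
      refine Finset.sum_congr rfl fun d _ => ?_
      rw [Finset.sum_mul]
      exact Finset.sum_congr rfl fun t _ => by ring
    have mid : ∀ (χ : α → S) (u : U),
        ∑ t, (∑ d : α → T, z ((Equiv.piOptionEquivProd (β := fun _ => T)).symm (t, d)) *
            ∏ a, b (some a) (d a) (χ a)) * b' none t u
        = ∑ d : α → T, (∑ t, z ((Equiv.piOptionEquivProd (β := fun _ => T)).symm (t, d)) *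
            b' none t u) * ∏ a, b (some a) (d a) (χ a) := by
      intro χ u
      simp only [Finset.sum_mul]
      rw [Finset.sum_comm]
      exact Finset.sum_congr rfl fun d _ => Finset.sum_congr rfl fun t _ => by ring
    simp only [lhs, rhs]
    -- The factors are exchanged one at a time. For fixed `χ` the inner sums over `d` form the
    -- coefficient vector of the one-factor inequality at `none`. After that exchange, each fixed
    -- `u` leaves an instance of the inequality for the remaining factors. Nonnegative weights are
    -- needed on the side that is being held fixed.
    calc _ = ∑ χ : α → S, (∏ a, m (some a) (χ a)) * ∑ s, m none s *
            (∑ t, (∑ d : α → T, z ((Equiv.piOptionEquivProd (β := fun _ => T)).symm (t, d)) *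
            ∏ a, b (some a) (d a) (χ a)) * b none t s) ^ 2 := by
          refine Finset.sum_congr rfl fun χ _ => ?_
          rw [Finset.mul_sum]
          refine Finset.sum_congr rfl fun s _ => ?_
          ring
      _ ≤ ∑ χ : α → S, (∏ a, m (some a) (χ a)) * ∑ u, m' none u *
            (∑ t, (∑ d : α → T, z ((Equiv.piOptionEquivProd (β := fun _ => T)).symm (t, d)) *
            ∏ a, b (some a) (d a) (χ a)) * b' none t u) ^ 2 :=
          Finset.sum_le_sum fun χ _ => mul_le_mul_of_nonneg_left (h none _)
            (Finset.prod_nonneg fun a _ => hm _ _)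
      _ = ∑ u, m' none u * ∑ χ : α → S, (∏ a, m (some a) (χ a)) *
            (∑ d : α → T, (∑ t, z ((Equiv.piOptionEquivProd (β := fun _ => T)).symm (t, d)) *
            b' none t u) * ∏ a, b (some a) (d a) (χ a)) ^ 2 := by
          simp only [Finset.mul_sum, mid]
          rw [Finset.sum_comm]
          exact Finset.sum_congr rfl fun d _ => Finset.sum_congr rfl fun t _ => by ring
      _ ≤ ∑ u, m' none u * ∑ χ : α → U, (∏ a, m' (some a) (χ a)) *
            (∑ d : α → T, (∑ t, z ((Equiv.piOptionEquivProd (β := fun _ => T)).symm (t, d)) *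
            b' none t u) * ∏ a, b' (some a) (d a) (χ a)) ^ 2 :=
          Finset.sum_le_sum fun u _ => mul_le_mul_of_nonneg_left
            (ih _ (fun a => hm _) _ (fun a => hm' _) _ _ (fun a => h _) _) (hm' _ _)
      _ = _ := by
          simp only [Finset.mul_sum]
          rw [Finset.sum_comm]
          exact Finset.sum_congr rfl fun d _ => Finset.sum_congr rfl fun t _ => by ring

theorem sum_pi_prod {α S : Type} [Fintype α] [DecidableEq α] [Fintype S] (f : α → S → ℝ) :
    ∑ χ : α → S, ∏ a, f a (χ a) = ∏ a, ∑ s, f a s := by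
  rw [Finset.prod_univ_sum, Fintype.piFinset_univ]

/-! ### Quadratic forms at a single prime. -/

section LocalForms

variable {ι : Type} [Fintype ι] [DecidableEq ι]

/-- The function `1/p - 1_{s = t}` for a colour `t`, and the constant `1` for no colour. -/
noncomputable def basisFn (p : ℝ) (t s : Option ι) : ℝ :=
  match t with
  | none => 1
  | some i => 1 / p - if s = some i then 1 else 0

/-- Each colour has probability `1/p`. -/
noncomputable def residueWeight (p : ℝ) (s : Option ι) : ℝ :=
  match s with
  | none => 1 - Fintype.card ι / p
  | some _ => 1 / p

/-- Each colour but `j` has probability `1/(p-1)`; the colour `j` does not occur. -/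
noncomputable def reducedWeight (j : ι) (p : ℝ) (s : Option ι) : ℝ :=
  match s with
  | none => 1 - (Fintype.card ι - 1) / (p - 1)
  | some i => if i = j then 0 else 1 / (p - 1)

/-- The variances of the basis functions in the model of `residueWeight`, up to `1/p^2`. -/
noncomputable def diagWeight (p : ℝ) (s : Option ι) : ℝ :=
  match s with
  | none => 1
  | some _ => 1 / p

/-- The weights that survive in the lower bound: almost `1` for no colour and almost `1/p` for a
colour other than `j`. The deficits are of relative size `1/p^2` and `1/p`, so that after tensoring
they cost only sums of `1/p^2` on average. -/
noncomputable def lowerWeight (j : ι) (p : ℝ) (s : Option ι) : ℝ :=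
  match s with
  | none => 1 - 1 / (p - 1) ^ 2
  | some i => if i = j then 0 else 1 / p * (1 - 4 * Fintype.card ι / p)

/-- When colour `j` cannot occur, its basis function is the constant `1/p` and merges with the empty
colour. Over all primes this sums out the `j`-th variable of the coefficients. -/
noncomputable def lowerFn (j : ι) (p : ℝ) (t u : Option ι) : ℝ :=
  match u with
  | none => if t = none then 1 else if t = some j then 1 / p else 0
  | some i => if t = some i then 1 else 0

/-- The functions `1/p - 1_i` have mean zero and covariance `δ_{il}/p - 1/p^2`. The left side
therefore equals the diagonal form minus the square of `∑ c_i/p`. -/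
theorem residue_form_le (p : ℝ) (c : Option ι → ℝ) :
    ∑ s, residueWeight p s * (∑ t, c t * basisFn p t s) ^ 2
      ≤ ∑ u, diagWeight p u * (∑ t, c t * if t = u then 1 else 0) ^ 2 := by
  simp only [Fintype.sum_option, residueWeight, basisFn, diagWeight]
  simp only [mul_ite, mul_one, mul_zero, Finset.sum_ite_eq', reduceCtorEq, if_false,
    Finset.sum_const_zero, add_zero, Finset.mem_univ, if_true, Option.some.injEq, sub_zero,
    mul_sub, Finset.sum_sub_distrib, eq_comm, Finset.sum_ite_eq, zero_add, one_mul]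
  set s : ℝ := ∑ i, c (some i) * (1 / p) with hs
  have e1 : ∑ i, 1 / p * (c none + (s - c (some i))) ^ 2
      = Fintype.card ι / p * (c none + s) ^ 2 - 2 * (c none + s) * s
        + ∑ i, 1 / p * c (some i) ^ 2 := by
    have : ∀ i, 1 / p * (c none + (s - c (some i))) ^ 2
      = 1 / p * (c none + s) ^ 2 - 2 * (c none + s) * (c (some i) * (1 / p))
        + 1 / p * c (some i) ^ 2 := fun i => by ring
    simp only [this, Finset.sum_add_distrib, Finset.sum_sub_distrib, ← Finset.mul_sum, ← hs,
      Finset.sum_const, Finset.card_univ, nsmul_eq_mul]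
    ring
  rw [e1]
  nlinarith [sq_nonneg s]

/-- With `d = c_0 + c_j/p`, `q = 1/(p-1)` and `s = ∑_{i ≠ j} c_i/p`, the right side is exactly `d^2
- 2qds - (1+2q)s^2 + q ∑_{i ≠ j} c_i^2`. The cross term is absorbed at the cost of `q^2 d^2`, and
Cauchy–Schwarz makes `s^2` a `k/p` fraction of the diagonal. -/
theorem lower_form_le (j : ι) (p : ℝ) (hp : 2 ≤ p) (hk : 4 * (Fintype.card ι : ℝ) ≤ p)
    (c : Option ι → ℝ) :
    ∑ u, lowerWeight j p u * (∑ t, c t * lowerFn j p t u) ^ 2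
      ≤ ∑ s, reducedWeight j p s * (∑ t, c t * basisFn p t s) ^ 2 := by
  have hp1 : (0 : ℝ) < p - 1 := by linarith
  have hp0 : (0 : ℝ) < p := by linarith
  simp only [Fintype.sum_option, reducedWeight, basisFn, lowerWeight, lowerFn]
  simp only [mul_ite, mul_one, mul_zero, Finset.sum_ite_eq', reduceCtorEq, if_false,
    Finset.sum_const_zero, add_zero, Finset.mem_univ, if_true, Option.some.injEq, sub_zero,
    mul_sub, Finset.sum_sub_distrib, Finset.sum_ite_eq, zero_add, one_mul, ite_mul, zero_mul]
  set E := Finset.univ.erase j with hE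
  have sum_if : ∀ f : ι → ℝ, (∑ i, if i = j then 0 else f i) = ∑ i ∈ E, f i := by
    intro f
    rw [← Finset.add_sum_erase _ _ (Finset.mem_univ j), if_pos rfl, zero_add]
    exact Finset.sum_congr rfl fun i hi => if_neg (Finset.ne_of_mem_erase hi)
  have sum_split : ∀ f : ι → ℝ, ∑ i, f i = f j + ∑ i ∈ E, f i := fun f =>
    (Finset.add_sum_erase _ _ (Finset.mem_univ j)).symm
  have cardE : (E.card : ℝ) = Fintype.card ι - 1 := by
    rw [hE, Finset.card_erase_of_mem (Finset.mem_univ j), Finset.card_univ, Nat.cast_sub, Nat.cast_one]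
    exact Fintype.card_pos_iff.2 ⟨j⟩
  simp only [sum_if]
  set s : ℝ := ∑ i ∈ E, c (some i) * (1 / p) with hs
  set d : ℝ := c none + c (some j) * (1 / p) with hd
  set Q : ℝ := ∑ i ∈ E, c (some i) ^ 2 with hQ
  set q : ℝ := 1 / (p - 1) with hq
  have hall : ∑ i, c (some i) * (1 / p) = c (some j) * (1 / p) + s := sum_split _
  simp only [hall]
  have hsQ : s ^ 2 ≤ (Fintype.card ι - 1) / p ^ 2 * Q := by
    have h1 : s = (1 / p) * ∑ i ∈ E, c (some i) := by rw [hs, ← Finset.sum_mul, mul_comm]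
    have h2 := sq_sum_le_card_mul_sum_sq (s := E) (f := fun i => c (some i))
    rw [cardE] at h2
    rw [h1, mul_pow]
    calc (1 / p) ^ 2 * (∑ i ∈ E, c (some i)) ^ 2 ≤ (1 / p) ^ 2 * ((Fintype.card ι - 1) * Q) := by
          gcongr
      _ = _ := by ring
  have e1 : ∑ i ∈ E, 1 / (p - 1) * (c none + (c (some j) * (1 / p) + s - c (some i))) ^ 2
      = (Fintype.card ι - 1) * q * (d + s) ^ 2 - 2 * q * p * (d + s) * s + q * Q := by
    have : ∀ i, 1 / (p - 1) * (c none + (c (some j) * (1 / p) + s - c (some i))) ^ 2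
      = q * (d + s) ^ 2 - 2 * q * p * (d + s) * (c (some i) * (1 / p))
        + q * c (some i) ^ 2 := fun i => by
      have : c (some i) = p * (c (some i) * (1 / p)) := by field_simp
      rw [hd]
      linear_combination (2 * q * (c none + c (some j) * (1 / p) + s)) * (-this)
    simp only [this, Finset.sum_add_distrib, Finset.sum_sub_distrib, ← Finset.mul_sum, ← hs,
      Finset.sum_const, nsmul_eq_mul, ← hQ, cardE]
    ring
  have e2 : ∑ i ∈ E, 1 / p * (1 - 4 * (Fintype.card ι : ℝ) / p) * c (some i) ^ 2
      = 1 / p * (1 - 4 * (Fintype.card ι : ℝ) / p) * Q := by rw [← Finset.mul_sum]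
  rw [e1]
  have e3 : c none + (c (some j) * (1 / p) + s) = d + s := by rw [hd]; ring
  rw [e3]
  have hq1 : q * (p - 1) = 1 := by rw [hq]; field_simp
  have hqp : q * p = 1 + q := by linarith
  have hqle : q ≤ 1 := by rw [hq, div_le_one hp1]; linarith
  have hq0 : 0 < q := by positivity
  have hQ0 : 0 ≤ Q := Finset.sum_nonneg fun i _ => sq_nonneg _
  have hqq : 1 / p ≤ q := one_div_le_one_div_of_le hp1 (by linarith)
  have hk1 : (0 : ℝ) ≤ Fintype.card ι - 1 := by rw [← cardE]; positivity
  have hmain : (1 - (Fintype.card ι - 1) / (p - 1)) * (d + s) ^ 2 +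
      ((Fintype.card ι - 1) * q * (d + s) ^ 2 - 2 * q * p * (d + s) * s + q * Q)
      = d ^ 2 - 2 * q * d * s - s ^ 2 * (1 + 2 * q) + q * Q := by
    have : ((Fintype.card ι : ℝ) - 1) / (p - 1) = (Fintype.card ι - 1) * q := by rw [hq]; ring
    rw [this]
    linear_combination (-2 * (d + s) * s) * hqp
  -- Completing the square `(q d - s)^2` leaves `-(2 + 2q) s^2 ≥ -4 s^2`, as `q ≤ 1`; this is the
  -- source of the constant `4`.
  have hgoal : (1 - q ^ 2) * d ^ 2 + 1 / p * (1 - 4 * (Fintype.card ι : ℝ) / p) * Q ≤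
      d ^ 2 - 2 * q * d * s - s ^ 2 * (1 + 2 * q) + q * Q := by
    have h4 : s ^ 2 * 4 ≤ 4 * (Fintype.card ι : ℝ) / p ^ 2 * Q := by
      calc s ^ 2 * 4 ≤ ((Fintype.card ι - 1) / p ^ 2 * Q) * 4 := by gcongr
        _ = 4 * (Fintype.card ι : ℝ) / p ^ 2 * Q - 4 * Q / p ^ 2 := by ring
        _ ≤ _ := by have : 0 ≤ 4 * Q / p ^ 2 := by positivity
                    linarith
    have h5 : 1 / p * (1 - 4 * (Fintype.card ι : ℝ) / p) * Q
        = 1 / p * Q - 4 * (Fintype.card ι : ℝ) / p ^ 2 * Q := by field_simp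
    rw [h5]
    have h6 : 1 / p * Q ≤ q * Q := by gcongr
    nlinarith [sq_nonneg (q * d - s), sq_nonneg s]
  rw [hmain]
  refine le_trans (le_of_eq ?_) hgoal
  rw [← e2, hq]
  congr 1
  · rw [hd]; simp [one_div]
  · exact Finset.sum_congr rfl fun i _ => by ring
end LocalForms

/-! ### Squarefree numbers as products of sets of primes. -/

section SubsetProd

variable {S : Finset ℕ}

/-- The product of the `p ∈ S` that satisfy `Q`. -/
def subsetProd (Q : S → Prop) [DecidablePred Q] : ℕ := ∏ p : S, if Q p then (p : ℕ) else 1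

theorem subsetProd_eq (Q : S → Prop) [DecidablePred Q] :
    subsetProd Q = ∏ p ∈ (Finset.univ.filter Q).map (Function.Embedding.subtype _), p := by
  rw [subsetProd, Finset.prod_map, Finset.prod_filter]; rfl

theorem prime_dvd_subsetProd (hS : ∀ p ∈ S, p.Prime) (Q : S → Prop) [DecidablePred Q] {q : ℕ}
    (hq : q.Prime) : q ∣ subsetProd Q ↔ ∃ h : q ∈ S, Q ⟨q, h⟩ := by
  rw [subsetProd, Prime.dvd_finsetProd_iff hq.prime]
  constructor
  · rintro ⟨p, -, hp⟩
    split_ifs at hp with h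
    · have := (Nat.prime_dvd_prime_iff_eq hq (hS p p.2)).1 hp
      subst this
      exact ⟨p.2, h⟩
    · exact absurd (Nat.dvd_one.1 hp) hq.ne_one
  · rintro ⟨h, hQ⟩
    exact ⟨⟨q, h⟩, Finset.mem_univ _, by simp [hQ]⟩

theorem primeFactors_subsetProd (hS : ∀ p ∈ S, p.Prime) (Q : S → Prop) [DecidablePred Q] :
    (subsetProd Q).primeFactors = (Finset.univ.filter Q).map (Function.Embedding.subtype _) := by
  rw [subsetProd_eq, Nat.primeFactors_prod]
  simp only [Finset.mem_map]
  rintro p ⟨q, -, rfl⟩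
  exact hS _ q.2

theorem subsetProd_pos (hS : ∀ p ∈ S, p.Prime) (Q : S → Prop) [DecidablePred Q] :
    0 < subsetProd Q :=
  Finset.prod_pos fun p _ => by split_ifs; exacts [(hS p p.2).pos, one_pos]

theorem coprime_subsetProd {W : ℕ} (hW : ∀ p ∈ S, p.Coprime W) (Q : S → Prop)
    [DecidablePred Q] : (subsetProd Q).Coprime W := by
  refine Nat.Coprime.prod_left fun p _ => ?_
  split_ifs
  exacts [hW p p.2, Nat.coprime_one_left W]

theorem subsetProd_mono (hS : ∀ p ∈ S, p.Prime) {Q Q' : S → Prop} [DecidablePred Q]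
    [DecidablePred Q'] (h : ∀ p, Q p → Q' p) : subsetProd Q ≤ subsetProd Q' := by
  refine Finset.prod_le_prod' fun p _ => ?_
  have := (hS p p.2).pos
  by_cases hQ : Q p
  · simp [hQ, h p hQ]
  · simp only [hQ, if_false]; split_ifs <;> omega

/-- A squarefree number all of whose prime factors lie in `S` is a subset product. -/
theorem subsetProd_dvd_eq (hS : ∀ p ∈ S, p.Prime) {m : ℕ} (hm : Squarefree m)
    (hmS : ∀ p, p.Prime → p ∣ m → p ∈ S) : subsetProd (fun p : S => (p : ℕ) ∣ m) = m := by
  conv_rhs => rw [← Nat.prod_primeFactors_of_squarefree hm]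
  rw [subsetProd_eq]
  refine Finset.prod_congr ?_ fun _ _ => rfl
  ext p
  simp only [Finset.mem_map, Finset.mem_filter, Finset.mem_univ, true_and, Nat.mem_primeFactors]
  constructor
  · rintro ⟨q, hq, rfl⟩
    exact ⟨hS _ q.2, hq, hm.ne_zero⟩
  · rintro ⟨h1, h2, -⟩
    exact ⟨⟨p, hmS p h1 h2⟩, h2, rfl⟩

end SubsetProd

/-! ### Colourings of primes, the sieve weight, and its mean from above. -/

section Colored

variable {ι : Type} [Fintype ι] [DecidableEq ι] {S : Finset ℕ}

/-- The product of the primes of colour `i` in the coloured set of primes `d`. -/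
def colorPart (d : S → Option ι) (i : ι) : ℕ := subsetProd fun p => d p = some i

/-- The product of all coloured primes. -/
def colorProd (d : S → Option ι) : ℕ := subsetProd fun p => d p ≠ none

/-- The number of coloured primes. -/
def colorCard (d : S → Option ι) : ℕ := (Finset.univ.filter fun p => d p ≠ none).card

theorem colorProd_eq_prod (d : S → Option ι) : colorProd d = ∏ i, colorPart d i := by
  unfold colorProd colorPart subsetProd
  rw [Finset.prod_comm]
  refine Finset.prod_congr rfl fun p _ => ?_
  rcases h : d p with _ | i
  · simp [h]
  · simp [h, Finset.prod_ite_eq]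

theorem colorCard_eq_sum (hS : ∀ p ∈ S, p.Prime) (d : S → Option ι) :
    colorCard d = ∑ i, (colorPart d i).primeFactors.card := by
  unfold colorCard colorPart
  simp only [primeFactors_subsetProd hS, Finset.card_map, Finset.card_filter]
  rw [Finset.sum_comm]
  refine Finset.sum_congr rfl fun p _ => ?_
  rcases h : d p with _ | i
  · simp [h]
  · simp [h, Finset.sum_ite_eq]

theorem dvd_colorPart (hS : ∀ p ∈ S, p.Prime) (d : S → Option ι) (i : ι) (p : S) :
    (p : ℕ) ∣ colorPart d i ↔ d p = some i := by
  rw [colorPart, prime_dvd_subsetProd hS _ (hS p p.2)]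
  simp

theorem colorPart_injective (hS : ∀ p ∈ S, p.Prime) :
    Function.Injective (colorPart : (S → Option ι) → ι → ℕ) := by
  intro d e h
  funext p
  ext i
  have := dvd_colorPart hS d i p
  rw [h, dvd_colorPart hS e i p] at this
  exact this.symm

theorem colorPart_pos (hS : ∀ p ∈ S, p.Prime) (d : S → Option ι) (i : ι) : 0 < colorPart d i :=
  subsetProd_pos hS _

/-- A colouring is determined by its parts, which range over pairwise coprime tuples. Forgetting the
coprimality only adds nonnegative terms, and the sum then factors. -/
theorem sum_prod_colorPart_le (hS : ∀ p ∈ S, p.Prime) (D : Finset (S → Option ι))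
    (A : ι → Finset ℕ) (hD : ∀ d ∈ D, ∀ i, colorPart d i ∈ A i) (f : ι → ℕ → ℝ)
    (hf : ∀ i m, 0 ≤ f i m) :
    ∑ d ∈ D, ∏ i, f i (colorPart d i) ≤ ∏ i, ∑ m ∈ A i, f i m := by
  classical
  rw [Finset.prod_univ_sum, ← Finset.sum_image (f := fun m : ι → ℕ => ∏ i, f i (m i))
    (g := colorPart) ((colorPart_injective hS).injOn)]
  refine Finset.sum_le_sum_of_subset_of_nonneg ?_ fun m _ _ => Finset.prod_nonneg fun i _ => hf _ _
  intro m hm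
  obtain ⟨d, hd, rfl⟩ := Finset.mem_image.1 hm
  exact Fintype.mem_piFinset.2 (hD d hd)

/-- The coefficients of the sieve weight. -/
noncomputable def sieveCoeff (G : ℕ → ℝ) (R : ℝ) (d : S → Option ι) : ℝ :=
  if (colorProd d : ℝ) ≤ R then ∏ i, G (colorPart d i) else 0

/-- The sieve weight as a function of the colouring `χ` of the primes in `S`. -/
noncomputable def sieveWeight (G : ℕ → ℝ) (R : ℝ) (χ : S → Option ι) : ℝ :=
  (∑ d : S → Option ι, sieveCoeff G R d * ∏ p : S, basisFn ((p : ℕ) : ℝ) (d p) (χ p)) ^ 2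

theorem residueWeight_nonneg {p : ℝ} (hp : Fintype.card ι ≤ p) (hp0 : 0 < p) (s : Option ι) :
    0 ≤ residueWeight p s := by
  cases s
  · simp only [residueWeight, sub_nonneg]; rwa [div_le_one hp0]
  · simp only [residueWeight]; positivity

/-- The expected value of the sieve weight when each `p` has each colour with probability `1/p`. -/
theorem expect_sieveWeight_le (hS : ∀ p ∈ S, p.Prime) (hk : ∀ p ∈ S, Fintype.card ι ≤ p)
    (G : ℕ → ℝ) (R : ℝ) (A : Finset ℕ)
    (hA : ∀ d : S → Option ι, ∀ i, G (colorPart d i) ≠ 0 → colorPart d i ∈ A) :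
    ∑ χ : S → Option ι, (∏ p : S, residueWeight ((p : ℕ) : ℝ) (χ p)) * sieveWeight G R χ
      ≤ (∑ m ∈ A, G m ^ 2 / m) ^ Fintype.card ι := by
  have hp0 : ∀ p : S, (0 : ℝ) < (p : ℕ) := fun p => by exact_mod_cast (hS p p.2).pos
  refine le_trans (tensor_quadratic_le (fun p : S => residueWeight ((p : ℕ) : ℝ))
    (fun p s => residueWeight_nonneg (by exact_mod_cast hk p p.2) (hp0 p) s)
    (fun p : S => diagWeight ((p : ℕ) : ℝ)) (fun p u => ?_) (fun p => basisFn ((p : ℕ) : ℝ))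
    (fun _ t u => if t = u then 1 else 0) (fun p c => residue_form_le _ c) (sieveCoeff G R)) ?_
  · cases u <;> simp [diagWeight]
  -- The tensored upper form is diagonal, so it reads off the single coefficient at `u`.
  have hz : ∀ u : S → Option ι, (∑ d : S → Option ι, sieveCoeff G R d *
      ∏ p : S, (if d p = u p then (1 : ℝ) else 0)) = sieveCoeff G R u := by
    intro u
    rw [Finset.sum_eq_single u]
    · simp
    · intro d _ hd
      obtain ⟨p, hp⟩ := Function.ne_iff.1 hd
      rw [Finset.prod_eq_zero (Finset.mem_univ p) (by simp [hp]), mul_zero]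
    · simp
  simp only [hz]
  have hw : ∀ u : S → Option ι, ∏ p : S, diagWeight ((p : ℕ) : ℝ) (u p)
      = ∏ i, (1 / (colorPart u i : ℝ)) := by
    intro u
    rw [Finset.prod_div_distrib, Finset.prod_const_one, ← Nat.cast_prod, ← colorProd_eq_prod,
      colorProd, subsetProd, Nat.cast_prod, one_div, ← Finset.prod_inv_distrib]
    refine Finset.prod_congr rfl fun p _ => ?_
    rcases h : u p <;> simp [diagWeight]
  classical
  calc _ = ∑ u ∈ Finset.univ.filter fun u : S → Option ι => sieveCoeff G R u ≠ 0,
        (∏ p : S, diagWeight ((p : ℕ) : ℝ) (u p)) * sieveCoeff G R u ^ 2 := by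
        rw [Finset.sum_filter]
        refine Finset.sum_congr rfl fun u _ => ?_
        split_ifs with h
        · rfl
        · simp [not_not.1 h]
    _ ≤ ∑ u ∈ Finset.univ.filter fun u : S → Option ι => sieveCoeff G R u ≠ 0,
        ∏ i, G (colorPart u i) ^ 2 / (colorPart u i) := by
        refine Finset.sum_le_sum fun u _ => ?_
        rw [hw, Finset.prod_div_distrib, Finset.prod_div_distrib, Finset.prod_const_one,
          Finset.prod_pow]
        unfold sieveCoeff
        split_ifs
        · rw [div_mul_eq_mul_div, one_mul]
        · simp only [ne_eq, OfNat.ofNat_ne_zero, not_false_eq_true, zero_pow, mul_zero]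
          positivity
    _ ≤ ∏ i : ι, ∑ m ∈ A, G m ^ 2 / m := by
        refine sum_prod_colorPart_le hS _ (fun _ => A) ?_ (fun _ m => G m ^ 2 / m)
          fun _ m => by positivity
        intro u hu i
        have hu := (Finset.mem_filter.1 hu).2
        refine hA u i fun h0 => hu ?_
        unfold sieveCoeff
        rw [Finset.prod_eq_zero (Finset.mem_univ i) h0, ite_self]
    _ = _ := by rw [Finset.prod_const, Finset.card_univ]

end Colored

/-! ### Expansion of the weight into divisibility indicators. -/

section Monomials

variable {ι : Type} [Fintype ι] [DecidableEq ι] {S : Finset ℕ}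

/-- The indicator that a colour `s` is compatible with the prescription `t`. -/
noncomputable def monoFn (t s : Option ι) : ℝ := if t = none ∨ t = s then 1 else 0

/-- `g` prescribes colours that `χ` has. -/
def Covered (g χ : S → Option ι) : Prop := ∀ p, g p = none ∨ g p = χ p

instance (g χ : S → Option ι) : Decidable (Covered g χ) :=
  inferInstanceAs (Decidable (∀ p, g p = none ∨ g p = χ p))

theorem prod_monoFn (g χ : S → Option ι) :
    ∏ p, monoFn (g p) (χ p) = if Covered g χ then (1 : ℝ) else 0 := by
  unfold monoFn
  split_ifs with h
  · exact Finset.prod_eq_one fun p _ => if_pos (h p)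
  · obtain ⟨p, hp⟩ := not_forall.1 h
    exact Finset.prod_eq_zero (Finset.mem_univ p) (if_neg hp)

/-- The product-measure expectation of the indicator of `Covered g`. -/
theorem sum_prod_covered (m : S → Option ι → ℝ) (hm : ∀ p, ∑ s, m p s = 1)
    (g : S → Option ι) :
    ∑ χ : S → Option ι, (∏ p, m p (χ p)) * (if Covered g χ then 1 else 0)
      = ∏ p, if g p = none then 1 else m p (g p) := by
  simp only [← prod_monoFn, ← Finset.prod_mul_distrib]
  rw [sum_pi_prod fun p s => m p s * monoFn (g p) s]
  refine Finset.prod_congr rfl fun p _ => ?_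
  unfold monoFn
  split_ifs with h
  · simp [h, hm]
  · simp [h]

noncomputable def expandFn (p : ℝ) (t r : Option ι) : ℝ :=
  match t with
  | none => if r = none then 1 else 0
  | some i => if r = none then 1 / p else if r = some i then -1 else 0

theorem basisFn_eq_sum (p : ℝ) (t s : Option ι) :
    basisFn p t s = ∑ r, expandFn p t r * monoFn r s := by
  rcases t with _ | i
  · simp [basisFn, expandFn, monoFn]
  · rw [Fintype.sum_option, Finset.sum_eq_single i]
    · simp only [basisFn, expandFn, monoFn, if_true, true_or, mul_one, reduceCtorEq, if_false,
        false_or, @eq_comm _ s, mul_ite, mul_zero]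
      split_ifs <;> ring
    · intro x _ hx
      simp [expandFn, hx]
    · simp

/-- Multiplication table of the indicators `monoFn`: two prescriptions combine to their union, and
incompatible colours have no combination because their product vanishes. -/
noncomputable def mergeFn (r r' t : Option ι) : ℝ :=
  if (r = none ∧ t = r') ∨ (r' = none ∧ t = r) ∨ (r = r' ∧ t = r) then 1 else 0

theorem mergeFn_nonneg (r r' t : Option ι) : 0 ≤ mergeFn r r' t := by
  unfold mergeFn; split_ifs <;> norm_num

theorem monoFn_mul (r r' s : Option ι) :
    monoFn r s * monoFn r' s = ∑ t, mergeFn r r' t * monoFn t s := by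
  rcases r with _ | i
  · simp only [monoFn, mergeFn, true_and, true_or, if_true, one_mul, ite_mul, zero_mul]
    rw [Finset.sum_eq_single r']
    · simp
    · intro t _ ht
      rw [if_neg]
      rintro (h | ⟨h1, h2⟩ | ⟨h1, h2⟩)
      · exact ht h
      · exact ht (h2.trans h1.symm)
      · exact ht (h2.trans h1)
    · simp
  · rcases r' with _ | i'
    · simp only [monoFn, mergeFn, true_and, true_or, if_true, mul_one, ite_mul, one_mul, zero_mul,
        reduceCtorEq, false_and, false_or, or_false]
      simp
    · by_cases h : i = i'
      · subst h
        rw [Finset.sum_eq_single (some i)]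
        · simp [monoFn, mergeFn]
        · intro t _ ht
          simp [mergeFn, ht]
        · simp
      · rw [Finset.sum_eq_zero fun t _ => by simp [mergeFn, h]]
        simp only [monoFn, reduceCtorEq, false_or, mul_ite, mul_one, mul_zero]
        split_ifs with h1 h2
        · exact absurd (Option.some.inj (h2.trans h1.symm)) h
        · rfl
        · rfl

/-- Only the empty pair merges to no colour, whereas a colour `t` arises from `(none, t)`, `(t,
none)` and `(t, t)`. -/
theorem sum_mergeFn_le (t : Option ι) :
    ∑ r, ∑ r', mergeFn r r' t ≤ if t = none then 1 else 3 := by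
  classical
  rw [← Finset.sum_product']
  have key : ∀ T : Finset (Option ι × Option ι),
      (∀ x : Option ι × Option ι, mergeFn x.1 x.2 t ≠ 0 → x ∈ T) →
      ∑ x ∈ Finset.univ ×ˢ Finset.univ, mergeFn x.1 x.2 t ≤ T.card := by
    intro T hT
    calc _ ≤ ∑ x ∈ Finset.univ ×ˢ Finset.univ, if x ∈ T then (1 : ℝ) else 0 := by
          refine Finset.sum_le_sum fun x _ => ?_
          split_ifs with h
          · unfold mergeFn; split_ifs <;> norm_num
          · exact le_of_eq (not_not.1 fun h0 => h (hT x h0))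
      _ ≤ T.card := by simp
  split_ifs with h
  · refine (key {(none, none)} ?_).trans (by simp)
    rintro ⟨r, r'⟩ hx
    have := (ite_ne_right_iff.1 hx).1
    subst h
    simp only [Finset.mem_singleton, Prod.mk.injEq]
    rcases this with ⟨h1, h2⟩ | ⟨h1, h2⟩ | ⟨h1, h2⟩
    · exact ⟨h1, h2.symm⟩
    · exact ⟨h2.symm, h1⟩
    · exact ⟨h2.symm, (h2.trans h1).symm⟩
  · refine (key {(none, t), (t, none), (t, t)} ?_).trans
      (by exact_mod_cast Finset.card_le_three)
    rintro ⟨r, r'⟩ hx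
    have := (ite_ne_right_iff.1 hx).1
    simp only [Finset.mem_insert, Finset.mem_singleton, Prod.mk.injEq]
    rcases this with ⟨h1, h2⟩ | ⟨h1, h2⟩ | ⟨h1, h2⟩
    · exact Or.inl ⟨h1, h2.symm⟩
    · exact Or.inr (Or.inl ⟨h2.symm, h1⟩)
    · exact Or.inr (Or.inr ⟨h2.symm, (h2.trans h1).symm⟩)

/-- The coefficients of the linear form in the indicators of `Covered`. -/
noncomputable def linCoeff (G : ℕ → ℝ) (R : ℝ) (e : S → Option ι) : ℝ :=
  ∑ d : S → Option ι, sieveCoeff G R d * ∏ p : S, expandFn ((p : ℕ) : ℝ) (d p) (e p)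

/-- The coefficients of the sieve weight in the indicators of `Covered`. -/
noncomputable def monoCoeff (G : ℕ → ℝ) (R : ℝ) (g : S → Option ι) : ℝ :=
  ∑ e : S → Option ι, ∑ f : S → Option ι,
    linCoeff G R e * linCoeff G R f * ∏ p : S, mergeFn (e p) (f p) (g p)

theorem sieveWeight_eq_sum (G : ℕ → ℝ) (R : ℝ) (χ : S → Option ι) :
    sieveWeight G R χ = ∑ g, monoCoeff G R g * if Covered g χ then 1 else 0 := by
  have h1 : ∑ d : S → Option ι, sieveCoeff G R d * ∏ p : S, basisFn ((p : ℕ) : ℝ) (d p) (χ p)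
      = ∑ e : S → Option ι, linCoeff G R e * ∏ p, monoFn (e p) (χ p) := by
    simp only [linCoeff, Finset.sum_mul]
    rw [Finset.sum_comm]
    refine Finset.sum_congr rfl fun d _ => ?_
    simp only [mul_assoc, ← Finset.mul_sum, ← Finset.prod_mul_distrib]
    rw [sum_pi_prod fun (p : S) r => expandFn ((p : ℕ) : ℝ) (d p) r * monoFn r (χ p)]
    simp only [basisFn_eq_sum]
  rw [sieveWeight, h1, sq, Finset.sum_mul_sum]
  simp only [← prod_monoFn, monoCoeff, Finset.sum_mul]
  refine Eq.trans ?_ Finset.sum_comm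
  refine Finset.sum_congr rfl fun e _ => ?_
  refine Eq.trans ?_ Finset.sum_comm
  refine Finset.sum_congr rfl fun f _ => ?_
  simp only [mul_assoc, ← Finset.mul_sum, ← Finset.prod_mul_distrib]
  rw [sum_pi_prod fun (p : S) t => mergeFn (e p) (f p) t * monoFn t (χ p)]
  simp only [← monoFn_mul, Finset.prod_mul_distrib]
  ring

theorem sieveCoeff_ne_zero {G : ℕ → ℝ} {R : ℝ} {d : S → Option ι} (h : sieveCoeff G R d ≠ 0) :
    (colorProd d : ℝ) ≤ R ∧ ∀ i, G (colorPart d i) ≠ 0 := by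
  unfold sieveCoeff at h
  have := ite_ne_right_iff.1 h
  exact ⟨this.1, fun i => Finset.prod_ne_zero_iff.1 this.2 i (Finset.mem_univ i)⟩

theorem linCoeff_ne_zero {G : ℕ → ℝ} {R : ℝ} {e : S → Option ι} (h : linCoeff G R e ≠ 0) :
    ∃ d : S → Option ι, sieveCoeff G R d ≠ 0 ∧ Covered e d := by
  obtain ⟨d, -, hd⟩ := Finset.exists_ne_zero_of_sum_ne_zero h
  refine ⟨d, left_ne_zero_of_mul hd, fun p => ?_⟩
  have := Finset.prod_ne_zero_iff.1 (right_ne_zero_of_mul hd) p (Finset.mem_univ p)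
  by_contra hc
  rw [not_or] at hc
  refine this ?_
  unfold expandFn
  rcases h' : d p with _ | i
  · simp [hc.1]
  · simp [hc.1, h' ▸ hc.2]

theorem Covered.colorProd_le (hS : ∀ p ∈ S, p.Prime) {e d : S → Option ι} (h : Covered e d) :
    colorProd e ≤ colorProd d :=
  subsetProd_mono hS fun p hp => by rwa [← (h p).resolve_left hp]

theorem Covered.colorCard_le {e d : S → Option ι} (h : Covered e d) :
    colorCard e ≤ colorCard d := by
  refine Finset.card_le_card fun p hp => ?_
  simp only [Finset.mem_filter, Finset.mem_univ, true_and] at hp ⊢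
  rwa [← (h p).resolve_left hp]

/-- The support conditions on the coefficients of the linear form. -/
theorem linCoeff_support (hS : ∀ p ∈ S, p.Prime) {G : ℕ → ℝ} {R K : ℝ} (hK : 0 ≤ K)
    (hG : ∀ m, G m ≠ 0 → (2 : ℝ) ^ m.primeFactors.card ≤ K)
    {e : S → Option ι} (h : linCoeff G R e ≠ 0) :
    (colorProd e : ℝ) ≤ R ∧ (2 : ℝ) ^ colorCard e ≤ K ^ Fintype.card ι := by
  obtain ⟨d, hd, hc⟩ := linCoeff_ne_zero h
  obtain ⟨h1, h2⟩ := sieveCoeff_ne_zero hd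
  refine ⟨le_trans (by exact_mod_cast hc.colorProd_le hS) h1, ?_⟩
  calc (2 : ℝ) ^ colorCard e ≤ 2 ^ colorCard d :=
        pow_le_pow_right₀ (by norm_num) hc.colorCard_le
    _ = ∏ i, (2 : ℝ) ^ (colorPart d i).primeFactors.card := by
        rw [colorCard_eq_sum hS, Finset.prod_pow_eq_pow_sum]
    _ ≤ ∏ _i : ι, K := Finset.prod_le_prod (fun _ _ => by positivity) fun i _ => hG _ (h2 i)
    _ = _ := by rw [Finset.prod_const, Finset.card_univ]

/-- A colouring `d` contributes to the coefficient at `e` only if it extends `e`, with weight at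
most the reciprocal of the product of the added primes. Summing over the added part gives at most
one harmonic sum per colour. -/
theorem abs_linCoeff_le (hS : ∀ p ∈ S, p.Prime) {G : ℕ → ℝ} {R : ℝ} {N : ℕ}
    (hG0 : ∀ m, 0 ≤ G m) (hG1 : ∀ m, G m ≤ 1) (hGN : ∀ m, G m ≠ 0 → m ≤ N) (e : S → Option ι) :
    |linCoeff G R e| ≤ (∑ m ∈ Finset.Icc 1 N, 1 / (m : ℝ)) ^ Fintype.card ι := by
  classical
  set D : Finset (S → Option ι) :=
    Finset.univ.filter fun d => sieveCoeff G R d ≠ 0 ∧ Covered e d with hD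
  -- The part of `d` outside `e`. Among extensions of `e` it determines `d`.
  let rest : (S → Option ι) → S → Option ι := fun d p => if e p = none then d p else none
  have hz : ∀ d : S → Option ι, |sieveCoeff G R d| ≤ 1 := by
    intro d
    unfold sieveCoeff
    split_ifs
    · rw [abs_of_nonneg (Finset.prod_nonneg fun i _ => hG0 _)]
      exact Finset.prod_le_one (fun i _ => hG0 _) fun i _ => hG1 _
    · simp
  calc |linCoeff G R e| ≤ ∑ d : S → Option ι,
        |sieveCoeff G R d * ∏ p : S, expandFn ((p : ℕ) : ℝ) (d p) (e p)| :=
        Finset.abs_sum_le_sum_abs _ _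
    _ = ∑ d ∈ D, |sieveCoeff G R d * ∏ p : S, expandFn ((p : ℕ) : ℝ) (d p) (e p)| := by
        refine (Finset.sum_subset (Finset.subset_univ _) fun d _ hd => ?_).symm
        by_contra h
        refine hd (Finset.mem_filter.2 ⟨Finset.mem_univ _, ?_, fun p => ?_⟩)
        · exact left_ne_zero_of_mul (abs_ne_zero.1 h)
        · have := Finset.prod_ne_zero_iff.1 (right_ne_zero_of_mul (abs_ne_zero.1 h)) p
            (Finset.mem_univ p)
          by_contra hc
          rw [not_or] at hc
          refine this ?_
          unfold expandFn
          rcases h' : d p with _ | i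
          · simp [hc.1]
          · simp [hc.1, h' ▸ hc.2]
    _ ≤ ∑ d ∈ D, ∏ i, (1 / (colorPart (rest d) i : ℝ)) := by
        refine Finset.sum_le_sum fun d hd => ?_
        have hc := (Finset.mem_filter.1 hd).2.2
        rw [abs_mul]
        refine (mul_le_of_le_one_left (abs_nonneg _) (hz d)).trans (le_of_eq ?_)
        rw [Finset.prod_div_distrib, Finset.prod_const_one, ← Nat.cast_prod, ← colorProd_eq_prod,
          colorProd, subsetProd, Nat.cast_prod, one_div, ← Finset.prod_inv_distrib,
          Finset.abs_prod]
        refine Finset.prod_congr rfl fun p _ => ?_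
        have hcp := hc p
        rcases h : e p with _ | i
        · rcases h' : d p with _ | i
          · simp [rest, h, h', expandFn]
          · simp [rest, h, h', expandFn]
        · have : d p = some i := by rw [h] at hcp; exact (hcp.resolve_left (by simp)).symm
          simp [rest, h, this, expandFn]
    _ = ∑ d ∈ D.image rest, ∏ i, (1 / (colorPart d i : ℝ)) := by
        rw [Finset.sum_image]
        intro d hd d' hd' h
        have hc := (Finset.mem_filter.1 hd).2.2
        have hc' := (Finset.mem_filter.1 hd').2.2
        funext p
        have hp := congrFun h p
        simp only [rest] at hp
        split_ifs at hp with h0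
        · exact hp
        · rw [← (hc p).resolve_left h0, ← (hc' p).resolve_left h0]
    _ ≤ ∏ _i : ι, ∑ m ∈ Finset.Icc 1 N, 1 / (m : ℝ) := by
        refine sum_prod_colorPart_le hS _ (fun _ => Finset.Icc 1 N) ?_
          (fun _ m => 1 / (m : ℝ)) fun _ m => by positivity
        intro d' hd' i
        obtain ⟨d, hd, rfl⟩ := Finset.mem_image.1 hd'
        have hd := (Finset.mem_filter.1 hd).2.1
        refine Finset.mem_Icc.2 ⟨colorPart_pos hS _ _, ?_⟩
        refine le_trans (subsetProd_mono hS (fun p hp => ?_)) (hGN _ ((sieveCoeff_ne_zero hd).2 i))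
        simp only [rest] at hp
        split_ifs at hp
        exact hp
    _ = _ := by rw [Finset.prod_const, Finset.card_univ]

/-- Support and size of the coefficients of the sieve weight. -/
theorem monoCoeff_bounds (hS : ∀ p ∈ S, p.Prime) {G : ℕ → ℝ} {R K : ℝ} {N : ℕ} (hK : 0 ≤ K)
    (hR : 0 ≤ R) (hG0 : ∀ m, 0 ≤ G m) (hG1 : ∀ m, G m ≤ 1) (hGN : ∀ m, G m ≠ 0 → m ≤ N)
    (hGK : ∀ m, G m ≠ 0 → (2 : ℝ) ^ m.primeFactors.card ≤ K)
    {g : S → Option ι} (h : monoCoeff G R g ≠ 0) :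
    (colorProd g : ℝ) ≤ R ^ 2 ∧ (2 : ℝ) ^ colorCard g ≤ K ^ (2 * Fintype.card ι) ∧
    |monoCoeff G R g| ≤ (∑ m ∈ Finset.Icc 1 N, 1 / (m : ℝ)) ^ (2 * Fintype.card ι)
      * K ^ (4 * Fintype.card ι) := by
  have hcard : ∃ e f : S → Option ι, (linCoeff G R e ≠ 0 ∧ linCoeff G R f ≠ 0) ∧
      ∀ p, mergeFn (e p) (f p) (g p) ≠ 0 := by
    obtain ⟨e, -, he⟩ := Finset.exists_ne_zero_of_sum_ne_zero h
    obtain ⟨f, -, hf⟩ := Finset.exists_ne_zero_of_sum_ne_zero he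
    have := left_ne_zero_of_mul hf
    exact ⟨e, f, ⟨left_ne_zero_of_mul this, right_ne_zero_of_mul this⟩, fun p =>
      Finset.prod_ne_zero_iff.1 (right_ne_zero_of_mul hf) p (Finset.mem_univ p)⟩
  have hsup : (colorProd g : ℝ) ≤ R ^ 2 ∧ (2 : ℝ) ^ colorCard g ≤ K ^ (2 * Fintype.card ι) := by
    obtain ⟨e, f, ⟨he, hf⟩, hm⟩ := hcard
    obtain ⟨e1, e2⟩ := linCoeff_support hS hK hGK he
    obtain ⟨f1, f2⟩ := linCoeff_support hS hK hGK hf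
    have hgp : ∀ p, g p ≠ none → e p ≠ none ∨ f p ≠ none := by
      intro p hp
      have := (ite_ne_right_iff.1 (hm p)).1
      by_contra hc
      push Not at hc
      rw [hc.1, hc.2] at this
      tauto
    constructor
    · have : colorProd g ≤ colorProd e * colorProd f := by
        unfold colorProd subsetProd
        rw [← Finset.prod_mul_distrib]
        refine Finset.prod_le_prod' fun p _ => ?_
        have hpos := (hS p p.2).pos
        have := hgp p
        split_ifs with h1 h2 h3 <;> first | nlinarith | skip
        tauto
      calc (colorProd g : ℝ) ≤ colorProd e * colorProd f := by exact_mod_cast this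
        _ ≤ R * R := by gcongr
        _ = R ^ 2 := by ring
    · have : colorCard g ≤ colorCard e + colorCard f := by
        unfold colorCard
        refine le_trans (Finset.card_le_card fun p hp => ?_) (Finset.card_union_le _ _)
        simp only [Finset.mem_filter, Finset.mem_univ, true_and, Finset.mem_union] at hp ⊢
        exact hgp p hp
      calc (2 : ℝ) ^ colorCard g ≤ 2 ^ (colorCard e + colorCard f) :=
            pow_le_pow_right₀ (by norm_num) this
        _ = 2 ^ colorCard e * 2 ^ colorCard f := pow_add _ _ _
        _ ≤ K ^ Fintype.card ι * K ^ Fintype.card ι := by gcongr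
        _ = _ := by rw [← pow_add, two_mul]
  refine ⟨hsup.1, hsup.2, ?_⟩
  set Λ := (∑ m ∈ Finset.Icc 1 N, 1 / (m : ℝ)) ^ Fintype.card ι with hΛ
  have hΛ0 : 0 ≤ Λ := by positivity
  have hl := fun e : S → Option ι => abs_linCoeff_le hS (R := R) hG0 hG1 hGN e
  calc |monoCoeff G R g| ≤ ∑ e : S → Option ι, ∑ f : S → Option ι,
        |linCoeff G R e * linCoeff G R f * ∏ p : S, mergeFn (e p) (f p) (g p)| :=
        (Finset.abs_sum_le_sum_abs _ _).trans
          (Finset.sum_le_sum fun e _ => Finset.abs_sum_le_sum_abs _ _)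
    _ ≤ ∑ e : S → Option ι, ∑ f : S → Option ι,
        Λ ^ 2 * ∏ p : S, mergeFn (e p) (f p) (g p) := by
        refine Finset.sum_le_sum fun e _ => Finset.sum_le_sum fun f _ => ?_
        have hm0 : 0 ≤ ∏ p : S, mergeFn (e p) (f p) (g p) :=
          Finset.prod_nonneg fun p _ => mergeFn_nonneg _ _ _
        rw [abs_mul, abs_mul, abs_of_nonneg hm0, sq]
        gcongr
        exacts [hl e, hl f]
    _ = Λ ^ 2 * ∏ p : S, ∑ r, ∑ r', mergeFn r r' (g p) := by
        simp only [← Finset.mul_sum]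
        rw [← sum_pi_prod fun (p : S) r => ∑ r', mergeFn r r' (g p)]
        congr 1
        refine Finset.sum_congr rfl fun e _ => ?_
        rw [sum_pi_prod fun (p : S) r' => mergeFn (e p) r' (g p)]
    -- The bound `3` per coloured prime is enlarged to `4 = 2^2`, so that the product is a power of
    -- the controlled quantity `2 ^ colorCard g`.
    _ ≤ Λ ^ 2 * ∏ p : S, if g p ≠ none then (4 : ℝ) else 1 := by
        refine mul_le_mul_of_nonneg_left (Finset.prod_le_prod (fun p _ =>
          Finset.sum_nonneg fun r _ => Finset.sum_nonneg fun r' _ => mergeFn_nonneg _ _ _)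
          fun p _ => (sum_mergeFn_le _).trans ?_) (by positivity)
        by_cases h : g p = none <;> simp [h]; norm_num
    _ = Λ ^ 2 * (2 ^ colorCard g) ^ 2 := by
        have h4 : ∀ n : ℕ, (4 : ℝ) ^ n = (2 ^ n) ^ 2 := fun n => by
          rw [← pow_mul, mul_comm, pow_mul]; norm_num
        rw [← Finset.prod_filter, Finset.prod_const, colorCard, h4]
    _ ≤ Λ ^ 2 * (K ^ (2 * Fintype.card ι)) ^ 2 := by gcongr; exact hsup.2
    _ = _ := by rw [hΛ, ← pow_mul, ← pow_mul]; ring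

end Monomials

/-! ### Sums over integers coprime to `W`, and over multiples. -/

section CoprimeSums

/-- The positive integers up to `N` that are coprime to `W`. -/
def coprimeUpto (W N : ℕ) : Finset ℕ := (Finset.Icc 1 N).filter fun m => m.Coprime W

theorem mem_coprimeUpto {W N m : ℕ} : m ∈ coprimeUpto W N ↔ (1 ≤ m ∧ m ≤ N) ∧ m.Coprime W := by
  simp [coprimeUpto]

/-- Write the multiples as `q m'`. The cofactor `m'` is again coprime to `W` and at most `N`, and
the submultiplicativity of `h` extracts `1/q`. It serves as the statement that `q` divides a random
integer with probability at most `1/q`. -/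
theorem sum_coprimeUpto_dvd_le (W N : ℕ) {q : ℕ} (hq : 0 < q) (h : ℕ → ℝ) (h0 : ∀ m, 0 ≤ h m)
    (hmul : ∀ m, 1 ≤ m → h (q * m) ≤ 1 / q * h m) :
    ∑ m ∈ coprimeUpto W N, h m * (if q ∣ m then 1 else 0) ≤ 1 / q * ∑ m ∈ coprimeUpto W N, h m := by
  simp only [mul_ite, mul_one, mul_zero]
  rw [← Finset.sum_filter, Finset.mul_sum]
  calc _ = ∑ m ∈ ((coprimeUpto W N).filter (q ∣ ·)).image (· / q), h (q * m) := by
        rw [Finset.sum_image]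
        · refine Finset.sum_congr rfl fun m hm => ?_
          rw [Nat.mul_div_cancel' (Finset.mem_filter.1 hm).2]
        · intro m hm m' hm' he
          have h1 := (Finset.mem_filter.1 hm).2
          have h2 := (Finset.mem_filter.1 hm').2
          rw [← Nat.mul_div_cancel' h1, ← Nat.mul_div_cancel' h2]
          simp only at he
          rw [he]
    _ ≤ ∑ m ∈ ((coprimeUpto W N).filter (q ∣ ·)).image (· / q), 1 / q * h m := by
        refine Finset.sum_le_sum fun m hm => hmul m ?_
        obtain ⟨m', hm', rfl⟩ := Finset.mem_image.1 hm
        obtain ⟨h1, h2⟩ := Finset.mem_filter.1 hm'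
        exact Nat.div_pos (Nat.le_of_dvd (mem_coprimeUpto.1 h1).1.1 h2) hq
    _ ≤ _ := by
        refine Finset.sum_le_sum_of_subset_of_nonneg ?_ fun m _ _ => mul_nonneg (by positivity) (h0 m)
        intro m hm
        obtain ⟨m', hm', rfl⟩ := Finset.mem_image.1 hm
        obtain ⟨h1, h2⟩ := Finset.mem_filter.1 hm'
        rw [mem_coprimeUpto] at h1 ⊢
        exact ⟨⟨Nat.div_pos (Nat.le_of_dvd h1.1.1 h2) hq, (Nat.div_le_self _ _).trans h1.1.2⟩,
          h1.2.of_dvd_left (Nat.div_dvd_of_dvd h2)⟩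

theorem two_pow_card_primeFactors_le {m : ℕ} (hm : m ≠ 0) :
    2 ^ m.primeFactors.card ≤ m.divisors.card := by
  rw [← Finset.card_powerset]
  refine Finset.card_le_card_of_injOn (fun s => ∏ p ∈ s, p) ?_ ?_
  · intro s hs
    have hs := Finset.mem_powerset.1 (Finset.mem_coe.1 hs)
    exact Finset.mem_coe.2 (Nat.mem_divisors.2 ⟨(Finset.prod_dvd_prod_of_subset _ _ _ hs).trans
      (Nat.prod_primeFactors_dvd m), hm⟩)
  · intro s hs t ht h
    have hs := Finset.mem_powerset.1 (Finset.mem_coe.1 hs)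
    have ht := Finset.mem_powerset.1 (Finset.mem_coe.1 ht)
    rw [← Nat.primeFactors_prod (s := s) fun p hp => (Nat.mem_primeFactors.1 (hs hp)).1,
      ← Nat.primeFactors_prod (s := t) fun p hp => (Nat.mem_primeFactors.1 (ht hp)).1]
    exact congrArg _ h

/-- `2^ω(m)` is at most the number of factorizations `m = a b`, and each such pair occurs once in
the square of the harmonic sum. This feeds the Rankin bounds for integers with many prime factors.
-/
theorem sum_two_pow_card_div_le (N : ℕ) :
    ∑ m ∈ Finset.Icc 1 N, (2 : ℝ) ^ m.primeFactors.card / m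
      ≤ (∑ m ∈ Finset.Icc 1 N, 1 / (m : ℝ)) ^ 2 := by
  calc _ ≤ ∑ m ∈ Finset.Icc 1 N, ∑ x ∈ m.divisorsAntidiagonal, 1 / (x.1 : ℝ) * (1 / (x.2 : ℝ)) := by
        refine Finset.sum_le_sum fun m hm => ?_
        have hm0 : m ≠ 0 := by have := (Finset.mem_Icc.1 hm).1; omega
        rw [Finset.sum_congr rfl (g := fun _ => 1 / (m : ℝ)) fun x hx => ?_]
        · rw [Finset.sum_const, ← Nat.map_div_right_divisors, Finset.card_map, nsmul_eq_mul, mul_one_div]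
          gcongr
          exact_mod_cast two_pow_card_primeFactors_le hm0
        · rw [← (Nat.mem_divisorsAntidiagonal.1 hx).1]; push_cast; rw [one_div_mul_one_div]
    _ = ∑ x ∈ (Finset.Icc 1 N).sigma fun m => m.divisorsAntidiagonal,
          1 / (x.2.1 : ℝ) * (1 / (x.2.2 : ℝ)) := by rw [Finset.sum_sigma]
    _ = ∑ x ∈ ((Finset.Icc 1 N).sigma fun m => m.divisorsAntidiagonal).image (fun x => x.2),
          1 / (x.1 : ℝ) * (1 / (x.2 : ℝ)) := by
        rw [Finset.sum_image]
        rintro ⟨m, x⟩ hx ⟨m', x'⟩ hx' h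
        simp only [Finset.coe_sigma, Set.mem_sigma_iff, Finset.mem_coe,
          Nat.mem_divisorsAntidiagonal] at hx hx' h
        subst h
        obtain rfl : m = m' := hx.2.1.symm.trans hx'.2.1
        rfl
    _ ≤ ∑ x ∈ Finset.Icc 1 N ×ˢ Finset.Icc 1 N, 1 / (x.1 : ℝ) * (1 / (x.2 : ℝ)) := by
        refine Finset.sum_le_sum_of_subset_of_nonneg ?_ fun _ _ _ => by positivity
        intro x hx
        obtain ⟨⟨m, y⟩, h, rfl⟩ := Finset.mem_image.1 hx
        simp only [Finset.mem_sigma, Finset.mem_Icc, Nat.mem_divisorsAntidiagonal] at h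
        obtain ⟨⟨h1, h2⟩, h3, h4⟩ := h
        have h5 : y.1 ≠ 0 := fun h => by rw [h, zero_mul] at h3; omega
        have h6 : y.2 ≠ 0 := fun h => by rw [h, mul_zero] at h3; omega
        have h7 : y.1 ≤ m := by rw [← h3]; exact Nat.le_mul_of_pos_right _ (by omega)
        have h8 : y.2 ≤ m := by rw [← h3]; exact Nat.le_mul_of_pos_left _ (by omega)
        simp only [Finset.mem_product, Finset.mem_Icc]
        omega
    _ = _ := by rw [sq, Finset.sum_mul_sum, Finset.sum_product]

end CoprimeSums

/-! ### Moments under a product of discrete measures. -/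

section ProductMeasure

variable {ι : Type} [Fintype ι] [DecidableEq ι]

/-- Expectation under a product of finitely supported weights. -/
noncomputable def prodExpect (A : ι → Finset ℕ) (w : ι → ℕ → ℝ) (F : (ι → ℕ) → ℝ) : ℝ :=
  ∑ n ∈ Fintype.piFinset A, (∏ i, w i (n i)) * F n

theorem prodExpect_prod (A : ι → Finset ℕ) (w f : ι → ℕ → ℝ) :
    prodExpect A w (fun n => ∏ i, f i (n i)) = ∏ i, ∑ m ∈ A i, w i m * f i m := by
  unfold prodExpect
  rw [Finset.prod_univ_sum]
  simp only [Finset.prod_mul_distrib]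

theorem prodExpect_one (A : ι → Finset ℕ) (w : ι → ℕ → ℝ) (hw : ∀ i, ∑ m ∈ A i, w i m = 1) :
    prodExpect A w (fun _ => 1) = 1 := by
  have := prodExpect_prod A w fun _ _ => 1
  simpa [hw] using this

theorem prodExpect_single (A : ι → Finset ℕ) (w : ι → ℕ → ℝ) (hw : ∀ i, ∑ m ∈ A i, w i m = 1)
    (i : ι) (f : ℕ → ℝ) :
    prodExpect A w (fun n => f (n i)) = ∑ m ∈ A i, w i m * f m := by
  have := prodExpect_prod A w fun i' m => if i' = i then f m else 1
  simp only [Finset.prod_ite_eq', Finset.mem_univ, if_true, mul_ite, mul_one] at this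
  rw [this, Finset.prod_eq_single i]
  · simp
  · intro i' _ h
    simp [h, hw]
  · simp

theorem prodExpect_pair (A : ι → Finset ℕ) (w : ι → ℕ → ℝ) (hw : ∀ i, ∑ m ∈ A i, w i m = 1)
    {i l : ι} (hil : i ≠ l) (f g : ℕ → ℝ) :
    prodExpect A w (fun n => f (n i) * g (n l))
      = (∑ m ∈ A i, w i m * f m) * ∑ m ∈ A l, w l m * g m := by
  have := prodExpect_prod A w fun i' m => (if i' = i then f m else 1) * (if i' = l then g m else 1)
  simp only [Finset.prod_mul_distrib, Finset.prod_ite_eq', Finset.mem_univ, if_true] at this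
  rw [this]
  rw [← Finset.mul_prod_erase _ _ (Finset.mem_univ i),
    ← Finset.mul_prod_erase _ _ (Finset.mem_erase.2 ⟨hil.symm, Finset.mem_univ l⟩),
    Finset.prod_eq_one, mul_one]
  · congr 1
    · simp [hil]
    · simp [hil.symm]
  · intro x hx
    simp only [Finset.mem_erase, Finset.mem_univ, and_true] at hx
    simp [hx.1, hx.2, hw]

theorem prodExpect_add (A : ι → Finset ℕ) (w : ι → ℕ → ℝ) (F H : (ι → ℕ) → ℝ) :
    prodExpect A w (fun n => F n + H n) = prodExpect A w F + prodExpect A w H := by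
  simp only [prodExpect, mul_add, Finset.sum_add_distrib]

theorem prodExpect_const_mul (A : ι → Finset ℕ) (w : ι → ℕ → ℝ) (c : ℝ) (F : (ι → ℕ) → ℝ) :
    prodExpect A w (fun n => c * F n) = c * prodExpect A w F := by
  simp only [prodExpect, Finset.mul_sum]
  exact Finset.sum_congr rfl fun _ _ => by ring

theorem prodExpect_sum {κ : Type} (s : Finset κ) (A : ι → Finset ℕ) (w : ι → ℕ → ℝ)
    (F : κ → (ι → ℕ) → ℝ) :
    prodExpect A w (fun n => ∑ x ∈ s, F x n) = ∑ x ∈ s, prodExpect A w (F x) := by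
  simp only [prodExpect, Finset.mul_sum]
  rw [Finset.sum_comm]

/-- Independent centred variables: the variance is additive. -/
theorem prodExpect_sq_sum_le (A : ι → Finset ℕ) (w : ι → ℕ → ℝ)
    (hw : ∀ i, ∑ m ∈ A i, w i m = 1) (f : ι → ℕ → ℝ) (hf : ∀ i, ∑ m ∈ A i, w i m * f i m = 0) :
    prodExpect A w (fun n => (∑ i, f i (n i)) ^ 2) = ∑ i, ∑ m ∈ A i, w i m * f i m ^ 2 := by
  simp only [sq, Finset.sum_mul_sum]
  rw [prodExpect_sum]
  refine Finset.sum_congr rfl fun i _ => ?_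
  rw [prodExpect_sum, Finset.sum_eq_single i]
  · exact prodExpect_single A w hw i fun m => f i m * f i m
  · intro l _ hl
    rw [prodExpect_pair A w hw hl.symm, hf, zero_mul]
  · simp

end ProductMeasure

/-! ### The weights `1/(m (L + log m)^a)` and their sieved sums. -/

section LogWeights

/-- `1 / (m (L + log m)^a)`. -/
noncomputable def logWeight (a : ℕ) (L : ℝ) (m : ℕ) : ℝ := 1 / (m * (L + Real.log m) ^ a)

theorem logWeight_nonneg (a : ℕ) {L : ℝ} (hL : 0 ≤ L) (m : ℕ) : 0 ≤ logWeight a L m := by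
  have := Real.log_natCast_nonneg m
  unfold logWeight; positivity

theorem logWeight_mul_le (a : ℕ) {L : ℝ} (hL : 0 < L) {q : ℕ} (hq : 0 < q) (m : ℕ) (hm : 1 ≤ m) :
    logWeight a L (q * m) ≤ 1 / q * logWeight a L m := by
  unfold logWeight
  have h1 := Real.log_natCast_nonneg m
  have hm' : (0 : ℝ) < m := by exact_mod_cast hm
  have hq' : (0 : ℝ) < q := by exact_mod_cast hq
  have h2 : Real.log m ≤ Real.log (q * m : ℕ) :=
    Real.log_le_log hm' (by exact_mod_cast Nat.le_mul_of_pos_left m hq)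
  rw [one_div_mul_one_div]
  push_cast at h2 ⊢
  rw [mul_assoc]
  gcongr

theorem logWeight_succ_mul (a : ℕ) {L : ℝ} (hL : 0 < L) (m : ℕ) :
    logWeight (a + 1) L m * (L + Real.log m) = logWeight a L m := by
  unfold logWeight
  have h1 := Real.log_natCast_nonneg m
  rcases Nat.eq_zero_or_pos m with rfl | hm
  · simp
  have hm' : (0 : ℝ) < m := by exact_mod_cast hm
  field_simp
  ring

theorem logWeight_succ_le (a : ℕ) {L : ℝ} (hL : 0 < L) (m : ℕ) :
    logWeight (a + 1) L m ≤ 1 / L * logWeight a L m := by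
  rw [← logWeight_succ_mul a hL, one_div, ← div_eq_inv_mul, le_div_iff₀ hL]
  exact mul_le_mul_of_nonneg_left (by linarith [Real.log_natCast_nonneg m])
    (logWeight_nonneg _ hL.le m)

theorem logWeight_zero (L : ℝ) (m : ℕ) : logWeight 0 L m = 1 / m := by simp [logWeight]

/-- The sum of `logWeight a L` over the integers up to `N` coprime to `W`. -/
noncomputable def logSum (W N : ℕ) (a : ℕ) (L : ℝ) : ℝ := ∑ m ∈ coprimeUpto W N, logWeight a L m

/-- The profile `1/(L + log m)` is the near-optimal one-variable choice in the sieve: `G(m)/m` and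
`G(m)^2/m` are `logWeight 1` and `logWeight 2`. The cut `2^ω(m) ≤ K` keeps all coefficients below a
power of `K` and of `log N`. -/
noncomputable def truncG (L K : ℝ) (N m : ℕ) : ℝ :=
  if m ≤ N ∧ (2 : ℝ) ^ m.primeFactors.card ≤ K then 1 / (L + Real.log m) else 0

theorem truncG_nonneg {L : ℝ} (hL : 0 ≤ L) (K : ℝ) (N m : ℕ) : 0 ≤ truncG L K N m := by
  have := Real.log_natCast_nonneg m
  unfold truncG; split_ifs <;> positivity

/-- The sum of `logWeight 1 L` over squarefree integers coprime to the `n i` with few prime factors is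
almost the full sum. -/
theorem sum_sieved_ge {ι : Type} [Fintype ι] {S : Finset ℕ} {W N : ℕ} (hS : ∀ p ∈ S, p.Prime)
    (hWS : ∀ p, p.Prime → p ≤ N → p.Coprime W → p ∈ S) {L K : ℝ} (hL : 0 < L) (hK : 0 < K)
    (n : ι → ℕ) :
    logSum W N 1 L * (1 - ∑ p ∈ S, 1 / (p : ℝ) ^ 2
        - ∑ i, ∑ p ∈ S, (if p ∣ n i then 1 / (p : ℝ) else 0))
        - (∑ m ∈ Finset.Icc 1 N, 1 / (m : ℝ)) ^ 2 / (L * K)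
      ≤ ∑ m ∈ (coprimeUpto W N).filter fun m => Squarefree m ∧ (∀ i, m.Coprime (n i)) ∧
          (2 : ℝ) ^ m.primeFactors.card ≤ K, logWeight 1 L m := by
  classical
  have hpos : ∀ p ∈ S, 0 < p := fun p hp => (hS p hp).pos
  have hw0 := logWeight_nonneg 1 hL.le
  -- A pointwise union bound. A discarded `m` has a square factor `p^2`, or shares a prime with some
  -- `n i`, or satisfies `2^ω(m) > K`; the last case is charged by Rankin's trick as `2^ω(m)/K`.
  have h1 : ∀ m ∈ coprimeUpto W N, logWeight 1 L m -
      ∑ p ∈ S, logWeight 1 L m * (if p ^ 2 ∣ m then 1 else 0) -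
      ∑ i, ∑ p ∈ S, (if p ∣ n i then 1 else 0) * (logWeight 1 L m * (if p ∣ m then 1 else 0)) -
      1 / (L * K) * ((2 : ℝ) ^ m.primeFactors.card / m) ≤
      if Squarefree m ∧ (∀ i, m.Coprime (n i)) ∧ (2 : ℝ) ^ m.primeFactors.card ≤ K
        then logWeight 1 L m else 0 := by
    intro m hm
    obtain ⟨⟨hm1, hmN⟩, hmW⟩ := mem_coprimeUpto.1 hm
    have hm0 : (0 : ℝ) < m := by exact_mod_cast hm1
    have t1 : 0 ≤ ∑ p ∈ S, logWeight 1 L m * (if p ^ 2 ∣ m then (1 : ℝ) else 0) :=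
      Finset.sum_nonneg fun p _ => mul_nonneg (hw0 m) (by split_ifs <;> norm_num)
    have t2' : ∀ i, 0 ≤ ∑ p ∈ S, (if p ∣ n i then (1 : ℝ) else 0) *
        (logWeight 1 L m * (if p ∣ m then 1 else 0)) := fun i =>
      Finset.sum_nonneg fun p _ => mul_nonneg (by split_ifs <;> norm_num)
        (mul_nonneg (hw0 m) (by split_ifs <;> norm_num))
    have t2 := Finset.sum_nonneg fun i (_ : i ∈ Finset.univ) => t2' i
    have t3 : 0 ≤ 1 / (L * K) * ((2 : ℝ) ^ m.primeFactors.card / m) := by positivity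
    have inS : ∀ p, p.Prime → p ∣ m → p ∈ S := fun p hp hpm =>
      hWS p hp ((Nat.le_of_dvd hm1 hpm).trans hmN) (hmW.of_dvd_left hpm)
    split_ifs with h
    · linarith
    · rw [not_and_or, not_and_or] at h
      rcases h with h | h | h
      · rw [Nat.squarefree_iff_prime_squarefree] at h
        push Not at h
        obtain ⟨p, hp, hpm⟩ := h
        have := Finset.single_le_sum (f := fun p => logWeight 1 L m *
          (if p ^ 2 ∣ m then (1 : ℝ) else 0)) (fun p _ => mul_nonneg (hw0 m)
          (by split_ifs <;> norm_num)) (inS p hp ((dvd_mul_right p p).trans hpm))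
        rw [← sq] at hpm
        simp only [hpm, if_true, mul_one] at this
        linarith
      · push Not at h
        obtain ⟨i, hi⟩ := h
        obtain ⟨p, hp, hpm, hpn⟩ := Nat.Prime.not_coprime_iff_dvd.1 hi
        have h1 := Finset.single_le_sum (f := fun i => ∑ p ∈ S, (if p ∣ n i then (1 : ℝ) else 0) *
          (logWeight 1 L m * (if p ∣ m then 1 else 0))) (fun i _ => t2' i) (Finset.mem_univ i)
        have h2 := Finset.single_le_sum (f := fun p => (if p ∣ n i then (1 : ℝ) else 0) *
          (logWeight 1 L m * (if p ∣ m then 1 else 0))) (fun p _ => mul_nonneg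
          (by split_ifs <;> norm_num) (mul_nonneg (hw0 m) (by split_ifs <;> norm_num)))
          (inS p hp hpm)
        simp only [hpn, hpm, if_true, mul_one, one_mul] at h1 h2
        linarith
      · have h4 : logWeight 1 L m ≤ 1 / (L * K) * ((2 : ℝ) ^ m.primeFactors.card / m) := by
          refine (logWeight_succ_le 0 hL m).trans ?_
          rw [logWeight_zero, one_div_mul_one_div, div_mul_div_comm, one_mul,
            div_le_div_iff₀ (by positivity) (by positivity), one_mul]
          have := mul_le_mul_of_nonneg_left (not_le.1 h).le (show 0 ≤ L * m by positivity)
          linarith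
        linarith
  rw [Finset.sum_filter]
  refine le_trans ?_ (Finset.sum_le_sum h1)
  simp only [Finset.sum_sub_distrib]
  have e1 : ∑ m ∈ coprimeUpto W N, ∑ p ∈ S, logWeight 1 L m * (if p ^ 2 ∣ m then (1 : ℝ) else 0)
      ≤ logSum W N 1 L * ∑ p ∈ S, 1 / (p : ℝ) ^ 2 := by
    rw [Finset.sum_comm, Finset.mul_sum]
    refine Finset.sum_le_sum fun p hp => ?_
    have := sum_coprimeUpto_dvd_le W N (pow_pos (hpos p hp) 2) _ hw0
      (logWeight_mul_le 1 hL (pow_pos (hpos p hp) 2))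
    rw [mul_comm]
    simpa [logSum] using this
  have e2 : ∑ m ∈ coprimeUpto W N, ∑ i, ∑ p ∈ S, (if p ∣ n i then (1 : ℝ) else 0) *
      (logWeight 1 L m * (if p ∣ m then 1 else 0))
      ≤ logSum W N 1 L * ∑ i, ∑ p ∈ S, (if p ∣ n i then 1 / (p : ℝ) else 0) := by
    rw [Finset.sum_comm, Finset.mul_sum]
    refine Finset.sum_le_sum fun i _ => ?_
    rw [Finset.sum_comm, Finset.mul_sum]
    refine Finset.sum_le_sum fun p hp => ?_
    rw [← Finset.mul_sum]
    have := sum_coprimeUpto_dvd_le W N (hpos p hp) _ hw0 (logWeight_mul_le 1 hL (hpos p hp))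
    split_ifs
    · rw [one_mul, mul_comm (logSum _ _ _ _)]; exact this
    · simp
  have e3 : ∑ m ∈ coprimeUpto W N, 1 / (L * K) * ((2 : ℝ) ^ m.primeFactors.card / m)
      ≤ (∑ m ∈ Finset.Icc 1 N, 1 / (m : ℝ)) ^ 2 / (L * K) := by
    rw [← Finset.mul_sum]
    refine (mul_le_mul_of_nonneg_left (le_trans ?_ (sum_two_pow_card_div_le N))
      (by positivity)).trans (le_of_eq (by ring))
    exact Finset.sum_le_sum_of_subset_of_nonneg (Finset.filter_subset _ _)
      fun _ _ _ => by positivity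
  have : logSum W N 1 L = ∑ m ∈ coprimeUpto W N, logWeight 1 L m := rfl
  rw [← this]
  linarith

end LogWeights

/-! ### Tuples of integers and their colourings. -/

section Tuples

variable {ι : Type} [Fintype ι] [DecidableEq ι] {S : Finset ℕ}

open Classical in
/-- The colouring of `S` in which `p` has colour `i` when `p ∣ n i`. -/
noncomputable def tupleColoring (S : Finset ℕ) (n : ι → ℕ) (p : S) : Option ι :=
  if h : ∃ i, (p : ℕ) ∣ n i then some h.choose else none

theorem tupleColoring_eq_some (hS : ∀ p ∈ S, p.Prime) {n : ι → ℕ}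
    (hn : ∀ i l, i ≠ l → (n i).Coprime (n l)) (p : S) (i : ι) :
    tupleColoring S n p = some i ↔ (p : ℕ) ∣ n i := by
  unfold tupleColoring
  split_ifs with h
  · rw [Option.some.injEq]
    constructor
    · rintro rfl; exact h.choose_spec
    · intro hi
      by_contra hne
      exact Nat.not_coprime_of_dvd_of_dvd (hS p p.2).one_lt h.choose_spec hi (hn _ _ hne)
  · simp only [reduceCtorEq, false_iff]
    exact fun hi => h ⟨i, hi⟩

theorem tupleColoring_eq_none (n : ι → ℕ) (p : S) :
    tupleColoring S n p = none ↔ ∀ i, ¬ (p : ℕ) ∣ n i := by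
  unfold tupleColoring
  split_ifs with h
  · simpa using h
  · simpa using h

theorem colorPart_tupleColoring (hS : ∀ p ∈ S, p.Prime) {n : ι → ℕ}
    (hn : ∀ i l, i ≠ l → (n i).Coprime (n l)) (i : ι) (hsq : Squarefree (n i))
    (hin : ∀ p, p.Prime → p ∣ n i → p ∈ S) :
    colorPart (tupleColoring S n) i = n i := by
  unfold colorPart
  simp only [tupleColoring_eq_some hS hn]
  exact subsetProd_dvd_eq hS hsq hin

/-- Conditions under which a tuple of integers occurs in the support of the sieve weight. -/
structure GoodTuple (S : Finset ℕ) (j : ι) (N : ℕ) (K R : ℝ) (n : ι → ℕ) : Prop where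
  one : n j = 1
  sq : ∀ i, Squarefree (n i)
  le : ∀ i, n i ≤ N
  mem : ∀ i, ∀ p, p.Prime → p ∣ n i → p ∈ S
  cop : ∀ i l, i ≠ l → (n i).Coprime (n l)
  card : ∀ i, (2 : ℝ) ^ (n i).primeFactors.card ≤ K
  prod : ((∏ i, n i : ℕ) : ℝ) * N ≤ R

theorem lowerFn_nonneg (j : ι) {p : ℝ} (hp : 0 ≤ p) (t u : Option ι) : 0 ≤ lowerFn j p t u := by
  unfold lowerFn
  cases u
  · simp only; split_ifs <;> positivity
  · simp only; split_ifs <;> norm_num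

/-- Only the colourings that come from replacing the entry `n j = 1` by an admissible `m` are kept;
the other terms are nonnegative. For these the primes of `m` have colour `j`, so the product of
`lowerFn` is `1/m`. The condition `∏ n i * N ≤ R` makes the cut at `R` inactive. -/
theorem inner_sum_ge (hS : ∀ p ∈ S, p.Prime) {W N : ℕ}
    (hWS : ∀ p, p.Prime → p ≤ N → p.Coprime W → p ∈ S) {L K R : ℝ} (hL : 0 < L)
    {j : ι} {n : ι → ℕ} (hn : GoodTuple S j N K R n) :
    (∏ i ∈ Finset.univ.erase j, 1 / (L + Real.log (n i))) *
      ∑ m ∈ (coprimeUpto W N).filter fun m => Squarefree m ∧ (∀ i, m.Coprime (n i)) ∧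
          (2 : ℝ) ^ m.primeFactors.card ≤ K, logWeight 1 L m
      ≤ ∑ d : S → Option ι, sieveCoeff (truncG L K N) R d *
          ∏ p : S, lowerFn j ((p : ℕ) : ℝ) (d p) (tupleColoring S n p) := by
  classical
  set B := (coprimeUpto W N).filter fun m => Squarefree m ∧ (∀ i, m.Coprime (n i)) ∧
          (2 : ℝ) ^ m.primeFactors.card ≤ K with hB
  have hBm : ∀ m ∈ B, (∀ p, p.Prime → p ∣ m → p ∈ S) := by
    intro m hm p hp hpm
    obtain ⟨⟨hm1, hmN⟩, hmW⟩ := mem_coprimeUpto.1 (Finset.mem_filter.1 hm).1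
    exact hWS p hp ((Nat.le_of_dvd hm1 hpm).trans hmN) (hmW.of_dvd_left hpm)
  let e : ℕ → ι → ℕ := fun m => Function.update n j m
  have ej : ∀ m, e m j = m := fun m => Function.update_self _ _ _
  have ei : ∀ m i, i ≠ j → e m i = n i := fun m i hi => Function.update_of_ne hi _ _
  have ecop : ∀ m ∈ B, ∀ i l, i ≠ l → (e m i).Coprime (e m l) := by
    intro m hm i l hil
    have hc := (Finset.mem_filter.1 hm).2.2.1
    rcases eq_or_ne i j with rfl | hi
    · rw [ej, ei m l hil.symm]; exact hc l
    · rcases eq_or_ne l j with rfl | hl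
      · rw [ej, ei m i hi]; exact (hc i).symm
      · rw [ei m i hi, ei m l hl]; exact hn.cop i l hil
  have ecol : ∀ m ∈ B, ∀ i, colorPart (tupleColoring S (e m)) i = e m i := by
    intro m hm i
    refine colorPart_tupleColoring hS (ecop m hm) i ?_ ?_
    · rcases eq_or_ne i j with rfl | hi
      · rw [ej]; exact (Finset.mem_filter.1 hm).2.1
      · rw [ei m i hi]; exact hn.sq i
    · rcases eq_or_ne i j with rfl | hi
      · rw [ej]; exact hBm m hm
      · rw [ei m i hi]; exact hn.mem i
  have hz0 : ∀ d : S → Option ι, 0 ≤ sieveCoeff (truncG L K N) R d := fun d => by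
    unfold sieveCoeff
    split_ifs
    exacts [Finset.prod_nonneg fun i _ => truncG_nonneg hL.le _ _ _, le_rfl]
  have hl0 : ∀ d : S → Option ι,
      0 ≤ ∏ p : S, lowerFn j ((p : ℕ) : ℝ) (d p) (tupleColoring S n p) := fun d =>
    Finset.prod_nonneg fun p _ => lowerFn_nonneg j (Nat.cast_nonneg _) _ _
  calc _ = ∑ m ∈ B, sieveCoeff (truncG L K N) R (tupleColoring S (e m)) *
          ∏ p : S, lowerFn j ((p : ℕ) : ℝ) (tupleColoring S (e m) p) (tupleColoring S n p) := by
        rw [Finset.mul_sum]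
        refine Finset.sum_congr rfl fun m hm => ?_
        obtain ⟨hmA, hmsq, hmc, hmK⟩ := Finset.mem_filter.1 hm
        obtain ⟨⟨hm1, hmN⟩, hmW⟩ := mem_coprimeUpto.1 hmA
        have h1 : sieveCoeff (truncG L K N) R (tupleColoring S (e m)) = 1 / (L + Real.log m) *
            ∏ i ∈ Finset.univ.erase j, 1 / (L + Real.log (n i)) := by
          unfold sieveCoeff
          rw [colorProd_eq_prod, if_pos]
          · rw [← Finset.mul_prod_erase _ _ (Finset.mem_univ j), ecol m hm, ej]
            congr 1
            · simp [truncG, hmN, hmK]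
            · refine Finset.prod_congr rfl fun i hi => ?_
              rw [ecol m hm, ei m i (Finset.ne_of_mem_erase hi)]
              simp [truncG, hn.le i, hn.card i]
          · refine le_trans ?_ hn.prod
            norm_cast
            rw [← Finset.mul_prod_erase _ _ (Finset.mem_univ j), ecol m hm, ej,
              ← Finset.mul_prod_erase _ n (Finset.mem_univ j), hn.one, one_mul, mul_comm]
            refine Nat.mul_le_mul (le_of_eq ?_) hmN
            exact Finset.prod_congr rfl fun i hi => by
              rw [ecol m hm, ei m i (Finset.ne_of_mem_erase hi)]
        have h2 : ∏ p : S, lowerFn j ((p : ℕ) : ℝ) (tupleColoring S (e m) p)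
            (tupleColoring S n p) = 1 / m := by
          conv_rhs => rw [← ej m, ← ecol m hm j]
          rw [colorPart, subsetProd, Nat.cast_prod, one_div, ← Finset.prod_inv_distrib]
          refine Finset.prod_congr rfl fun p _ => ?_
          rcases h : tupleColoring S n p with _ | i
          · rw [tupleColoring_eq_none] at h
            rcases h' : tupleColoring S (e m) p with _ | l
            · simp [lowerFn]
            · rw [tupleColoring_eq_some hS (ecop m hm)] at h'
              obtain rfl : l = j := by
                by_contra hl
                rw [ei m l hl] at h'
                exact h l h'
              simp [lowerFn]
          · rw [tupleColoring_eq_some hS hn.cop] at h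
            have hij : i ≠ j := by
              rintro rfl
              rw [hn.one] at h
              exact (hS p p.2).one_lt.ne' (Nat.dvd_one.1 h)
            have h' : tupleColoring S (e m) p = some i := by
              rw [tupleColoring_eq_some hS (ecop m hm), ei m i hij]; exact h
            simp [lowerFn, h', hij]
        rw [h1, h2, logWeight]
        rw [pow_one]
        rw [one_div_mul_eq_div, div_mul_div_comm, mul_one, mul_one_div, mul_comm (m : ℝ)]
    _ = ∑ d ∈ B.image fun m => tupleColoring S (e m), sieveCoeff (truncG L K N) R d *
          ∏ p : S, lowerFn j ((p : ℕ) : ℝ) (d p) (tupleColoring S n p) := by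
        rw [Finset.sum_image]
        intro m hm m' hm' h
        have h1 := ecol m hm j
        have h2 := ecol m' hm' j
        simp only at h
        rw [ej] at h1 h2
        rw [← h1, ← h2, h]
    _ ≤ _ := Finset.sum_le_sum_of_subset_of_nonneg (Finset.subset_univ _)
        fun d _ _ => mul_nonneg (hz0 d) (hl0 d)

end Tuples

theorem one_sub_sum_le_prod {α : Type} (s : Finset α) (x : α → ℝ) (h0 : ∀ a ∈ s, 0 ≤ x a)
    (h1 : ∀ a ∈ s, x a ≤ 1) : 1 - ∑ a ∈ s, x a ≤ ∏ a ∈ s, (1 - x a) := by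
  classical
  induction s using Finset.induction_on with
  | empty => simp
  | insert a s ha ih =>
    rw [Finset.sum_insert ha, Finset.prod_insert ha]
    have i1 := ih (fun b hb => h0 b (Finset.mem_insert_of_mem hb))
      fun b hb => h1 b (Finset.mem_insert_of_mem hb)
    have i2 := h0 a (Finset.mem_insert_self _ _)
    have i3 := h1 a (Finset.mem_insert_self _ _)
    have i4 : ∏ b ∈ s, (1 - x b) ≤ 1 := Finset.prod_le_one
      (fun b hb => by linarith [h1 b (Finset.mem_insert_of_mem hb)])
      fun b hb => by linarith [h0 b (Finset.mem_insert_of_mem hb)]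
    nlinarith

/-! ### The contribution of a single good tuple. -/

section LowerBound

variable {ι : Type} [Fintype ι] [DecidableEq ι] {S : Finset ℕ}

/-- The sum of `1/p` over the `p ∈ S` dividing one of the `n i`, with multiplicity. -/
noncomputable def recipSum (S : Finset ℕ) (n : ι → ℕ) : ℝ :=
  ∑ i, ∑ p ∈ S, if p ∣ n i then 1 / (p : ℝ) else 0

theorem recipSum_nonneg (S : Finset ℕ) (n : ι → ℕ) : 0 ≤ recipSum S n :=
  Finset.sum_nonneg fun _ _ => Finset.sum_nonneg fun _ _ => by split_ifs <;> positivity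

/-- A coloured prime contributes `1/p` times `1 - 4k/p`, an uncoloured one `1 - 1/(p-1)^2` with
`1/(p-1)^2 ≤ 4/p^2`. A product of such factors is at least one minus the sum of the deficits, and
the deficits of the coloured primes add up to a multiple of `recipSum`. -/
theorem prod_lowerWeight_ge (hS : ∀ p ∈ S, p.Prime) (hk : ∀ p ∈ S, 4 * Fintype.card ι ≤ p)
    {j : ι} {N : ℕ} {K R : ℝ} {n : ι → ℕ} (hn : GoodTuple S j N K R n) :
    (∏ i, 1 / (n i : ℝ)) * (1 - (4 * ∑ p ∈ S, 1 / (p : ℝ) ^ 2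
        + 4 * Fintype.card ι * recipSum S n))
      ≤ ∏ p : S, lowerWeight j ((p : ℕ) : ℝ) (tupleColoring S n p) := by
  set u := tupleColoring S n with hu
  let x : S → ℝ := fun p => if u p = none then 1 / (((p : ℕ) : ℝ) - 1) ^ 2
    else 4 * Fintype.card ι / ((p : ℕ) : ℝ)
  have hp2 : ∀ p : S, (2 : ℝ) ≤ (p : ℕ) := fun p => by exact_mod_cast (hS p p.2).two_le
  have hfac : ∀ p : S, lowerWeight j ((p : ℕ) : ℝ) (u p)
      = (if u p ≠ none then ((p : ℕ) : ℝ) else 1)⁻¹ * (1 - x p) := by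
    intro p
    rcases h : u p with _ | i
    · simp [lowerWeight, x, h]
    · have hij : i ≠ j := by
        rintro rfl
        have := (tupleColoring_eq_some hS hn.cop p i).1 h
        rw [hn.one] at this
        exact (hS p p.2).one_lt.ne' (Nat.dvd_one.1 this)
      simp [lowerWeight, x, h, hij]
  have hprod : ∏ p : S, (if u p ≠ none then ((p : ℕ) : ℝ) else 1)⁻¹ = ∏ i, 1 / (n i : ℝ) := by
    rw [Finset.prod_inv_distrib, Finset.prod_div_distrib, Finset.prod_const_one, one_div]
    congr 1
    have : ∏ i, n i = colorProd u := by
      rw [colorProd_eq_prod]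
      exact Finset.prod_congr rfl fun i _ =>
        (colorPart_tupleColoring hS hn.cop i (hn.sq i) (hn.mem i)).symm
    rw [← Nat.cast_prod, this, colorProd, subsetProd, Nat.cast_prod]
    exact Finset.prod_congr rfl fun p _ => by split_ifs <;> simp
  simp only [hfac]
  rw [Finset.prod_mul_distrib, hprod]
  refine mul_le_mul_of_nonneg_left ?_ (Finset.prod_nonneg fun i _ => by positivity)
  refine le_trans ?_ (one_sub_sum_le_prod Finset.univ x (fun p _ => ?_) fun p _ => ?_)
  · have : ∑ p : S, x p ≤ ∑ p : S, (4 * (1 / ((p : ℕ) : ℝ) ^ 2) + 4 * Fintype.card ι *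
        ∑ i, if (p : ℕ) ∣ n i then 1 / ((p : ℕ) : ℝ) else 0) := by
      refine Finset.sum_le_sum fun p _ => ?_
      have h2 := hp2 p
      have hnn : ∀ i, (0 : ℝ) ≤ if (p : ℕ) ∣ n i then 1 / ((p : ℕ) : ℝ) else 0 := fun i => by
        split_ifs <;> positivity
      have hsn := Finset.sum_nonneg fun i (_ : i ∈ Finset.univ) => hnn i
      by_cases h : u p = none
      · simp only [x, h, if_true]
        have h3 : 1 / (((p : ℕ) : ℝ) - 1) ^ 2 ≤ 4 * (1 / ((p : ℕ) : ℝ) ^ 2) := by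
          rw [mul_one_div, div_le_div_iff₀ (by nlinarith) (by nlinarith)]
          nlinarith
        have : 0 ≤ 4 * (Fintype.card ι : ℝ) *
          ∑ i, if (p : ℕ) ∣ n i then 1 / ((p : ℕ) : ℝ) else 0 := by positivity
        linarith
      · obtain ⟨i, hi⟩ := Option.ne_none_iff_exists'.1 h
        rw [tupleColoring_eq_some hS hn.cop] at hi
        have h3 := Finset.single_le_sum (fun i _ => hnn i) (Finset.mem_univ i)
        simp only [hi, if_true] at h3
        simp only [x, h, if_false]
        have h4 : 4 * (Fintype.card ι : ℝ) / ((p : ℕ) : ℝ) ≤ 4 * Fintype.card ι *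
          ∑ i, if (p : ℕ) ∣ n i then 1 / ((p : ℕ) : ℝ) else 0 := by
          rw [div_eq_mul_one_div]; gcongr
        have : 0 ≤ 4 * (1 / ((p : ℕ) : ℝ) ^ 2) := by positivity
        linarith
    rw [Finset.sum_add_distrib, ← Finset.mul_sum, ← Finset.mul_sum, Finset.sum_comm] at this
    rw [recipSum]
    have e1 := Finset.sum_coe_sort S fun p : ℕ => 1 / (p : ℝ) ^ 2
    have e2 := fun i => Finset.sum_coe_sort S fun p : ℕ => if p ∣ n i then 1 / (p : ℝ) else 0
    rw [e1, Finset.sum_congr rfl fun i _ => e2 i] at this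
    linarith
  · have := hp2 p
    simp only [x]; split_ifs <;> positivity
  · have h2 := hp2 p
    simp only [x]; split_ifs
    · rw [div_le_one (by nlinarith)]; nlinarith
    · rw [div_le_one (by linarith)]; exact_mod_cast hk p p.2

theorem lowerWeight_nonneg (j : ι) {p : ℝ} (hp : 2 ≤ p) (hk : 4 * (Fintype.card ι : ℝ) ≤ p)
    (u : Option ι) : 0 ≤ lowerWeight j p u := by
  cases u
  · simp only [lowerWeight, sub_nonneg]
    rw [div_le_one (by nlinarith)]; nlinarith
  · simp only [lowerWeight]
    split_ifs
    · exact le_rfl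
    · refine mul_nonneg (by positivity) (sub_nonneg.2 ?_)
      rwa [div_le_one (by linarith)]

theorem reducedWeight_nonneg (j : ι) {p : ℝ} (hp : 2 ≤ p) (hk : 4 * (Fintype.card ι : ℝ) ≤ p)
    (u : Option ι) : 0 ≤ reducedWeight j p u := by
  cases u
  · simp only [reducedWeight, sub_nonneg]
    rw [div_le_one (by linarith)]
    have : (0 : ℝ) ≤ Fintype.card ι := Nat.cast_nonneg _
    linarith
  · simp only [reducedWeight]
    split_ifs
    · exact le_rfl
    · exact one_div_nonneg.2 (by linarith)

/-- The contribution of one good tuple. -/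
theorem goodTuple_term_ge (hS : ∀ p ∈ S, p.Prime) (hk : ∀ p ∈ S, 4 * Fintype.card ι ≤ p)
    {W N : ℕ} (hWS : ∀ p, p.Prime → p ≤ N → p.Coprime W → p ∈ S) {L K R : ℝ} (hL : 0 < L)
    (hK : 0 < K) (hI : 0 < logSum W N 1 L) {j : ι} {n : ι → ℕ} (hn : GoodTuple S j N K R n) :
    (∏ i ∈ Finset.univ.erase j, logWeight 2 L (n i)) * (logSum W N 1 L ^ 2 *
      (1 - 6 * ∑ p ∈ S, 1 / (p : ℝ) ^ 2 - (4 * Fintype.card ι + 2) * recipSum S n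
        - 2 * (∑ m ∈ Finset.Icc 1 N, 1 / (m : ℝ)) ^ 2 / (L * K * logSum W N 1 L)))
      ≤ (∏ p : S, lowerWeight j ((p : ℕ) : ℝ) (tupleColoring S n p)) *
        (∑ d : S → Option ι, sieveCoeff (truncG L K N) R d *
          ∏ p : S, lowerFn j ((p : ℕ) : ℝ) (d p) (tupleColoring S n p)) ^ 2 := by
  have h1 := prod_lowerWeight_ge hS hk hn
  have h2 := inner_sum_ge (W := W) hS hWS hL hn
  have h3 := sum_sieved_ge (W := W) hS hWS hL hK n
  set I := logSum W N 1 L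
  set X := ∏ p : S, lowerWeight j ((p : ℕ) : ℝ) (tupleColoring S n p)
  set J := ∑ m ∈ (coprimeUpto W N).filter fun m => Squarefree m ∧ (∀ i, m.Coprime (n i)) ∧
          (2 : ℝ) ^ m.primeFactors.card ≤ K, logWeight 1 L m
  set P := ∏ i ∈ Finset.univ.erase j, 1 / (L + Real.log (n i)) with hP
  set Z := ∑ d : S → Option ι, sieveCoeff (truncG L K N) R d *
          ∏ p : S, lowerFn j ((p : ℕ) : ℝ) (d p) (tupleColoring S n p)
  set ψ := recipSum S n with hψ
  set s := ∑ p ∈ S, 1 / (p : ℝ) ^ 2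
  set H := (∑ m ∈ Finset.Icc 1 N, 1 / (m : ℝ)) ^ 2
  have hψ0 : 0 ≤ ψ := recipSum_nonneg S n
  have hs0 : 0 ≤ s := Finset.sum_nonneg fun _ _ => by positivity
  have hH0 : 0 ≤ H := sq_nonneg _
  have hlog : ∀ i, 0 < L + Real.log (n i) := fun i => by
    have := Real.log_natCast_nonneg (n i); linarith
  have hP0 : 0 ≤ P := Finset.prod_nonneg fun i _ => (one_div_pos.2 (hlog i)).le
  have hX0 : 0 ≤ X := Finset.prod_nonneg fun p _ => lowerWeight_nonneg j
    (by exact_mod_cast (hS p p.2).two_le) (by exact_mod_cast hk p p.2) _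
  have hJ0 : 0 ≤ J := Finset.sum_nonneg fun m _ => logWeight_nonneg 1 hL.le m
  set Q := ∏ i, 1 / (n i : ℝ) with hQ
  have hQ0 : 0 ≤ Q := Finset.prod_nonneg fun i _ => by positivity
  have hQP : ∏ i ∈ Finset.univ.erase j, logWeight 2 L (n i) = Q * P ^ 2 := by
    rw [hQ, ← Finset.mul_prod_erase _ _ (Finset.mem_univ j), hn.one, hP, ← Finset.prod_pow]
    simp only [Nat.cast_one, ne_eq, one_ne_zero, not_false_eq_true, div_self, one_mul]
    rw [← Finset.prod_mul_distrib]
    refine Finset.prod_congr rfl fun i _ => ?_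
    rw [logWeight, div_pow, one_pow, one_div_mul_one_div]
  set a := s + ψ + H / (L * K * I) with ha
  have ha0 : 0 ≤ a := by positivity
  have hJ : I * (1 - a) ≤ J := by
    refine le_trans (le_of_eq ?_) h3
    rw [ha, hψ, recipSum]
    field_simp
    ring
  have hJ2 : I ^ 2 * (1 - 2 * a) ≤ J ^ 2 := by
    rcases le_or_gt a 1 with h | h
    · have : (I * (1 - a)) ^ 2 ≤ J ^ 2 := pow_le_pow_left₀ (mul_nonneg hI.le (by linarith)) hJ 2
      nlinarith [sq_nonneg (I * a)]
    · have : I ^ 2 * (1 - 2 * a) ≤ 0 := mul_nonpos_of_nonneg_of_nonpos (sq_nonneg _) (by linarith)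
      nlinarith [sq_nonneg J]
  set b := 4 * s + 4 * Fintype.card ι * ψ with hb
  have hb0 : 0 ≤ b := by positivity
  have hZ : (P * J) ^ 2 ≤ Z ^ 2 := pow_le_pow_left₀ (mul_nonneg hP0 hJ0) h2 2
  -- The loss `b` comes from the weights and the loss `a` from the inner sum, which is squared: `(1
  -- - a)^2 ≥ 1 - 2a` and `(1 - b)(1 - 2a) ≥ 1 - b - 2a`. If the last quantity is negative the claim
  -- is trivial.
  have hgoal : (1 - 6 * s - (4 * Fintype.card ι + 2) * ψ - 2 * H / (L * K * I))
      = 1 - b - 2 * a := by rw [ha, hb]; ring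
  rw [hgoal, hQP]
  rcases le_or_gt (1 - b - 2 * a) 0 with h | h
  · refine le_trans ?_ (mul_nonneg hX0 (sq_nonneg Z))
    exact mul_nonpos_of_nonneg_of_nonpos (by positivity)
      (mul_nonpos_of_nonneg_of_nonpos (by positivity) h)
  · calc Q * P ^ 2 * (I ^ 2 * (1 - b - 2 * a))
        ≤ Q * P ^ 2 * ((1 - b) * (I ^ 2 * (1 - 2 * a))) := by
          refine mul_le_mul_of_nonneg_left ?_ (by positivity)
          nlinarith [mul_nonneg (sq_nonneg I) (mul_nonneg hb0 ha0)]
      _ ≤ Q * P ^ 2 * ((1 - b) * J ^ 2) := by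
          refine mul_le_mul_of_nonneg_left ?_ (by positivity)
          exact mul_le_mul_of_nonneg_left hJ2 (by linarith)
      _ = (Q * (1 - b)) * (P * J) ^ 2 := by ring
      _ ≤ X * Z ^ 2 := mul_le_mul h1 hZ (sq_nonneg _) hX0

end LowerBound

/-! ### Random tuples: most of them are good. -/

section Expectation

variable {ι : Type} [Fintype ι] [DecidableEq ι] {S : Finset ℕ}

/-- The supports of the random tuples. -/
def tupleSupport (j : ι) (W N : ℕ) (i : ι) : Finset ℕ := if i = j then {1} else coprimeUpto W N

/-- The distribution of the random tuples. -/
noncomputable def tupleWeight (j : ι) (W N : ℕ) (L : ℝ) (i : ι) (m : ℕ) : ℝ :=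
  if i = j then 1 else logWeight 2 L m / logSum W N 2 L

theorem tupleWeight_nonneg (j : ι) (W N : ℕ) {L : ℝ} (hL : 0 ≤ L) (i : ι) (m : ℕ) :
    0 ≤ tupleWeight j W N L i m := by
  unfold tupleWeight
  split_ifs
  · exact zero_le_one
  · exact div_nonneg (logWeight_nonneg 2 hL m)
      (Finset.sum_nonneg fun _ _ => logWeight_nonneg 2 hL _)

theorem sum_tupleWeight (j : ι) {W N : ℕ} {L : ℝ} (hI : 0 < logSum W N 2 L) (i : ι) :
    ∑ m ∈ tupleSupport j W N i, tupleWeight j W N L i m = 1 := by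
  unfold tupleSupport tupleWeight
  split_ifs
  · simp
  · rw [← Finset.sum_div]; exact div_self hI.ne'

theorem sum_tupleWeight_dvd (j : ι) {W N : ℕ} {L : ℝ} (hL : 0 < L) (hI : 0 < logSum W N 2 L)
    (i : ι) {q : ℕ} (hq : 2 ≤ q) :
    ∑ m ∈ tupleSupport j W N i, tupleWeight j W N L i m * (if q ∣ m then 1 else 0) ≤ 1 / q := by
  unfold tupleSupport tupleWeight
  split_ifs
  · have : ¬ q ∣ 1 := fun h => by have := Nat.dvd_one.1 h; omega
    rw [Finset.sum_singleton, if_neg this]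
    simp
  · simp only [div_mul_eq_mul_div]
    rw [← Finset.sum_div, div_le_iff₀ hI]
    exact sum_coprimeUpto_dvd_le W N (by omega) _ (logWeight_nonneg 2 hL.le)
      (logWeight_mul_le 2 hL (by omega))

/-- Since `log m ≤ L + log m`, one factor of the denominator of `logWeight 2` cancels. -/
theorem weighted_mean_log_le {W N : ℕ} {L : ℝ} (hL : 0 < L) (hI : 0 < logSum W N 2 L) :
    ∑ m ∈ coprimeUpto W N, logWeight 2 L m / logSum W N 2 L * Real.log m
      ≤ logSum W N 1 L / logSum W N 2 L := by
  simp only [div_mul_eq_mul_div]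
  rw [← Finset.sum_div]
  refine div_le_div_of_nonneg_right (Finset.sum_le_sum fun m _ => ?_) hI.le
  rw [← logWeight_succ_mul 1 hL]
  exact mul_le_mul_of_nonneg_left (by linarith) (logWeight_nonneg 2 hL.le m)

/-- Upper bound for the indicator that a random tuple is not good. -/
noncomputable def badBound (S : Finset ℕ) (j : ι) (K D μ : ℝ) (n : ι → ℕ) : ℝ :=
  (∑ i, ∑ p ∈ S, if p ^ 2 ∣ n i then (1 : ℝ) else 0)
  + (∑ i, ∑ l, ∑ p ∈ S, if i ≠ l ∧ p ∣ n i ∧ p ∣ n l then (1 : ℝ) else 0)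
  + (∑ i, if i = j then 0 else (2 : ℝ) ^ (n i).primeFactors.card / K)
  + (1 / D ^ 2) * (∑ i, if i = j then 0 else Real.log (n i) - μ) ^ 2

theorem badBound_parts_nonneg (S : Finset ℕ) (j : ι) {K : ℝ} (hK : 0 ≤ K) (n : ι → ℕ) :
    0 ≤ (∑ i, ∑ p ∈ S, if p ^ 2 ∣ n i then (1 : ℝ) else 0) ∧
    0 ≤ (∑ i, ∑ l, ∑ p ∈ S, if i ≠ l ∧ p ∣ n i ∧ p ∣ n l then (1 : ℝ) else 0) ∧
    0 ≤ (∑ i, if i = j then 0 else (2 : ℝ) ^ (n i).primeFactors.card / K) := by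
  refine ⟨Finset.sum_nonneg fun _ _ => Finset.sum_nonneg fun _ _ => ?_,
    Finset.sum_nonneg fun _ _ => Finset.sum_nonneg fun _ _ => Finset.sum_nonneg fun _ _ => ?_,
    Finset.sum_nonneg fun _ _ => ?_⟩ <;> split_ifs <;> positivity

/-- Each way of failing to be good makes one of the four nonnegative penalties at least `1`. For the
size condition, `∏ n i * N > R` forces the sum of the centred logarithms above `log R - log N - k μ'
≥ D`. -/
theorem one_le_badBound {W N : ℕ} (hWS : ∀ p, p.Prime → p ≤ N → p.Coprime W → p ∈ S)
    {K R D μ μ' : ℝ} {j : ι} (hN : 1 ≤ N) (hK : 1 ≤ K) (hR : 0 < R) (hD : 0 < D) (hμ : 0 ≤ μ')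
    (hμ' : μ ≤ μ') (hDR : D + Fintype.card ι * μ' ≤ Real.log R - Real.log N)
    {n : ι → ℕ} (hn : n ∈ Fintype.piFinset (tupleSupport j W N))
    (hbad : ¬ GoodTuple S j N K R n) : 1 ≤ badBound S j K D μ n := by
  obtain ⟨q1, q2, q3⟩ := badBound_parts_nonneg S j (zero_le_one.trans hK) n
  have q4 : 0 ≤ (1 / D ^ 2) * (∑ i, if i = j then 0 else Real.log (n i) - μ) ^ 2 := by positivity
  rw [Fintype.mem_piFinset] at hn
  have hone : n j = 1 := by simpa [tupleSupport] using hn j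
  have hmem : ∀ i, n i ∈ coprimeUpto W N := by
    intro i
    have := hn i
    rw [tupleSupport] at this
    split_ifs at this with h
    · rw [Finset.mem_singleton.1 this, mem_coprimeUpto]
      exact ⟨⟨le_rfl, hN⟩, Nat.coprime_one_left W⟩
    · exact this
  have hpos : ∀ i, 1 ≤ n i := fun i => (mem_coprimeUpto.1 (hmem i)).1.1
  have inS : ∀ i p, p.Prime → p ∣ n i → p ∈ S := fun i p hp hpm => by
    obtain ⟨⟨hm1, hmN⟩, hmW⟩ := mem_coprimeUpto.1 (hmem i)
    exact hWS p hp ((Nat.le_of_dvd hm1 hpm).trans hmN) (hmW.of_dvd_left hpm)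
  unfold badBound
  by_contra hlt
  rw [not_le] at hlt
  refine hbad ⟨hone, fun i => ?_, fun i => (mem_coprimeUpto.1 (hmem i)).1.2, inS,
    fun i l hil => ?_, fun i => ?_, ?_⟩
  · by_contra h
    rw [Nat.squarefree_iff_prime_squarefree] at h
    push Not at h
    obtain ⟨p, hp, hpm⟩ := h
    have h1 := Finset.single_le_sum (f := fun i => ∑ p ∈ S, if p ^ 2 ∣ n i then (1 : ℝ) else 0)
      (fun i _ => Finset.sum_nonneg fun _ _ => by split_ifs <;> norm_num) (Finset.mem_univ i)
    have h2 := Finset.single_le_sum (f := fun p => if p ^ 2 ∣ n i then (1 : ℝ) else 0)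
      (fun _ _ => by split_ifs <;> norm_num) (inS i p hp ((dvd_mul_right p p).trans hpm))
    rw [← sq] at hpm
    simp only [hpm, if_true] at h1 h2
    linarith
  · by_contra h
    obtain ⟨p, hp, hpi, hpl⟩ := Nat.Prime.not_coprime_iff_dvd.1 h
    have h1 := Finset.single_le_sum (f := fun i => ∑ l, ∑ p ∈ S,
      if i ≠ l ∧ p ∣ n i ∧ p ∣ n l then (1 : ℝ) else 0)
      (fun i _ => Finset.sum_nonneg fun _ _ => Finset.sum_nonneg fun _ _ => by
        split_ifs <;> norm_num) (Finset.mem_univ i)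
    have h2 := Finset.single_le_sum (f := fun l => ∑ p ∈ S,
      if i ≠ l ∧ p ∣ n i ∧ p ∣ n l then (1 : ℝ) else 0)
      (fun i _ => Finset.sum_nonneg fun _ _ => by split_ifs <;> norm_num) (Finset.mem_univ l)
    have h3 := Finset.single_le_sum (f := fun p =>
      if i ≠ l ∧ p ∣ n i ∧ p ∣ n l then (1 : ℝ) else 0)
      (fun _ _ => by split_ifs <;> norm_num) (inS i p hp hpi)
    simp only [hil, hpi, hpl, ne_eq, not_false_eq_true, and_self, if_true] at h1 h2 h3
    linarith
  · by_contra h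
    have hij : i ≠ j := by
      rintro rfl
      rw [hone] at h
      simp only [Nat.primeFactors_one, Finset.card_empty, pow_zero] at h
      exact h hK
    have h1 := Finset.single_le_sum (f := fun i => if i = j then (0 : ℝ) else
      (2 : ℝ) ^ (n i).primeFactors.card / K)
      (fun i _ => by split_ifs <;> positivity) (Finset.mem_univ i)
    simp only [hij, if_false] at h1
    have h2 : 1 ≤ (2 : ℝ) ^ (n i).primeFactors.card / K := by
      rw [one_le_div (by linarith)]; exact (not_le.1 h).le
    linarith
  · by_contra h
    have hN0 : (0 : ℝ) < N := by exact_mod_cast hN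
    have hn0 : ∀ i, (0 : ℝ) < n i := fun i => by exact_mod_cast hpos i
    have h1 := Real.log_lt_log hR (not_le.1 h)
    rw [Nat.cast_prod, Real.log_mul (Finset.prod_pos fun i _ => hn0 i).ne' hN0.ne',
      Real.log_prod fun i _ => (hn0 i).ne'] at h1
    have h2 : ∑ i, Real.log (n i) - Fintype.card ι * μ'
        ≤ ∑ i, if i = j then 0 else Real.log (n i) - μ := by
      have : (Fintype.card ι : ℝ) * μ' = ∑ _i : ι, μ' := by simp
      rw [this, ← Finset.sum_sub_distrib]
      refine Finset.sum_le_sum fun i _ => ?_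
      split_ifs with h
      · rw [h, hone]; simpa using hμ
      · linarith
    have h3 : 1 ≤ (1 / D ^ 2) * (∑ i, if i = j then 0 else Real.log (n i) - μ) ^ 2 := by
      rw [one_div_mul_eq_div, one_le_div (by positivity)]
      exact pow_le_pow_left₀ hD.le (by linarith) 2
    linarith

theorem expect_recipSum_le (hS : ∀ p ∈ S, p.Prime) (j : ι) {W N : ℕ} {L : ℝ} (hL : 0 < L)
    (hI : 0 < logSum W N 2 L) :
    prodExpect (tupleSupport j W N) (tupleWeight j W N L) (recipSum S)
      ≤ Fintype.card ι * ∑ p ∈ S, 1 / (p : ℝ) ^ 2 := by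
  have hw := sum_tupleWeight j hI
  unfold recipSum
  rw [prodExpect_sum, ← nsmul_eq_mul, ← Finset.card_univ]
  refine Finset.sum_le_card_nsmul _ _ _ fun i _ => ?_
  rw [prodExpect_sum]
  refine Finset.sum_le_sum fun p hp => ?_
  rw [prodExpect_single _ _ hw i fun m => if p ∣ m then 1 / (p : ℝ) else 0]
  have := mul_le_mul_of_nonneg_left (sum_tupleWeight_dvd j hL hI i (hS p hp).two_le)
    (show (0 : ℝ) ≤ 1 / p by positivity)
  rw [Finset.mul_sum] at this
  refine le_trans (le_of_eq (Finset.sum_congr rfl fun m _ => ?_)) (this.trans (le_of_eq ?_))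
  · split_ifs <;> ring
  · ring

/-- The four penalties are averaged separately. Divisibility by `p^2`, or of two independent entries
by `p`, has probability at most `1/p^2`; many prime factors are treated by
`sum_two_pow_card_div_le`; and the variance of the sum of logarithms is the sum of the variances. -/
theorem expect_badBound_le (hS : ∀ p ∈ S, p.Prime) (j : ι) {W N : ℕ} {L K D : ℝ}
    (hL : 0 < L) (hK : 0 < K) (hI : 0 < logSum W N 2 L) :
    prodExpect (tupleSupport j W N) (tupleWeight j W N L)
      (badBound S j K D (∑ m ∈ coprimeUpto W N, logWeight 2 L m / logSum W N 2 L * Real.log m))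
      ≤ (Fintype.card ι + Fintype.card ι ^ 2) * ∑ p ∈ S, 1 / (p : ℝ) ^ 2
        + Fintype.card ι * ((∑ m ∈ Finset.Icc 1 N, 1 / (m : ℝ)) ^ 2 / (L ^ 2 * K * logSum W N 2 L))
        + Fintype.card ι * (Real.log N * (logSum W N 1 L / logSum W N 2 L)) / D ^ 2 := by
  have hw := sum_tupleWeight j hI
  have hw0 := tupleWeight_nonneg j W N hL.le
  set μ := ∑ m ∈ coprimeUpto W N, logWeight 2 L m / logSum W N 2 L * Real.log m with hμ
  have hlw : ∀ m, 0 ≤ logWeight 2 L m / logSum W N 2 L := fun m =>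
    div_nonneg (logWeight_nonneg 2 hL.le m) hI.le
  unfold badBound
  rw [prodExpect_add, prodExpect_add, prodExpect_add]
  have b1 : prodExpect (tupleSupport j W N) (tupleWeight j W N L)
      (fun n => ∑ i, ∑ p ∈ S, if p ^ 2 ∣ n i then (1 : ℝ) else 0)
      ≤ Fintype.card ι * ∑ p ∈ S, 1 / (p : ℝ) ^ 2 := by
    rw [prodExpect_sum, ← nsmul_eq_mul, ← Finset.card_univ]
    refine Finset.sum_le_card_nsmul _ _ _ fun i _ => ?_
    rw [prodExpect_sum]
    refine Finset.sum_le_sum fun p hp => ?_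
    rw [prodExpect_single _ _ hw i fun m => if p ^ 2 ∣ m then (1 : ℝ) else 0]
    have h2 := (hS p hp).two_le
    have := sum_tupleWeight_dvd j hL hI i (q := p ^ 2) (by nlinarith)
    simpa using this
  have b2 : prodExpect (tupleSupport j W N) (tupleWeight j W N L)
      (fun n => ∑ i, ∑ l, ∑ p ∈ S, if i ≠ l ∧ p ∣ n i ∧ p ∣ n l then (1 : ℝ) else 0)
      ≤ Fintype.card ι ^ 2 * ∑ p ∈ S, 1 / (p : ℝ) ^ 2 := by
    rw [sq, mul_assoc, prodExpect_sum, ← nsmul_eq_mul, ← Finset.card_univ]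
    refine Finset.sum_le_card_nsmul _ _ _ fun i _ => ?_
    rw [prodExpect_sum, Finset.card_univ, ← nsmul_eq_mul, ← Finset.card_univ]
    refine Finset.sum_le_card_nsmul _ _ _ fun l _ => ?_
    rw [prodExpect_sum]
    refine Finset.sum_le_sum fun p hp => ?_
    by_cases hil : i = l
    · simp only [hil, ne_eq, not_true_eq_false, false_and, if_false]
      simp only [prodExpect, mul_zero, Finset.sum_const_zero]
      positivity
    · have := prodExpect_pair _ _ hw hil (fun m => if p ∣ m then (1 : ℝ) else 0)
        (fun m => if p ∣ m then (1 : ℝ) else 0)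
      have e : (fun n : ι → ℕ => if i ≠ l ∧ p ∣ n i ∧ p ∣ n l then (1 : ℝ) else 0)
        = fun n => (if p ∣ n i then (1 : ℝ) else 0) * (if p ∣ n l then 1 else 0) := by
        funext n
        by_cases h1 : p ∣ n i <;> by_cases h2 : p ∣ n l <;> simp [hil, h1, h2]
      rw [e, this]
      have t := fun i => sum_tupleWeight_dvd j hL hI i (hS p hp).two_le
      calc _ ≤ 1 / (p : ℝ) * (1 / p) := mul_le_mul (t i) (t l) (Finset.sum_nonneg fun m _ =>
            mul_nonneg (hw0 _ _) (by split_ifs <;> norm_num)) (by positivity)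
        _ = _ := by rw [one_div_mul_one_div, sq]
  have b3 : prodExpect (tupleSupport j W N) (tupleWeight j W N L)
      (fun n => ∑ i, if i = j then 0 else (2 : ℝ) ^ (n i).primeFactors.card / K)
      ≤ Fintype.card ι * ((∑ m ∈ Finset.Icc 1 N, 1 / (m : ℝ)) ^ 2
        / (L ^ 2 * K * logSum W N 2 L)) := by
    rw [prodExpect_sum, ← nsmul_eq_mul, ← Finset.card_univ]
    refine Finset.sum_le_card_nsmul _ _ _ fun i _ => ?_
    rw [prodExpect_single _ _ hw i fun m => if i = j then 0 else (2 : ℝ) ^ m.primeFactors.card / K]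
    unfold tupleSupport tupleWeight
    split_ifs with h
    · simp only [mul_zero, Finset.sum_const_zero]; positivity
    · have : ∀ m ∈ coprimeUpto W N, logWeight 2 L m / logSum W N 2 L *
          ((2 : ℝ) ^ m.primeFactors.card / K) ≤ 1 / (L ^ 2 * K * logSum W N 2 L) *
          ((2 : ℝ) ^ m.primeFactors.card / m) := by
        intro m _
        have h1 : logWeight 2 L m ≤ 1 / L ^ 2 * (1 / m) := by
          refine (logWeight_succ_le 1 hL m).trans ?_
          rw [sq, ← one_div_mul_one_div, mul_assoc]
          refine mul_le_mul_of_nonneg_left ?_ (by positivity)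
          have := logWeight_succ_le 0 hL m
          rwa [logWeight_zero] at this
        calc _ ≤ (1 / L ^ 2 * (1 / m)) / logSum W N 2 L *
              ((2 : ℝ) ^ m.primeFactors.card / K) := by gcongr
          _ = _ := by ring
      refine (Finset.sum_le_sum this).trans ?_
      rw [← Finset.mul_sum]
      refine (mul_le_mul_of_nonneg_left (le_trans ?_ (sum_two_pow_card_div_le N))
        (by positivity)).trans (le_of_eq (by ring))
      exact Finset.sum_le_sum_of_subset_of_nonneg (Finset.filter_subset _ _)
        fun _ _ _ => by positivity
  have hmean : μ ≤ logSum W N 1 L / logSum W N 2 L := weighted_mean_log_le hL hI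
  have b4 : prodExpect (tupleSupport j W N) (tupleWeight j W N L)
      (fun n => (1 / D ^ 2) * (∑ i, if i = j then 0 else Real.log (n i) - μ) ^ 2)
      ≤ Fintype.card ι * (Real.log N * (logSum W N 1 L / logSum W N 2 L)) / D ^ 2 := by
    rw [prodExpect_const_mul]
    have := prodExpect_sq_sum_le (tupleSupport j W N) (tupleWeight j W N L) hw
      (fun i m => if i = j then 0 else Real.log m - μ) (fun i => by
        unfold tupleSupport tupleWeight
        split_ifs with h
        · simp
        · simp only [mul_sub, Finset.sum_sub_distrib, ← hμ, ← Finset.sum_mul]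
          rw [← Finset.sum_div, show (∑ m ∈ coprimeUpto W N, logWeight 2 L m) = logSum W N 2 L
            from rfl, div_self hI.ne', one_mul, sub_self])
    rw [this, one_div_mul_eq_div]
    refine div_le_div_of_nonneg_right ?_ (sq_nonneg D)
    rw [← nsmul_eq_mul, ← Finset.card_univ]
    have hlogN := Real.log_natCast_nonneg N
    refine Finset.sum_le_card_nsmul _ _ _ fun i _ => ?_
    unfold tupleSupport tupleWeight
    split_ifs with h
    · have : 0 ≤ logSum W N 1 L := Finset.sum_nonneg fun m _ => logWeight_nonneg 1 hL.le m
      simp only [ne_eq, OfNat.ofNat_ne_zero, not_false_eq_true, zero_pow, mul_zero,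
        Finset.sum_const_zero]
      positivity
    · have e1 : ∑ m ∈ coprimeUpto W N, logWeight 2 L m / logSum W N 2 L * (Real.log m - μ) ^ 2
          = ∑ m ∈ coprimeUpto W N, logWeight 2 L m / logSum W N 2 L * Real.log m ^ 2 - μ ^ 2 := by
        have hexp : ∀ m : ℕ, logWeight 2 L m / logSum W N 2 L * (Real.log m - μ) ^ 2
          = logWeight 2 L m / logSum W N 2 L * Real.log m ^ 2
            - 2 * μ * (logWeight 2 L m / logSum W N 2 L * Real.log m)
            + μ ^ 2 * (logWeight 2 L m / logSum W N 2 L) := fun m => by ring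
        simp only [hexp, Finset.sum_add_distrib, Finset.sum_sub_distrib, ← Finset.mul_sum, ← hμ]
        rw [← Finset.sum_div, show (∑ m ∈ coprimeUpto W N, logWeight 2 L m) = logSum W N 2 L
            from rfl, div_self hI.ne']
        ring
      rw [e1]
      -- The second moment is at most `log N` times the mean. Since `log N` is much smaller than
      -- `log R`, this suffices for concentration.
      have e2 : ∑ m ∈ coprimeUpto W N, logWeight 2 L m / logSum W N 2 L * Real.log m ^ 2
          ≤ Real.log N * μ := by
        rw [hμ, Finset.mul_sum]
        refine Finset.sum_le_sum fun m hm => ?_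
        obtain ⟨⟨h1, h2⟩, -⟩ := mem_coprimeUpto.1 hm
        have h3 : Real.log m ≤ Real.log N :=
          Real.log_le_log (by exact_mod_cast h1) (by exact_mod_cast h2)
        calc _ = Real.log m * (logWeight 2 L m / logSum W N 2 L * Real.log m) := by ring
          _ ≤ _ := mul_le_mul_of_nonneg_right h3
            (mul_nonneg (hlw m) (Real.log_natCast_nonneg m))
      have e3 := mul_le_mul_of_nonneg_left hmean hlogN
      nlinarith [sq_nonneg μ]
  linarith

/-- Lower bound for the expected sieve weight when `n + h j` is conditioned to be rough. -/
theorem expect_sieveWeight_ge (hS : ∀ p ∈ S, p.Prime) (hk : ∀ p ∈ S, 4 * Fintype.card ι ≤ p)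
    {W N : ℕ} (hWS : ∀ p, p.Prime → p ≤ N → p.Coprime W → p ∈ S) {L K R D : ℝ} (hL : 0 < L)
    (hK : 1 ≤ K) (hN : 1 ≤ N) (hR : 0 < R) (hI1 : 0 < logSum W N 1 L) (hI2 : 0 < logSum W N 2 L)
    (hD : 0 < D) (hDR : D + Fintype.card ι * (logSum W N 1 L / logSum W N 2 L)
      ≤ Real.log R - Real.log N) (j : ι) :
    logSum W N 2 L ^ (Fintype.card ι - 1) * (logSum W N 1 L ^ 2 *
      (1 - 14 * Fintype.card ι ^ 2 * ∑ p ∈ S, 1 / (p : ℝ) ^ 2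
        - 2 * (∑ m ∈ Finset.Icc 1 N, 1 / (m : ℝ)) ^ 2 / (L * K * logSum W N 1 L)
        - Fintype.card ι * ((∑ m ∈ Finset.Icc 1 N, 1 / (m : ℝ)) ^ 2 / (L ^ 2 * K * logSum W N 2 L))
        - Fintype.card ι * (Real.log N * (logSum W N 1 L / logSum W N 2 L)) / D ^ 2))
      ≤ ∑ χ : S → Option ι, (∏ p : S, reducedWeight j ((p : ℕ) : ℝ) (χ p)) *
          sieveWeight (truncG L K N) R χ := by
  classical
  have hp2 : ∀ p : S, (2 : ℝ) ≤ (p : ℕ) := fun p => by exact_mod_cast (hS p p.2).two_le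
  have hpk : ∀ p : S, 4 * (Fintype.card ι : ℝ) ≤ (p : ℕ) := fun p => by exact_mod_cast hk p p.2
  have hw0 := tupleWeight_nonneg j W N hL.le
  refine le_trans ?_ (tensor_quadratic_le (fun p : S => lowerWeight j ((p : ℕ) : ℝ))
    (fun p s => lowerWeight_nonneg j (hp2 p) (hpk p) s)
    (fun p : S => reducedWeight j ((p : ℕ) : ℝ))
    (fun p s => reducedWeight_nonneg j (hp2 p) (hpk p) s)
    (fun p => lowerFn j ((p : ℕ) : ℝ)) (fun p => basisFn ((p : ℕ) : ℝ))
    (fun p c => lower_form_le j _ (hp2 p) (hpk p) c) (sieveCoeff (truncG L K N) R))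
  set s := ∑ p ∈ S, 1 / (p : ℝ) ^ 2 with hs
  set H := (∑ m ∈ Finset.Icc 1 N, 1 / (m : ℝ)) ^ 2
  set I1 := logSum W N 1 L with hI1e
  set I2 := logSum W N 2 L with hI2e
  set μ := ∑ m ∈ coprimeUpto W N, logWeight 2 L m / logSum W N 2 L * Real.log m with hμ
  set 𝒜 := Fintype.piFinset (tupleSupport j W N) with h𝒜
  set 𝒢 := 𝒜.filter fun n => GoodTuple S j N K R n with h𝒢
  let Y : (ι → ℕ) → ℝ := fun n => 1 - 6 * s - (4 * Fintype.card ι + 2) * recipSum S n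
        - 2 * H / (L * K * I1)
  have hs0 : 0 ≤ s := Finset.sum_nonneg fun _ _ => by positivity
  have hmean : μ ≤ I1 / I2 := weighted_mean_log_le hL hI2
  have hY1 : ∀ n, Y n ≤ 1 := fun n => by
    have := recipSum_nonneg S n
    have : 0 ≤ (4 * Fintype.card ι + 2) * recipSum S n := by positivity
    have : 0 ≤ 2 * H / (L * K * I1) := by positivity
    simp only [Y]; linarith
  have hcard : 1 ≤ Fintype.card ι := Fintype.card_pos_iff.2 ⟨j⟩
  have hcard' : (1 : ℝ) ≤ Fintype.card ι := by exact_mod_cast hcard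
  have hgoodcol : ∀ n ∈ 𝒢, ∀ i, colorPart (tupleColoring S n) i = n i := fun n hn i =>
    have hg := (Finset.mem_filter.1 hn).2
    colorPart_tupleColoring hS hg.cop i (hg.sq i) (hg.mem i)
  -- Good tuples have distinct colourings, and the terms of all other colourings are nonnegative.
  have step1 : ∑ n ∈ 𝒢, (∏ i ∈ Finset.univ.erase j, logWeight 2 L (n i)) * (I1 ^ 2 * Y n)
      ≤ ∑ u : S → Option ι, (∏ p : S, lowerWeight j ((p : ℕ) : ℝ) (u p)) *
        (∑ d : S → Option ι, sieveCoeff (truncG L K N) R d *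
          ∏ p : S, lowerFn j ((p : ℕ) : ℝ) (d p) (u p)) ^ 2 := by
    calc _ ≤ ∑ n ∈ 𝒢, (∏ p : S, lowerWeight j ((p : ℕ) : ℝ) (tupleColoring S n p)) *
        (∑ d : S → Option ι, sieveCoeff (truncG L K N) R d *
          ∏ p : S, lowerFn j ((p : ℕ) : ℝ) (d p) (tupleColoring S n p)) ^ 2 :=
          Finset.sum_le_sum fun n hn => goodTuple_term_ge hS hk hWS hL (by linarith) hI1
            (Finset.mem_filter.1 hn).2
      _ = ∑ u ∈ 𝒢.image (tupleColoring S), (∏ p : S, lowerWeight j ((p : ℕ) : ℝ) (u p)) *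
        (∑ d : S → Option ι, sieveCoeff (truncG L K N) R d *
          ∏ p : S, lowerFn j ((p : ℕ) : ℝ) (d p) (u p)) ^ 2 := by
          rw [Finset.sum_image]
          intro n hn n' hn' h
          funext i
          rw [← hgoodcol n hn i, ← hgoodcol n' hn' i, h]
      _ ≤ _ := Finset.sum_le_sum_of_subset_of_nonneg (Finset.subset_univ _) fun u _ _ =>
          mul_nonneg (Finset.prod_nonneg fun p _ => lowerWeight_nonneg j (hp2 p) (hpk p) _)
            (sq_nonneg _)
  refine le_trans ?_ step1
  have hwprod : ∀ n : ι → ℕ, ∏ i ∈ Finset.univ.erase j, logWeight 2 L (n i)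
      = I2 ^ (Fintype.card ι - 1) * ∏ i, tupleWeight j W N L i (n i) := by
    intro n
    rw [← Finset.mul_prod_erase _ _ (Finset.mem_univ j)]
    simp only [tupleWeight, if_true, one_mul]
    rw [← Finset.card_univ, ← Finset.card_erase_of_mem (Finset.mem_univ j),
      ← Finset.prod_const, ← Finset.prod_mul_distrib]
    refine Finset.prod_congr rfl fun i hi => ?_
    rw [if_neg (Finset.ne_of_mem_erase hi), mul_div_cancel₀ _ hI2.ne']
  simp only [hwprod]
  have e1 : ∑ n ∈ 𝒢, I2 ^ (Fintype.card ι - 1) * (∏ i, tupleWeight j W N L i (n i)) *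
      (I1 ^ 2 * Y n) = I2 ^ (Fintype.card ι - 1) * (I1 ^ 2 *
        ∑ n ∈ 𝒢, (∏ i, tupleWeight j W N L i (n i)) * Y n) := by
    simp only [Finset.mul_sum]
    exact Finset.sum_congr rfl fun n _ => by ring
  rw [e1]
  refine mul_le_mul_of_nonneg_left (mul_le_mul_of_nonneg_left ?_ (sq_nonneg _))
    (pow_nonneg hI2.le _)
  have e2 : prodExpect (tupleSupport j W N) (tupleWeight j W N L)
      (fun n => Y n + (-1) * badBound S j K D μ n)
      ≤ ∑ n ∈ 𝒢, (∏ i, tupleWeight j W N L i (n i)) * Y n := by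
    -- On a good tuple the penalty is only subtracted; on a bad one `Y ≤ 1 ≤ badBound`, so the
    -- summand is nonpositive. The restriction to good tuples thus costs only the mean penalty.
    rw [h𝒢, Finset.sum_filter]
    refine Finset.sum_le_sum fun n hn => ?_
    have hp0 : 0 ≤ ∏ i, tupleWeight j W N L i (n i) := Finset.prod_nonneg fun i _ => hw0 _ _
    split_ifs with hg
    · refine mul_le_mul_of_nonneg_left ?_ hp0
      obtain ⟨q1, q2, q3⟩ := badBound_parts_nonneg S j (zero_le_one.trans hK) n
      have : 0 ≤ badBound S j K D μ n := by
        unfold badBound; positivity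
      linarith
    · refine mul_nonpos_of_nonneg_of_nonpos hp0 ?_
      have := one_le_badBound hWS hN hK hR hD (div_nonneg hI1.le hI2.le) hmean hDR hn hg
      linarith [hY1 n]
  refine le_trans ?_ e2
  rw [prodExpect_add, prodExpect_const_mul]
  have e3 : prodExpect (tupleSupport j W N) (tupleWeight j W N L) Y
      = (1 - 6 * s - 2 * H / (L * K * I1)) + -(4 * Fintype.card ι + 2) *
        prodExpect (tupleSupport j W N) (tupleWeight j W N L) (recipSum S) := by
    have : Y = fun n => (1 - 6 * s - 2 * H / (L * K * I1)) * 1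
        + -(4 * Fintype.card ι + 2) * recipSum S n := by funext n; simp only [Y]; ring
    rw [this, prodExpect_add, prodExpect_const_mul, prodExpect_const_mul,
      prodExpect_one _ _ (sum_tupleWeight j hI2), mul_one]
  rw [e3]
  have e4 := expect_recipSum_le hS j hL hI2
  have e5 := expect_badBound_le (K := K) (D := D) hS j hL (by linarith) hI2
  have e6 := mul_le_mul_of_nonneg_left e4 (show 0 ≤ 4 * (Fintype.card ι : ℝ) + 2 by positivity)
  -- The terms add to `5k^2 + 3k + 6`, which is at most `14 k^2` for `k ≥ 1`.
  have e7 : 6 * s + (4 * (Fintype.card ι : ℝ) + 2) * (Fintype.card ι * s)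
      + (Fintype.card ι + Fintype.card ι ^ 2) * s ≤ 14 * Fintype.card ι ^ 2 * s := by
    have : 6 + (4 * (Fintype.card ι : ℝ) + 2) * Fintype.card ι
      + (Fintype.card ι + Fintype.card ι ^ 2) ≤ 14 * Fintype.card ι ^ 2 := by nlinarith
    calc _ = (6 + (4 * (Fintype.card ι : ℝ) + 2) * Fintype.card ι
      + (Fintype.card ι + Fintype.card ι ^ 2)) * s := by ring
      _ ≤ _ := by gcongr
  linarith

end Expectation

/-! ### Partial summation and the asymptotics of the logarithmic sums. -/

/-- Abel summation. The induction carries the difference from the boundary term `(∑ c) h N`, for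
which the bound `B (h 1 - h N)` telescopes. -/
theorem abs_sum_mul_antitone_le (c h : ℕ → ℝ) (B : ℝ) (N : ℕ) (h0 : ∀ m, 0 ≤ h m)
    (hanti : ∀ m, 1 ≤ m → h (m + 1) ≤ h m) (hB : ∀ M, |∑ m ∈ Finset.Icc 1 M, c m| ≤ B)
    (hN : 1 ≤ N) : |∑ m ∈ Finset.Icc 1 N, c m * h m| ≤ B * h 1 := by
  have key : |∑ m ∈ Finset.Icc 1 N, c m * h m - (∑ m ∈ Finset.Icc 1 N, c m) * h N|
      ≤ B * (h 1 - h N) := by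
    induction N, hN using Nat.le_induction with
    | base => simp
    | succ n hn ih =>
      rw [Finset.sum_Icc_succ_top (by omega), Finset.sum_Icc_succ_top (by omega)]
      have e : ∑ m ∈ Finset.Icc 1 n, c m * h m + c (n + 1) * h (n + 1)
          - (∑ m ∈ Finset.Icc 1 n, c m + c (n + 1)) * h (n + 1)
          = (∑ m ∈ Finset.Icc 1 n, c m * h m - (∑ m ∈ Finset.Icc 1 n, c m) * h n)
            + (∑ m ∈ Finset.Icc 1 n, c m) * (h n - h (n + 1)) := by ring
      rw [e]
      have h1 : 0 ≤ h n - h (n + 1) := sub_nonneg.2 (hanti n hn)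
      calc _ ≤ |∑ m ∈ Finset.Icc 1 n, c m * h m - (∑ m ∈ Finset.Icc 1 n, c m) * h n|
            + |(∑ m ∈ Finset.Icc 1 n, c m) * (h n - h (n + 1))| := abs_add_le _ _
        _ ≤ B * (h 1 - h n) + B * (h n - h (n + 1)) := by
            rw [abs_mul, abs_of_nonneg h1]
            exact add_le_add ih (mul_le_mul_of_nonneg_right (hB n) h1)
        _ = _ := by ring
  have h2 : |(∑ m ∈ Finset.Icc 1 N, c m) * h N| ≤ B * h N := by
    rw [abs_mul, abs_of_nonneg (h0 N)]
    exact mul_le_mul_of_nonneg_right (hB N) (h0 N)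
  calc _ = |(∑ m ∈ Finset.Icc 1 N, c m * h m - (∑ m ∈ Finset.Icc 1 N, c m) * h N)
        + (∑ m ∈ Finset.Icc 1 N, c m) * h N| := by rw [sub_add_cancel]
    _ ≤ _ := abs_add_le _ _
    _ ≤ B * h 1 := by linarith

/-- The summand is periodic modulo `W` with zero sum over a period, so only an incomplete period of
fewer than `W` terms of size at most `1` remains. The extra `1` pays for the term at `0`. -/
theorem abs_sum_coprime_sub_le {W : ℕ} (hW : 0 < W) (M : ℕ) :
    |∑ m ∈ Finset.Icc 1 M, ((if m.Coprime W then (1 : ℝ) else 0) - W.totient / W)| ≤ W + 1 := by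
  set c : ℕ → ℝ := fun m => (if m.Coprime W then (1 : ℝ) else 0) - W.totient / W with hc
  have hW' : (0 : ℝ) < W := by exact_mod_cast hW
  have hφ : (W.totient : ℝ) / W ≤ 1 := by
    rw [div_le_one hW']; exact_mod_cast Nat.totient_le W
  have hφ0 : 0 ≤ (W.totient : ℝ) / W := by positivity
  have hc1 : ∀ m, |c m| ≤ 1 := fun m => by
    simp only [hc]; split_ifs <;> rw [abs_le] <;> constructor <;> linarith
  have hper : ∀ n, ∑ m ∈ Finset.Ico n (n + W), c m = 0 := by
    intro n
    simp only [hc, Finset.sum_sub_distrib, Finset.sum_const, Nat.card_Ico, nsmul_eq_mul,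
      Finset.sum_boole]
    have : (Finset.Ico n (n + W)).filter (fun m => m.Coprime W)
        = (Finset.Ico n (n + W)).filter W.Coprime := by
      ext m; simp [Nat.coprime_comm]
    rw [this, Nat.filter_coprime_Ico_eq_totient, Nat.add_sub_cancel_left]
    field_simp
    ring
  have hstep : ∀ n q, ∑ m ∈ Finset.range (n + W * q), c m = ∑ m ∈ Finset.range n, c m := by
    intro n q
    induction q with
    | zero => simp
    | succ q ih =>
      rw [← ih, Finset.range_eq_Ico, Finset.range_eq_Ico,
        ← Finset.sum_Ico_consecutive c (Nat.zero_le (n + W * q)) (show n + W * q ≤ n + W * (q + 1)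
          by nlinarith), show n + W * (q + 1) = (n + W * q) + W by ring, hper, add_zero]
  have hr : |∑ m ∈ Finset.range (M + 1), c m| ≤ W := by
    rw [← Nat.mod_add_div (M + 1) W, hstep]
    calc _ ≤ ∑ m ∈ Finset.range ((M + 1) % W), |c m| := Finset.abs_sum_le_sum_abs _ _
      _ ≤ ∑ m ∈ Finset.range ((M + 1) % W), 1 := Finset.sum_le_sum fun m _ => hc1 m
      _ = (((M + 1) % W : ℕ) : ℝ) := by simp
      _ ≤ W := by exact_mod_cast (Nat.mod_lt _ hW).le
  have hIcc : ∑ m ∈ Finset.range (M + 1), c m = c 0 + ∑ m ∈ Finset.Icc 1 M, c m := by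
    rw [Finset.range_eq_Ico, Finset.sum_eq_sum_Ico_succ_bot (by omega)]
    rfl
  have : ∑ m ∈ Finset.Icc 1 M, c m = ∑ m ∈ Finset.range (M + 1), c m - c 0 := by rw [hIcc]; ring
  rw [this]
  calc _ ≤ |∑ m ∈ Finset.range (M + 1), c m| + |c 0| := abs_sub _ _
    _ ≤ _ := add_le_add hr (hc1 0)

section LogSumAsymptotics

theorem logWeight_one (a : ℕ) (L : ℝ) : logWeight a L 1 = 1 / L ^ a := by simp [logWeight]

theorem logWeight_succ_arg_le (a : ℕ) {L : ℝ} (hL : 0 < L) (m : ℕ) (hm : 1 ≤ m) :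
    logWeight a L (m + 1) ≤ logWeight a L m := by
  unfold logWeight
  have h1 := Real.log_natCast_nonneg m
  have hm' : (0 : ℝ) < m := by exact_mod_cast hm
  have h2 : Real.log m ≤ Real.log (m + 1 : ℕ) := Real.log_le_log hm' (by push_cast; linarith)
  push_cast at h2 ⊢
  gcongr
  linarith

theorem abs_logSum_sub_le {W N : ℕ} (hW : 0 < W) (hN : 1 ≤ N) (a : ℕ) {L : ℝ} (hL : 0 < L) :
    |logSum W N a L - W.totient / W * ∑ m ∈ Finset.Icc 1 N, logWeight a L m|
      ≤ (W + 1) * (1 / L ^ a) := by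
  have := abs_sum_mul_antitone_le _ (logWeight a L) (W + 1) N (logWeight_nonneg a hL.le)
    (logWeight_succ_arg_le a hL) (abs_sum_coprime_sub_le hW) hN
  rw [logWeight_one] at this
  convert this using 2
  rw [logSum, coprimeUpto, Finset.sum_filter, Finset.mul_sum, ← Finset.sum_sub_distrib]
  refine Finset.sum_congr rfl fun m _ => ?_
  split_ifs <;> ring

theorem log_succ_sub_log_le {m : ℕ} (hm : 1 ≤ m) :
    Real.log (m + 1 : ℕ) - Real.log m ≤ 1 / m := by
  have hm' : (0 : ℝ) < m := by exact_mod_cast hm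
  rw [← Real.log_div (by positivity) hm'.ne']
  refine (Real.log_le_sub_one_of_pos (by positivity)).trans (le_of_eq ?_)
  push_cast; field_simp; ring

theorem le_log_succ_sub_log {m : ℕ} (hm : 1 ≤ m) :
    1 / ((m + 1 : ℕ) : ℝ) ≤ Real.log (m + 1 : ℕ) - Real.log m := by
  have hm' : (0 : ℝ) < m := by exact_mod_cast hm
  rw [← Real.log_div (by positivity) hm'.ne']
  refine le_trans (le_of_eq ?_) (Real.one_sub_inv_le_log_of_pos (by positivity))
  push_cast; field_simp; ring

theorem log_div_add_mono {a b c : ℝ} (ha : 0 < a) (hab : a ≤ b) (h : (b - a) / a ≤ c) :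
    Real.log b - Real.log a ≤ c := by
  rw [← Real.log_div (by linarith) ha.ne']
  refine (Real.log_le_sub_one_of_pos (div_pos (by linarith) ha)).trans (le_trans (le_of_eq ?_) h)
  field_simp

/-- Comparison with the primitive `log (L + log t)` of `1/(t (L + log t))`, in telescoped form. -/
theorem sum_logWeight_one_ge {L : ℝ} (hL : 0 < L) (N : ℕ) :
    Real.log (L + Real.log (N + 1 : ℕ)) - Real.log L
      ≤ ∑ m ∈ Finset.Icc 1 N, logWeight 1 L m := by
  induction N with
  | zero => simp
  | succ n ih =>
    rw [Finset.sum_Icc_succ_top (by omega)]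
    have h0 := Real.log_natCast_nonneg (n + 1)
    have hle := log_succ_sub_log_le (m := n + 1) (by omega)
    have hmono : Real.log (n + 1 : ℕ) ≤ Real.log (n + 1 + 1 : ℕ) :=
      Real.log_le_log (by positivity) (by push_cast; linarith)
    have := log_div_add_mono (a := L + Real.log (n + 1 : ℕ)) (b := L + Real.log (n + 1 + 1 : ℕ))
      (c := logWeight 1 L (n + 1)) (by linarith) (by linarith) (by
        rw [logWeight, pow_one, ← one_div_mul_one_div, div_eq_mul_one_div]
        exact mul_le_mul_of_nonneg_right (by linarith) (by positivity))
    linarith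

theorem sum_logWeight_one_le {L : ℝ} (hL : 0 < L) {N : ℕ} (hN : 1 ≤ N) :
    ∑ m ∈ Finset.Icc 1 N, logWeight 1 L m
      ≤ 1 / L + (Real.log (L + Real.log N) - Real.log L) := by
  induction N, hN using Nat.le_induction with
  | base => simp [logWeight]
  | succ n hn ih =>
    rw [Finset.sum_Icc_succ_top (by omega)]
    have h0 := Real.log_natCast_nonneg n
    have h1 := Real.log_natCast_nonneg (n + 1)
    have hle := le_log_succ_sub_log hn
    have hb : 0 < L + Real.log (n + 1 : ℕ) := by linarith
    have ha : 0 < L + Real.log n := by linarith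
    have : logWeight 1 L (n + 1) ≤
        Real.log (L + Real.log (n + 1 : ℕ)) - Real.log (L + Real.log n) := by
      rw [← Real.log_div hb.ne' ha.ne']
      refine le_trans ?_ (Real.one_sub_inv_le_log_of_pos (by positivity))
      rw [logWeight, pow_one, ← one_div_mul_one_div, inv_div, one_sub_div hb.ne',
        div_eq_mul_one_div (_ - _)]
      exact mul_le_mul_of_nonneg_right (by linarith) (by positivity)
    linarith

/-- Comparison with the primitive `-1/(L + log t)` of `1/(t (L + log t)^2)`, in telescoped form. -/
theorem sum_logWeight_two_ge {L : ℝ} (hL : 0 < L) (N : ℕ) :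
    1 / L - 1 / (L + Real.log (N + 1 : ℕ)) ≤ ∑ m ∈ Finset.Icc 1 N, logWeight 2 L m := by
  induction N with
  | zero => simp
  | succ n ih =>
    rw [Finset.sum_Icc_succ_top (by omega)]
    have h0 := Real.log_natCast_nonneg (n + 1)
    have hle := log_succ_sub_log_le (m := n + 1) (by omega)
    have hmono : Real.log (n + 1 : ℕ) ≤ Real.log (n + 1 + 1 : ℕ) :=
      Real.log_le_log (by positivity) (by push_cast; linarith)
    set a := L + Real.log (n + 1 : ℕ) with ha
    set b := L + Real.log (n + 1 + 1 : ℕ) with hb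
    have ha0 : 0 < a := by linarith
    have hab : a ≤ b := by linarith
    have : 1 / a - 1 / b ≤ logWeight 2 L (n + 1) := by
      rw [logWeight, ← ha, ← one_div_mul_one_div, div_sub_div _ _ ha0.ne' (by linarith),
        div_eq_mul_one_div]
      refine mul_le_mul (by linarith) ?_ (by positivity) (by positivity)
      exact one_div_le_one_div_of_le (by positivity) (by nlinarith)
    linarith

theorem sum_logWeight_two_le {L : ℝ} (hL : 0 < L) {N : ℕ} (hN : 1 ≤ N) :
    ∑ m ∈ Finset.Icc 1 N, logWeight 2 L m ≤ 1 / L ^ 2 + (1 / L - 1 / (L + Real.log N)) := by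
  induction N, hN using Nat.le_induction with
  | base => simp [logWeight]
  | succ n hn ih =>
    rw [Finset.sum_Icc_succ_top (by omega)]
    have h0 := Real.log_natCast_nonneg n
    have hle := le_log_succ_sub_log hn
    have hmono : Real.log n ≤ Real.log (n + 1 : ℕ) :=
      Real.log_le_log (by exact_mod_cast hn) (by push_cast; linarith)
    set a := L + Real.log n with ha
    set b := L + Real.log (n + 1 : ℕ) with hb
    have ha0 : 0 < a := by linarith
    have hab : a ≤ b := by linarith
    have hb0 : 0 < b := by linarith
    have : logWeight 2 L (n + 1) ≤ 1 / a - 1 / b := by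
      rw [logWeight, ← hb, ← one_div_mul_one_div, div_sub_div _ _ ha0.ne' hb0.ne',
        div_eq_mul_one_div (_ - _)]
      refine mul_le_mul (by linarith) ?_ (by positivity) (by linarith)
      exact one_div_le_one_div_of_le (by positivity) (by nlinarith)
    linarith

/-- The range of summation as a function of the parameter `L`. -/
noncomputable def expFloor (β L : ℝ) : ℕ := ⌊Real.exp (β * L)⌋₊

theorem one_le_expFloor {β L : ℝ} (hβ : 0 ≤ β) (hL : 0 ≤ L) : 1 ≤ expFloor β L :=
  Nat.one_le_floor_iff _ |>.2 (Real.one_le_exp (mul_nonneg hβ hL))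

theorem log_expFloor_le {β L : ℝ} (hβ : 0 ≤ β) (hL : 0 ≤ L) : Real.log (expFloor β L) ≤ β * L := by
  have h1 : (0 : ℝ) < expFloor β L := by exact_mod_cast one_le_expFloor hβ hL
  rw [Real.log_le_iff_le_exp h1]
  exact Nat.floor_le (Real.exp_pos _).le

theorem le_log_expFloor_succ (β L : ℝ) : β * L ≤ Real.log (expFloor β L + 1 : ℕ) := by
  rw [Real.le_log_iff_exp_le (by positivity)]
  push_cast
  exact (Nat.lt_floor_add_one _).le

theorem abs_logSum_one_sub_le {W : ℕ} (hW : 0 < W) {β L : ℝ} (hβ : 0 ≤ β) (hL : 0 < L) :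
    |logSum W (expFloor β L) 1 L - W.totient / W * Real.log (1 + β)| ≤ (W + 2) * (1 / L) := by
  have hN := one_le_expFloor hβ hL.le
  have h1 := abs_logSum_sub_le hW hN 1 hL
  have hW' : (0 : ℝ) < W := by exact_mod_cast hW
  have hφ : (W.totient : ℝ) / W ≤ 1 := by
    rw [div_le_one hW']; exact_mod_cast Nat.totient_le W
  have hφ0 : 0 ≤ (W.totient : ℝ) / W := by positivity
  set T := ∑ m ∈ Finset.Icc 1 (expFloor β L), logWeight 1 L m
  have elog : Real.log (1 + β) = Real.log (L + β * L) - Real.log L := by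
    rw [← Real.log_div (by positivity) hL.ne']; congr 1; field_simp
  have h2 : Real.log (1 + β) ≤ T := by
    refine le_trans ?_ (sum_logWeight_one_ge hL _)
    rw [elog]
    have := le_log_expFloor_succ β L
    have : Real.log (L + β * L) ≤ Real.log (L + Real.log (expFloor β L + 1 : ℕ)) :=
      Real.log_le_log (by positivity) (by linarith)
    linarith
  have h3 : T ≤ 1 / L + Real.log (1 + β) := by
    refine (sum_logWeight_one_le hL hN).trans ?_
    rw [elog]
    have := log_expFloor_le hβ hL.le
    have h0 := Real.log_natCast_nonneg (expFloor β L)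
    have : Real.log (L + Real.log (expFloor β L)) ≤ Real.log (L + β * L) :=
      Real.log_le_log (by linarith) (by linarith)
    linarith
  rw [pow_one] at h1
  have hL1 : 0 < 1 / L := by positivity
  rw [abs_le] at h1 ⊢
  constructor <;> nlinarith

theorem abs_logSum_two_sub_le {W : ℕ} (hW : 0 < W) {β L : ℝ} (hβ : 0 ≤ β) (hL : 0 < L) :
    |L * logSum W (expFloor β L) 2 L - W.totient / W * (β / (1 + β))| ≤ (W + 2) * (1 / L) := by
  have hN := one_le_expFloor hβ hL.le
  have h1 := abs_logSum_sub_le hW hN 2 hL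
  have hW' : (0 : ℝ) < W := by exact_mod_cast hW
  have hφ : (W.totient : ℝ) / W ≤ 1 := by
    rw [div_le_one hW']; exact_mod_cast Nat.totient_le W
  have hφ0 : 0 ≤ (W.totient : ℝ) / W := by positivity
  set T := ∑ m ∈ Finset.Icc 1 (expFloor β L), logWeight 2 L m
  have e1 : β / (1 + β) = L * (1 / L - 1 / (L + β * L)) := by field_simp; ring
  have h2 : β / (1 + β) ≤ L * T := by
    rw [e1]
    refine mul_le_mul_of_nonneg_left (le_trans ?_ (sum_logWeight_two_ge hL _)) hL.le
    have := le_log_expFloor_succ β L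
    have : 1 / (L + Real.log (expFloor β L + 1 : ℕ)) ≤ 1 / (L + β * L) :=
      one_div_le_one_div_of_le (by positivity) (by linarith)
    linarith
  have h3 : L * T ≤ 1 / L + β / (1 + β) := by
    have h3' : T ≤ 1 / L ^ 2 + (1 / L - 1 / (L + β * L)) := by
      refine (sum_logWeight_two_le hL hN).trans ?_
      have := log_expFloor_le hβ hL.le
      have h0 := Real.log_natCast_nonneg (expFloor β L)
      have : 1 / (L + β * L) ≤ 1 / (L + Real.log (expFloor β L)) :=
        one_div_le_one_div_of_le (by linarith) (by linarith)
      linarith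
    calc L * T ≤ L * (1 / L ^ 2 + (1 / L - 1 / (L + β * L))) :=
          mul_le_mul_of_nonneg_left h3' hL.le
      _ = _ := by rw [mul_add, ← e1]; field_simp
  have h4 : |L * logSum W (expFloor β L) 2 L - W.totient / W * (L * T)| ≤ (W + 1) * (1 / L) := by
    have : L * logSum W (expFloor β L) 2 L - W.totient / W * (L * T)
        = L * (logSum W (expFloor β L) 2 L - W.totient / W * T) := by ring
    rw [this, abs_mul, abs_of_pos hL]
    refine (mul_le_mul_of_nonneg_left h1 hL.le).trans (le_of_eq ?_)
    field_simp
  have hL1 : 0 < 1 / L := by positivity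
  rw [abs_le] at h4 ⊢
  constructor <;> nlinarith

theorem tendsto_of_abs_sub_le {f : ℝ → ℝ} {a C : ℝ} (h : ∀ L, 0 < L → |f L - a| ≤ C * (1 / L)) :
    Tendsto f atTop (𝓝 a) := by
  rw [tendsto_iff_norm_sub_tendsto_zero]
  have : Tendsto (fun L : ℝ => C * (1 / L)) atTop (𝓝 0) := by
    simpa using (tendsto_inv_atTop_zero (𝕜 := ℝ)).const_mul C
  refine squeeze_zero' (Eventually.of_forall fun _ => norm_nonneg _) ?_ this
  filter_upwards [eventually_gt_atTop 0] with L hL using h L hL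

theorem tendsto_logSum_one {W : ℕ} (hW : 0 < W) {β : ℝ} (hβ : 0 ≤ β) :
    Tendsto (fun L => logSum W (expFloor β L) 1 L) atTop
      (𝓝 (W.totient / W * Real.log (1 + β))) :=
  tendsto_of_abs_sub_le fun _ hL => abs_logSum_one_sub_le hW hβ hL

theorem tendsto_logSum_two {W : ℕ} (hW : 0 < W) {β : ℝ} (hβ : 0 ≤ β) :
    Tendsto (fun L => L * logSum W (expFloor β L) 2 L) atTop
      (𝓝 (W.totient / W * (β / (1 + β)))) :=
  tendsto_of_abs_sub_le fun _ hL => abs_logSum_two_sub_le hW hβ hL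

end LogSumAsymptotics

/-! ### Residue classes and counting in progressions. -/

section Residues

/-- Chinese remainder theorem for a base modulus and finitely many primes. -/
theorem exists_modEq_primes {W : ℕ} (S : Finset ℕ) (hS : ∀ p ∈ S, p.Prime)
    (hW : ∀ p ∈ S, p.Coprime W) (b : ℤ) (r : ℕ → ℤ) :
    ∃ a : ℤ, a ≡ b [ZMOD W] ∧ ∀ p ∈ S, a ≡ r p [ZMOD p] := by
  classical
  suffices h : ∃ a : ℤ, a ≡ b [ZMOD W] ∧ ∀ p ∈ S, a ≡ r p [ZMOD p] from h
  induction S using Finset.induction_on with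
  | empty => exact ⟨b, Int.ModEq.refl _, by simp⟩
  | insert p S hp ih =>
    obtain ⟨a, ha, har⟩ := ih (fun q hq => hS q (Finset.mem_insert_of_mem hq))
      fun q hq => hW q (Finset.mem_insert_of_mem hq)
    have hcop : IsCoprime ((W * ∏ q ∈ S, q : ℕ) : ℤ) (p : ℤ) := by
      rw [Nat.isCoprime_iff_coprime]
      refine Nat.Coprime.mul_left (hW p (Finset.mem_insert_self _ _)).symm
        (Nat.Coprime.prod_left fun q hq => ?_)
      refine (Nat.coprime_primes (hS q (Finset.mem_insert_of_mem hq))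
        (hS p (Finset.mem_insert_self _ _))).2 ?_
      rintro rfl
      exact hp hq
    obtain ⟨u, v, huv⟩ := hcop
    set Q : ℤ := ((W * ∏ q ∈ S, q : ℕ) : ℤ) with hQ
    have key : ∀ m : ℤ, m ∣ Q → a * (v * p) + r p * (u * Q) ≡ a [ZMOD m] := by
      intro m hm
      rw [Int.modEq_iff_dvd]
      have : a - (a * (v * p) + r p * (u * Q)) = Q * (u * (a - r p)) := by
        linear_combination (-a) * huv
      rw [this]
      exact hm.mul_right _
    refine ⟨a * (v * p) + r p * (u * Q), (key W ⟨((∏ q ∈ S, q : ℕ) : ℤ), by rw [hQ]; push_cast; ring⟩).trans ha, ?_⟩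
    intro q hq
    rcases Finset.mem_insert.1 hq with rfl | hq
    · rw [Int.modEq_iff_dvd]
      have : r q - (a * (v * q) + r q * (u * Q)) = q * (v * (r q - a)) := by
        linear_combination (-r q) * huv
      rw [this]
      exact dvd_mul_right _ _
    · refine (key q ?_).trans (har q hq)
      rw [hQ]
      exact_mod_cast (Finset.dvd_prod_of_mem _ hq).mul_left W

variable {ι : Type} [Fintype ι] [DecidableEq ι] {S : Finset ℕ}

theorem coprime_subsetProd_base {W : ℕ} (hW : ∀ p ∈ S, p.Coprime W) (g : S → Option ι) :
    (colorProd g).Coprime W := coprime_subsetProd hW _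

/-- A congruence modulo `W * colorProd g` splits into congruences modulo `W` and the primes. -/
theorem modEq_mul_colorProd (hS : ∀ p ∈ S, p.Prime) {W : ℕ} (hW : ∀ p ∈ S, p.Coprime W)
    (g : S → Option ι) (m a : ℤ) :
    m ≡ a [ZMOD (W * colorProd g : ℕ)] ↔
      m ≡ a [ZMOD W] ∧ ∀ p : S, g p ≠ none → m ≡ a [ZMOD (p : ℕ)] := by
  simp only [Int.modEq_iff_dvd]
  have hcop : IsCoprime (W : ℤ) (colorProd g : ℤ) := by
    rw [Nat.isCoprime_iff_coprime]; exact (coprime_subsetProd_base hW g).symm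
  constructor
  · intro h
    push_cast at h
    refine ⟨(dvd_mul_right _ _).trans h, fun p hp => ?_⟩
    refine Dvd.dvd.trans ?_ ((dvd_mul_left _ _).trans h)
    exact_mod_cast (prime_dvd_subsetProd hS _ (hS p p.2)).2 ⟨p.2, hp⟩
  · rintro ⟨h1, h2⟩
    push_cast
    refine hcop.mul_dvd h1 ?_
    rw [colorProd, subsetProd, Nat.cast_prod]
    refine Finset.prod_dvd_of_coprime (fun p _ q _ hpq => ?_) fun p _ => ?_
    · have : IsCoprime ((p : ℕ) : ℤ) ((q : ℕ) : ℤ) := by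
        rw [Nat.isCoprime_iff_coprime, Nat.coprime_primes (hS p p.2) (hS q q.2)]
        exact fun h => hpq (Subtype.ext h)
      show IsCoprime (((if g p ≠ none then (p : ℕ) else 1 : ℕ)) : ℤ)
        (((if g q ≠ none then (q : ℕ) else 1 : ℕ)) : ℤ)
      split_ifs
      · exact this
      · exact isCoprime_one_right
      · exact isCoprime_one_left
      · exact isCoprime_one_left
    · split_ifs with h
      · exact h2 p h
      · simp

/-- The count is a difference of two floors. The maximum with `0` in the exact formula does no harm
because the expected count is nonnegative, also for an empty interval `X = Y + 1`. -/
theorem abs_card_filter_modEq_sub_le (X Y : ℕ) (hXY : X ≤ Y + 1) {q : ℕ} (hq : 0 < q) (a : ℤ) :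
    |((((Finset.Icc X Y).filter fun n : ℕ => (n : ℤ) ≡ a [ZMOD q]).card : ℝ))
      - ((Y : ℝ) + 1 - X) / q| ≤ 1 := by
  have hq' : (0 : ℤ) < q := by exact_mod_cast hq
  have hqr : (0 : ℝ) < q := by exact_mod_cast hq
  have h1 : ((Finset.Icc X Y).filter fun n : ℕ => (n : ℤ) ≡ a [ZMOD q]).card
      = ((Finset.Ioc ((X : ℤ) - 1) Y).filter fun n : ℤ => n ≡ a [ZMOD q]).card := by
    refine Finset.card_bij (fun n _ => (n : ℤ)) ?_ ?_ ?_
    · intro n hn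
      simp only [Finset.mem_filter, Finset.mem_Icc, Finset.mem_Ioc] at hn ⊢
      exact ⟨by omega, hn.2⟩
    · intro n _ m _ h; exact_mod_cast h
    · intro n hn
      simp only [Finset.mem_filter, Finset.mem_Ioc] at hn
      refine ⟨n.toNat, ?_, by omega⟩
      simp only [Finset.mem_filter, Finset.mem_Icc]
      have : ((n.toNat : ℕ) : ℤ) = n := by omega
      rw [this]
      exact ⟨by omega, hn.2⟩
  have h2 := Int.Ioc_filter_modEq_card ((X : ℤ) - 1) Y hq' a
  rw [h1]
  have h3 : (((Finset.Ioc ((X : ℤ) - 1) Y).filter fun n : ℤ => n ≡ a [ZMOD q]).card : ℝ)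
      = max ((⌊((Y : ℤ) - a) / ((q : ℤ) : ℚ)⌋ - ⌊(((X : ℤ) - 1 : ℤ) - a) / ((q : ℤ) : ℚ)⌋ : ℤ) : ℝ) 0 := by
    exact_mod_cast congrArg (fun z : ℤ => (z : ℝ)) h2
  rw [h3]
  set u : ℚ := ((Y : ℤ) - a) / ((q : ℤ) : ℚ) with hu
  set v : ℚ := (((X : ℤ) - 1 : ℤ) - a) / ((q : ℤ) : ℚ) with hv
  have huv : ((u - v : ℚ) : ℝ) = ((Y : ℝ) + 1 - X) / q := by
    rw [hu, hv]; push_cast; field_simp; ring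
  have hpos : 0 ≤ ((Y : ℝ) + 1 - X) / q := by
    refine div_nonneg ?_ hqr.le
    have : (X : ℝ) ≤ Y + 1 := by exact_mod_cast hXY
    linarith
  have b1 : ((⌊u⌋ : ℚ) : ℝ) ≤ (u : ℝ) := by exact_mod_cast Int.floor_le u
  have b2 : (u : ℝ) < ((⌊u⌋ : ℚ) : ℝ) + 1 := by exact_mod_cast Int.lt_floor_add_one u
  have b3 : ((⌊v⌋ : ℚ) : ℝ) ≤ (v : ℝ) := by exact_mod_cast Int.floor_le v
  have b4 : (v : ℝ) < ((⌊v⌋ : ℚ) : ℝ) + 1 := by exact_mod_cast Int.lt_floor_add_one v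
  push_cast at b1 b2 b3 b4 huv ⊢
  rw [← huv] at hpos ⊢
  rw [abs_le]
  constructor
  · have := le_max_left ((⌊u⌋ : ℝ) - ⌊v⌋) 0
    linarith
  · have : max ((⌊u⌋ : ℝ) - ⌊v⌋) 0 ≤ (u : ℝ) - v + 1 := max_le (by linarith) (by linarith)
    linarith

end Residues

/-! ### The colouring attached to a shifted tuple. -/

section ShiftedSums

variable {ι : Type} [Fintype ι] [DecidableEq ι] {S : Finset ℕ}

/-- `p` divides at most one of the shifts of any integer. -/
def SeparatesShifts (S : Finset ℕ) (h : ι → ℕ) : Prop :=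
  ∀ p ∈ S, ∀ i l, i ≠ l → ¬ ((h i : ℤ) ≡ h l [ZMOD p])

/-- The colouring of `S` given by `n`: the colour of `p` is `i` if `p ∣ n + h i`. -/
noncomputable def shiftColoring (S : Finset ℕ) (h : ι → ℕ) (n : ℕ) : S → Option ι :=
  tupleColoring S fun i => n + h i

theorem shiftColoring_eq_some {h : ι → ℕ} (hh : SeparatesShifts S h) (n : ℕ) (p : S) (i : ι) :
    shiftColoring S h n p = some i ↔ (p : ℕ) ∣ n + h i := by
  unfold shiftColoring tupleColoring
  split_ifs with hex
  · rw [Option.some.injEq]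
    constructor
    · rintro rfl; exact hex.choose_spec
    · intro hi
      by_contra hne
      refine hh p p.2 _ _ hne ?_
      have h1 : ((p : ℕ) : ℤ) ∣ ((n + h hex.choose : ℕ) : ℤ) := by exact_mod_cast hex.choose_spec
      have h2 : ((p : ℕ) : ℤ) ∣ ((n + h i : ℕ) : ℤ) := by exact_mod_cast hi
      rw [Int.modEq_iff_dvd]
      have := dvd_sub h2 h1
      push_cast at this
      simpa using this
  · simp only [reduceCtorEq, false_iff]
    exact fun hi => hex ⟨i, hi⟩

theorem covered_shiftColoring_iff {h : ι → ℕ} (hh : SeparatesShifts S h) (n : ℕ)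
    (g : S → Option ι) :
    Covered g (shiftColoring S h n) ↔ ∀ p : S, ∀ i, g p = some i → (p : ℕ) ∣ n + h i := by
  refine forall_congr' fun p => ?_
  rcases hg : g p with _ | i
  · simp
  · simp only [reduceCtorEq, false_or, Option.some.injEq, forall_eq']
    rw [eq_comm, shiftColoring_eq_some hh]

/-- Rankin's trick: each colouring counted is weighted by `X / colorProd g ≥ 1`, and the weighted
sum factors over the colours. -/
theorem card_colorProd_le (hS : ∀ p ∈ S, p.Prime) {X : ℝ} (hX : 0 ≤ X) :
    (((Finset.univ.filter fun g : S → Option ι => (colorProd g : ℝ) ≤ X).card : ℕ) : ℝ)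
      ≤ X * (∑ m ∈ Finset.Icc 1 ⌊X⌋₊, 1 / (m : ℝ)) ^ Fintype.card ι := by
  have hcp : ∀ g : S → Option ι, (0 : ℝ) < colorProd g := fun g => by
    exact_mod_cast subsetProd_pos hS _
  calc _ = ∑ g ∈ Finset.univ.filter fun g : S → Option ι => (colorProd g : ℝ) ≤ X, (1 : ℝ) := by
        simp
    _ ≤ ∑ g ∈ Finset.univ.filter fun g : S → Option ι => (colorProd g : ℝ) ≤ X,
          X * ∏ i, 1 / (colorPart g i : ℝ) := by
        refine Finset.sum_le_sum fun g hg => ?_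
        have := (Finset.mem_filter.1 hg).2
        rw [Finset.prod_div_distrib, Finset.prod_const_one, ← Nat.cast_prod, ← colorProd_eq_prod,
          mul_one_div, one_le_div (hcp g)]
        exact this
    _ = X * ∑ g ∈ Finset.univ.filter fun g : S → Option ι => (colorProd g : ℝ) ≤ X,
          ∏ i, 1 / (colorPart g i : ℝ) := by rw [Finset.mul_sum]
    _ ≤ X * ∏ _i : ι, ∑ m ∈ Finset.Icc 1 ⌊X⌋₊, 1 / (m : ℝ) := by
        refine mul_le_mul_of_nonneg_left ?_ hX
        refine sum_prod_colorPart_le hS _ (fun _ => Finset.Icc 1 ⌊X⌋₊) ?_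
          (fun _ m => 1 / (m : ℝ)) fun _ m => by positivity
        intro g hg i
        have := (Finset.mem_filter.1 hg).2
        refine Finset.mem_Icc.2 ⟨colorPart_pos hS _ _, Nat.le_floor (le_trans ?_ this)⟩
        exact_mod_cast subsetProd_mono hS fun p hp => by simp [hp]
    _ = _ := by rw [Finset.prod_const, Finset.card_univ]

end ShiftedSums

/-! ### Sums of the sieve weight over integers, plain and against `ρ`. -/

section SieveSums

variable {ι : Type} [Fintype ι] [DecidableEq ι] {S : Finset ℕ}

theorem sum_residueWeight {p : ℝ} (hp : p ≠ 0) :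
    ∑ s : Option ι, residueWeight p s = 1 := by
  rw [Fintype.sum_option]
  simp only [residueWeight, Finset.sum_const, Finset.card_univ, nsmul_eq_mul]
  field_simp
  ring

theorem sum_reducedWeight (j : ι) {p : ℝ} (hp : p ≠ 1) :
    ∑ s : Option ι, reducedWeight j p s = 1 := by
  have hp' : p - 1 ≠ 0 := sub_ne_zero.2 hp
  rw [Fintype.sum_option]
  simp only [reducedWeight]
  rw [← Finset.add_sum_erase _ _ (Finset.mem_univ j), if_pos rfl, zero_add,
    Finset.sum_congr rfl (g := fun _ => 1 / (p - 1)) fun i hi =>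
      if_neg (Finset.ne_of_mem_erase hi), Finset.sum_const,
    Finset.card_erase_of_mem (Finset.mem_univ j), Finset.card_univ, nsmul_eq_mul,
    Nat.cast_sub (Fintype.card_pos_iff.2 ⟨j⟩), Nat.cast_one]
  field_simp
  ring

/-- The same expansion into indicators is applied to the actual sums over `n`, so model and reality
can be compared indicator by indicator. -/
theorem expect_sieveWeight_eq (m : S → Option ι → ℝ) (hm : ∀ p, ∑ s, m p s = 1) (G : ℕ → ℝ)
    (R : ℝ) : ∑ χ : S → Option ι, (∏ p, m p (χ p)) * sieveWeight G R χ
      = ∑ g, monoCoeff G R g * ∏ p, if g p = none then 1 else m p (g p) := by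
  simp only [sieveWeight_eq_sum, Finset.mul_sum]
  rw [Finset.sum_comm]
  refine Finset.sum_congr rfl fun g _ => ?_
  rw [← sum_prod_covered m hm, Finset.mul_sum]
  exact Finset.sum_congr rfl fun χ _ => by ring

/-- Upper bound for the sum of the sieve weight over a progression. -/
theorem sum_sieveWeight_le (hS : ∀ p ∈ S, p.Prime) {W : ℕ} (hW0 : 0 < W)
    (hW : ∀ p ∈ S, p.Coprime W) {h : ι → ℕ} (hh : SeparatesShifts S h) {X Y : ℕ}
    (hXY : X ≤ Y + 1) (b : ℤ) (G : ℕ → ℝ) {R Q Cm : ℝ} (hQ : 0 ≤ Q) (hCm : 0 ≤ Cm)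
    (hc : ∀ g : S → Option ι, monoCoeff G R g ≠ 0 →
      (colorProd g : ℝ) ≤ Q ∧ |monoCoeff G R g| ≤ Cm) :
    ∑ n ∈ (Finset.Icc X Y).filter (fun n : ℕ => (n : ℤ) ≡ b [ZMOD W]),
        sieveWeight G R (shiftColoring S h n)
      ≤ ((Y : ℝ) + 1 - X) / W *
          (∑ χ : S → Option ι, (∏ p : S, residueWeight ((p : ℕ) : ℝ) (χ p)) * sieveWeight G R χ)
        + Cm * (Q * (∑ m ∈ Finset.Icc 1 ⌊Q⌋₊, 1 / (m : ℝ)) ^ Fintype.card ι) := by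
  have hp0 : ∀ p : S, ((p : ℕ) : ℝ) ≠ 0 := fun p => by exact_mod_cast (hS p p.2).ne_zero
  rw [expect_sieveWeight_eq _ (fun p => sum_residueWeight (hp0 p))]
  have hcount : ∀ g : S → Option ι,
      |(∑ n ∈ (Finset.Icc X Y).filter (fun n : ℕ => (n : ℤ) ≡ b [ZMOD W]),
        if Covered g (shiftColoring S h n) then (1 : ℝ) else 0)
        - ((Y : ℝ) + 1 - X) / W * ∏ p : S, (if g p = none then 1 else
          residueWeight ((p : ℕ) : ℝ) (g p))| ≤ 1 := by
    intro g
    let r : ℕ → ℤ := fun p => if hp : p ∈ S then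
      match g ⟨p, hp⟩ with
      | none => 0
      | some i => -(h i : ℤ) else 0
    obtain ⟨a, ha, har⟩ := exists_modEq_primes S hS hW b r
    have hq : 0 < W * colorProd g := Nat.mul_pos hW0 (subsetProd_pos hS _)
    have := abs_card_filter_modEq_sub_le X Y hXY hq a
    convert this using 3
    · rw [Finset.sum_boole, Finset.filter_filter]
      congr 2
      ext n
      simp only [Finset.mem_filter]
      refine and_congr_right fun _ => ?_
      rw [modEq_mul_colorProd hS hW, covered_shiftColoring_iff hh]
      refine and_congr ⟨fun h' => h'.trans ha.symm, fun h' => h'.trans ha⟩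
        (forall_congr' fun p => ?_)
      have harp := har p p.2
      simp only [r, Finset.coe_mem, dif_pos, Subtype.coe_eta] at harp
      rcases hg : g p with _ | i
      · simp
      · rw [hg] at harp
        simp only [Option.some.injEq, forall_eq', ne_eq, reduceCtorEq, not_false_eq_true,
          forall_true_left]
        have e : (p : ℕ) ∣ n + h i ↔ (n : ℤ) ≡ -(h i : ℤ) [ZMOD (p : ℕ)] := by
          rw [Int.modEq_iff_dvd, ← Int.natCast_dvd_natCast, ← dvd_neg]
          push_cast
          rw [neg_add', sub_eq_add_neg, sub_eq_add_neg, add_comm]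
        rw [e]
        exact ⟨fun h' => h'.trans harp.symm, fun h' => h'.trans harp⟩
    · have : ∏ p : S, (if g p = none then 1 else residueWeight ((p : ℕ) : ℝ) (g p))
          = (1 : ℝ) / colorProd g := by
        rw [colorProd, subsetProd, Nat.cast_prod, one_div, ← Finset.prod_inv_distrib]
        refine Finset.prod_congr rfl fun p _ => ?_
        rcases hg : g p with _ | i <;> simp [residueWeight]
      rw [this]
      push_cast
      rw [mul_one_div, div_div]
  have expand : ∑ n ∈ (Finset.Icc X Y).filter (fun n : ℕ => (n : ℤ) ≡ b [ZMOD W]),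
        sieveWeight G R (shiftColoring S h n)
      = ∑ g : S → Option ι, monoCoeff G R g *
        ∑ n ∈ (Finset.Icc X Y).filter (fun n : ℕ => (n : ℤ) ≡ b [ZMOD W]),
        if Covered g (shiftColoring S h n) then (1 : ℝ) else 0 := by
    simp only [sieveWeight_eq_sum]
    rw [Finset.sum_comm]
    simp only [Finset.mul_sum]
  rw [expand, Finset.mul_sum, ← sub_le_iff_le_add', ← Finset.sum_sub_distrib]
  calc _ ≤ ∑ g : S → Option ι, if (colorProd g : ℝ) ≤ Q then Cm else 0 := by
        refine Finset.sum_le_sum fun g _ => ?_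
        by_cases hg : monoCoeff G R g = 0
        · rw [hg]
          simp only [zero_mul, mul_zero, sub_zero]
          split_ifs <;> linarith
        · obtain ⟨h1, h2⟩ := hc g hg
          rw [if_pos h1]
          calc _ = monoCoeff G R g * ((∑ n ∈ (Finset.Icc X Y).filter
                (fun n : ℕ => (n : ℤ) ≡ b [ZMOD W]),
                if Covered g (shiftColoring S h n) then (1 : ℝ) else 0)
                - ((Y : ℝ) + 1 - X) / W * ∏ p : S, (if g p = none then 1 else
                residueWeight ((p : ℕ) : ℝ) (g p))) := by ring
            _ ≤ |monoCoeff G R g| * 1 := by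
                refine (le_abs_self _).trans ?_
                rw [abs_mul]
                exact mul_le_mul_of_nonneg_left (hcount g) (abs_nonneg _)
            _ ≤ Cm := by rw [mul_one]; exact h2
    _ = Cm * ((Finset.univ.filter fun g : S → Option ι => (colorProd g : ℝ) ≤ Q).card : ℕ) := by
        rw [← Finset.sum_filter, Finset.sum_const, nsmul_eq_mul, mul_comm]
    _ ≤ _ := mul_le_mul_of_nonneg_left (card_colorProd_le hS hQ) hCm

theorem totient_prod_primes (hS : ∀ p ∈ S, p.Prime) (T : Finset S) :
    ((∏ p ∈ T, (p : ℕ)).totient : ℝ) = ∏ p ∈ T, (((p : ℕ) : ℝ) - 1) := by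
  induction T using Finset.induction_on with
  | empty => simp
  | insert q T hq ih =>
    rw [Finset.prod_insert hq, Finset.prod_insert hq, Nat.totient_mul, Nat.cast_mul, ih,
      Nat.totient_prime (hS q q.2), Nat.cast_sub (hS q q.2).one_lt.le, Nat.cast_one]
    refine Nat.Coprime.prod_right fun p hp => (Nat.coprime_primes (hS q q.2) (hS p p.2)).2 ?_
    intro h
    exact hq (Subtype.ext h ▸ hp)

theorem totient_mul_colorProd (hS : ∀ p ∈ S, p.Prime) {W : ℕ} (hW : ∀ p ∈ S, p.Coprime W)
    (g : S → Option ι) : ((W * colorProd g).totient : ℝ)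
      = W.totient * ∏ p : S, if g p = none then 1 else (((p : ℕ) : ℝ) - 1) := by
  rw [Nat.totient_mul (coprime_subsetProd_base hW g).symm, Nat.cast_mul]
  congr 1
  have : colorProd g = ∏ p ∈ Finset.univ.filter fun p => g p ≠ none, (p : ℕ) := by
    rw [colorProd, subsetProd, Finset.prod_filter]
  rw [this, totient_prod_primes hS, Finset.prod_filter]
  exact Finset.prod_congr rfl fun p _ => by split_ifs <;> simp_all

/-- The weights of a random colouring that avoids the colour `j`. -/
noncomputable def uniformWeight (j : ι) (s : Option ι) : ℝ :=
  match s with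
  | none => 0
  | some i => if i = j then 0 else 1 / ((Fintype.card ι : ℝ) - 1)

theorem sum_uniformWeight (j : ι) (hk : 2 ≤ Fintype.card ι) :
    ∑ s : Option ι, uniformWeight j s = 1 := by
  have hk' : (Fintype.card ι : ℝ) - 1 ≠ 0 := by
    have : (2 : ℝ) ≤ Fintype.card ι := by exact_mod_cast hk
    linarith
  rw [Fintype.sum_option]
  simp only [uniformWeight]
  rw [← Finset.add_sum_erase _ _ (Finset.mem_univ j), if_pos rfl, zero_add,
    Finset.sum_congr rfl (g := fun _ => 1 / ((Fintype.card ι : ℝ) - 1)) fun i hi =>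
      if_neg (Finset.ne_of_mem_erase hi), Finset.sum_const,
    Finset.card_erase_of_mem (Finset.mem_univ j), Finset.card_univ, nsmul_eq_mul,
    Nat.cast_sub (by omega), Nat.cast_one, zero_add]
  field_simp

theorem uniformWeight_nonneg (j : ι) (hk : 2 ≤ Fintype.card ι) (s : Option ι) :
    0 ≤ uniformWeight j s := by
  have : (2 : ℝ) ≤ Fintype.card ι := by exact_mod_cast hk
  cases s
  · exact le_rfl
  · simp only [uniformWeight]; split_ifs
    · exact le_rfl
    · exact one_div_nonneg.2 (by linarith)

/-- The residue of `n + h j` at a prime where `n` has colour `s`. -/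
def colorResidue (h : ι → ℕ) (j : ι) (s : Option ι) : ℤ :=
  match s with
  | none => 1
  | some i => if i = j then 1 else (h j : ℤ) - h i

/-- The sum of `f` over a shifted progression with prescribed colours. -/
noncomputable def coveredSum (x : ℝ) (f : ℕ → ℝ) (W : ℕ) (h : ι → ℕ) (j : ι) (b : ℤ) (X Y : ℕ)
    (g : S → Option ι) : ℝ :=
  ∑ n ∈ (Finset.Icc X Y).filter (fun n : ℕ => (n : ℤ) ≡ b [ZMOD W]),
    (if n + h j ∈ dyadicBlock x then f (n + h j) else 0) *
      if Covered g (shiftColoring S h n) then 1 else 0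

/-- Substituting `n + h j` for `n` turns `p ∣ n + h i` into the class `h j - h i` modulo `p`. -/
theorem coveredSum_eq {x : ℝ} {f : ℕ → ℝ} {W : ℕ} {h : ι → ℕ} (hh : SeparatesShifts S h)
    {j : ι} {b : ℤ} {X Y : ℕ}
    (hXY : ∀ n ∈ dyadicBlock x, X + h j ≤ n ∧ n ≤ Y + h j) (g : S → Option ι) :
    coveredSum x f W h j b X Y g = ∑ n ∈ (dyadicBlock x).filter (fun n : ℕ =>
      (n : ℤ) ≡ b + h j [ZMOD W] ∧ ∀ p : S, ∀ i, g p = some i →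
        (n : ℤ) ≡ (h j : ℤ) - h i [ZMOD (p : ℕ)]), f n := by
  unfold coveredSum
  simp only [mul_ite, mul_one, mul_zero]
  rw [← Finset.sum_filter, Finset.filter_filter, ← Finset.sum_filter, Finset.filter_filter]
  refine Finset.sum_bij (fun n _ => n + h j) ?_ ?_ ?_ fun n _ => rfl
  · intro n hn
    simp only [Finset.mem_filter, covered_shiftColoring_iff hh] at hn ⊢
    obtain ⟨-, ⟨h1, h2⟩, h3⟩ := hn
    refine ⟨h3, by push_cast; exact h1.add_right _, fun p i hi => ?_⟩
    have := h2 p i hi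
    rw [Int.modEq_iff_dvd, ← dvd_neg]
    have e : -((h j : ℤ) - h i - ((n + h j : ℕ) : ℤ)) = ((n + h i : ℕ) : ℤ) := by push_cast; ring
    rw [e]; exact_mod_cast this
  · intro n _ m _ hnm; simpa using hnm
  · intro n hn
    simp only [Finset.mem_filter] at hn
    obtain ⟨h1, h2, h3⟩ := hn
    obtain ⟨h4, h5⟩ := hXY n h1
    refine ⟨n - h j, ?_, by omega⟩
    have hcast : ((n - h j : ℕ) : ℤ) = n - h j := by omega
    simp only [Finset.mem_filter, Finset.mem_Icc, covered_shiftColoring_iff hh]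
    refine ⟨⟨by omega, by omega⟩, ⟨?_, fun p i hi => ?_⟩, ?_⟩
    · rw [hcast]
      simpa using h2.sub_right (h j : ℤ)
    · have := h3 p i hi
      rw [Int.modEq_iff_dvd, ← dvd_neg] at this
      have e : -((h j : ℤ) - h i - (n : ℤ)) = ((n - h j + h i : ℕ) : ℤ) := by push_cast; omega
      rw [e] at this; exact_mod_cast this
    · rwa [Nat.sub_add_cancel (by omega)]

/-- The prime-weighted covered sums are governed by discrepancies. -/
theorem coveredSum_sub_eq_discrepancy (hS : ∀ p ∈ S, p.Prime) {x : ℝ} {f : ℕ → ℝ} {W : ℕ}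
    (hW : ∀ p ∈ S, p.Coprime W) {h : ι → ℕ} (hh : SeparatesShifts S h)
    {j : ι} {b : ℤ} {X Y : ℕ}
    (hXY : ∀ n ∈ dyadicBlock x, X + h j ≤ n ∧ n ≤ Y + h j)
    (hf : ∀ n ∈ dyadicBlock x, f n ≠ 0 → n.Coprime (W * ∏ p ∈ S, p))
    {g : S → Option ι} (hg : ∀ p, g p ≠ some j) {a : ℤ} (ha : a ≡ b + h j [ZMOD W])
    (hag : ∀ p : S, ∀ i, g p = some i → a ≡ (h j : ℤ) - h i [ZMOD (p : ℕ)]) :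
    coveredSum x f W h j b X Y g - (∑ n ∈ dyadicBlock x, f n) / W.totient *
      (∏ p : S, if g p = none then 1 else reducedWeight j ((p : ℕ) : ℝ) (g p))
      = discrepancy x f (W * colorProd g) a := by
  rw [coveredSum_eq hh hXY, discrepancy]
  congr 1
  · refine Finset.sum_congr (Finset.filter_congr fun n _ => ?_) fun _ _ => rfl
    rw [modEq_mul_colorProd hS hW]
    refine and_congr ⟨fun h' => h'.trans ha.symm, fun h' => h'.trans ha⟩
      (forall_congr' fun p => ?_)
    rcases hgp : g p with _ | i
    · simp
    · simp only [Option.some.injEq, forall_eq', ne_eq, reduceCtorEq, not_false_eq_true,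
          forall_true_left]
      have := hag p i hgp
      exact ⟨fun h' => h'.trans this.symm, fun h' => h'.trans this⟩
  · have e1 : ∑ n ∈ (dyadicBlock x).filter (fun n : ℕ => n.Coprime (W * colorProd g)), f n
        = ∑ n ∈ dyadicBlock x, f n := by
      rw [Finset.sum_filter]
      refine Finset.sum_congr rfl fun n hn => ?_
      by_cases h0 : f n = 0
      · simp [h0]
      · rw [if_pos]
        refine (hf n hn h0).coprime_dvd_right (mul_dvd_mul_left _ ?_)
        rw [colorProd, subsetProd, ← Finset.prod_coe_sort S fun p => p]
        refine Finset.prod_dvd_prod_of_dvd _ _ fun p _ => ?_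
        split_ifs
        exacts [dvd_rfl, one_dvd _]
    have e2 : (∏ p : S, if g p = none then 1 else reducedWeight j ((p : ℕ) : ℝ) (g p))
        = 1 / ∏ p : S, if g p = none then 1 else (((p : ℕ) : ℝ) - 1) := by
      rw [one_div, ← Finset.prod_inv_distrib]
      refine Finset.prod_congr rfl fun p _ => ?_
      rcases hgp : g p with _ | i
      · simp
      · have : i ≠ j := fun h => hg p (h ▸ hgp)
        simp [reducedWeight, this]
    rw [e1, e2, totient_mul_colorProd hS hW, ← one_div_mul_one_div]
    ring

/-- Lower bound for the sum of the sieve weight against a function with good distribution. -/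
theorem sum_mul_sieveWeight_ge (hS : ∀ p ∈ S, p.Prime) {x : ℝ} {f : ℕ → ℝ} {W : ℕ}
    (hW0 : 0 < W) (hW : ∀ p ∈ S, p.Coprime W) {h : ι → ℕ} (hh : SeparatesShifts S h)
    {j : ι} {b : ℤ} {X Y : ℕ} (hk : 2 ≤ Fintype.card ι)
    (hb : IsCoprime (b + h j) (W : ℤ))
    (hXY : ∀ n ∈ dyadicBlock x, X + h j ≤ n ∧ n ≤ Y + h j)
    (hf : ∀ n ∈ dyadicBlock x, f n ≠ 0 → n.Coprime (W * ∏ p ∈ S, p))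
    {G : ℕ → ℝ} {R Q K B Cm : ℝ} (hK : 1 ≤ K) (hCm : 0 ≤ Cm) (hB : 0 ≤ B)
    (hdist : ∀ a : ℤ, IsCoprime a ((W * ∏ p ∈ S, p : ℕ) : ℤ) →
      ∑ q ∈ (W * ∏ p ∈ S, p).divisors with ((q : ℕ) : ℝ) ≤ Q, |discrepancy x f q a| ≤ B)
    (hc : ∀ g : S → Option ι, monoCoeff G R g ≠ 0 →
      ((W * colorProd g : ℕ) : ℝ) ≤ Q ∧ (2 : ℝ) ^ colorCard g ≤ K ∧ |monoCoeff G R g| ≤ Cm) :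
    (∑ n ∈ dyadicBlock x, f n) / W.totient *
        (∑ χ : S → Option ι, (∏ p : S, reducedWeight j ((p : ℕ) : ℝ) (χ p)) * sieveWeight G R χ)
      - Cm * (K ^ Fintype.card ι * B)
      ≤ ∑ n ∈ (Finset.Icc X Y).filter (fun n : ℕ => (n : ℤ) ≡ b [ZMOD W]),
        (if n + h j ∈ dyadicBlock x then f (n + h j) else 0) *
          sieveWeight G R (shiftColoring S h n) := by
  classical
  have hp1 : ∀ p : S, ((p : ℕ) : ℝ) ≠ 1 := fun p => by exact_mod_cast (hS p p.2).ne_one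
  rw [expect_sieveWeight_eq _ (fun p => sum_reducedWeight j (hp1 p))]
  set M := ∑ n ∈ dyadicBlock x, f n with hM
  let Δ : (S → Option ι) → ℝ := fun g => coveredSum x f W h j b X Y g - M / W.totient *
      (∏ p : S, if g p = none then 1 else reducedWeight j ((p : ℕ) : ℝ) (g p))
  have expand : ∑ n ∈ (Finset.Icc X Y).filter (fun n : ℕ => (n : ℤ) ≡ b [ZMOD W]),
        (if n + h j ∈ dyadicBlock x then f (n + h j) else 0) *
          sieveWeight G R (shiftColoring S h n)
      = ∑ g : S → Option ι, monoCoeff G R g * coveredSum x f W h j b X Y g := by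
    simp only [sieveWeight_eq_sum, coveredSum, Finset.mul_sum]
    rw [Finset.sum_comm]
    exact Finset.sum_congr rfl fun g _ => Finset.sum_congr rfl fun n _ => by ring
  -- A prescription using colour `j` asks a prime of `S` to divide `n + h j`, where `f` vanishes;
  -- its model probability is `0` as well.
  have hbad : ∀ g : S → Option ι, (∃ p, g p = some j) → Δ g = 0 := by
    rintro g ⟨p, hp⟩
    simp only [Δ]
    rw [coveredSum_eq hh hXY, Finset.prod_eq_zero (Finset.mem_univ p) (by
      simp [hp, reducedWeight]), mul_zero, sub_zero]
    refine Finset.sum_eq_zero fun n hn => ?_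
    obtain ⟨h1, -, h3⟩ := Finset.mem_filter.1 hn
    by_contra h0
    have h4 := h3 p j hp
    rw [sub_self, Int.modEq_zero_iff_dvd] at h4
    have h5 : (p : ℕ) ∣ n := by exact_mod_cast h4
    exact Nat.not_coprime_of_dvd_of_dvd (hS p p.2).one_lt h5
      ((Finset.dvd_prod_of_mem _ p.2).mul_left W) (hf n h1 h0)
  -- One residue modulo the full modulus serves every prescription that `χ` covers. Where `χ`
  -- demands nothing, or colour `j`, the residue `1` is an arbitrary unit; elsewhere `h j - h i` is
  -- a unit because the shifts are separated.
  have hres : ∀ χ : S → Option ι, ∃ a : ℤ, a ≡ b + h j [ZMOD W] ∧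
      ∀ p : S, a ≡ colorResidue h j (χ p) [ZMOD (p : ℕ)] := by
    intro χ
    obtain ⟨a, ha, har⟩ := exists_modEq_primes S hS hW (b + h j)
      fun p => if hp : p ∈ S then colorResidue h j (χ ⟨p, hp⟩) else 0
    exact ⟨a, ha, fun p => by simpa using har p p.2⟩
  choose a ha har using hres
  have hacop : ∀ χ, IsCoprime (a χ) ((W * ∏ p ∈ S, p : ℕ) : ℤ) := by
    intro χ
    push_cast
    refine IsCoprime.mul_right ?_ (IsCoprime.prod_right fun p hp => ?_)
    · obtain ⟨t, ht⟩ := (Int.modEq_iff_dvd.1 (ha χ))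
      have : a χ = (b + h j) + (W : ℤ) * (-t) := by linear_combination -ht
      rw [this]
      exact IsCoprime.add_mul_left_left hb (-t)
    · rw [isCoprime_comm, Prime.coprime_iff_not_dvd (Nat.prime_iff_prime_int.1 (hS p hp))]
      intro hd
      have h1 := har χ ⟨p, hp⟩
      have h2 : (p : ℤ) ∣ colorResidue h j (χ ⟨p, hp⟩) := by
        rw [← Int.modEq_zero_iff_dvd] at hd ⊢
        exact h1.symm.trans hd
      have hone : ¬ (p : ℤ) ∣ 1 := by
        intro h
        exact (hS p hp).one_lt.ne' (Nat.dvd_one.1 (by exact_mod_cast h))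
      unfold colorResidue at h2
      split at h2
      · exact hone h2
      · split_ifs at h2 with hij
        · exact hone h2
        · rename_i i _
          exact hh p hp i j hij (Int.modEq_iff_dvd.2 h2)
  have hΔ : ∀ (g χ : S → Option ι), (∀ p, g p ≠ some j) → Covered g χ →
      Δ g = discrepancy x f (W * colorProd g) (a χ) := by
    intro g χ hg hcov
    refine coveredSum_sub_eq_discrepancy hS hW hh hXY hf hg (ha χ) fun p i hi => ?_
    have h1 := har χ p
    have h2 : χ p = some i := by
      have := hcov p
      rw [hi] at this
      exact (this.resolve_left (by simp)).symm
    have hij : i ≠ j := fun h => hg p (h ▸ hi)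
    simpa [h2, colorResidue, hij] using h1
  set 𝒢 : Finset (S → Option ι) := Finset.univ.filter fun g => (∀ p, g p ≠ some j) ∧
    ((W * colorProd g : ℕ) : ℝ) ≤ Q ∧ (2 : ℝ) ^ colorCard g ≤ K with h𝒢
  have hm0 : ∀ χ : S → Option ι, 0 ≤ ∏ p, uniformWeight j (χ p) := fun χ =>
    Finset.prod_nonneg fun p _ => uniformWeight_nonneg j hk _
  have hk2 : (2 : ℝ) ≤ Fintype.card ι := by exact_mod_cast hk
  -- Among the prescriptions covered by one `χ` the modulus determines the prescription. Each
  -- modulus is met at most once, always with residue `a χ`, so the distribution hypothesis applies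
  -- directly.
  have hinner : ∀ χ : S → Option ι, ∑ g ∈ 𝒢, (if Covered g χ then 1 else 0) * |Δ g| ≤ B := by
    intro χ
    refine le_trans ?_ (hdist (a χ) (hacop χ))
    calc _ = ∑ g ∈ 𝒢.filter fun g => Covered g χ, |discrepancy x f (W * colorProd g) (a χ)| := by
          refine Eq.trans ?_ (Finset.sum_filter _ _).symm
          refine Finset.sum_congr rfl fun g hg => ?_
          split_ifs with hcov
          · rw [one_mul, hΔ g χ (Finset.mem_filter.1 hg).2.1 hcov]
          · simp
      _ = ∑ q ∈ (𝒢.filter fun g => Covered g χ).image fun g => W * colorProd g,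
            |discrepancy x f q (a χ)| := by
          rw [Finset.sum_image]
          intro g hg g' hg' he
          have c1 := (Finset.mem_filter.1 hg).2
          have c2 := (Finset.mem_filter.1 hg').2
          have he : colorProd g = colorProd g' := Nat.eq_of_mul_eq_mul_left hW0 he
          have hnone : ∀ p, g p ≠ none ↔ g' p ≠ none := by
            intro p
            have e1 := prime_dvd_subsetProd hS (fun p => g p ≠ none) (hS p p.2)
            have e2 := prime_dvd_subsetProd hS (fun p => g' p ≠ none) (hS p p.2)
            have : subsetProd (fun p => g p ≠ none) = subsetProd (fun p => g' p ≠ none) := he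
            rw [this, e2] at e1
            simpa using e1.symm
          funext p
          by_cases hgp : g p = none
          · have := not_iff_not.2 (hnone p)
            simp only [not_not] at this
            rw [hgp, this.1 hgp]
          · rw [(c1 p).resolve_left hgp, (c2 p).resolve_left ((hnone p).1 hgp)]
      _ ≤ _ := by
          refine Finset.sum_le_sum_of_subset_of_nonneg ?_ fun _ _ _ => abs_nonneg _
          intro q hq
          obtain ⟨g, hg, rfl⟩ := Finset.mem_image.1 hq
          have h1 := (Finset.mem_filter.1 (Finset.mem_filter.1 hg).1).2
          refine Finset.mem_filter.2 ⟨Nat.mem_divisors.2 ⟨mul_dvd_mul_left _ ?_, ?_⟩, h1.2.1⟩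
          · rw [colorProd, subsetProd, ← Finset.prod_coe_sort S fun p => p]
            refine Finset.prod_dvd_prod_of_dvd _ _ fun p _ => ?_
            split_ifs
            exacts [dvd_rfl, one_dvd _]
          · exact (Nat.mul_pos hW0 (Finset.prod_pos fun p hp => (hS p hp).pos)).ne'
  -- A uniform colouring avoiding `j` covers `g` with probability `(k-1)^(-colorCard g)`. As `k - 1
  -- ≤ 2^k` and `2^colorCard g ≤ K`, this is at least `K^(-k)`, which is the price of averaging over
  -- `χ`.
  have hcov : ∀ g ∈ 𝒢, 1 ≤ K ^ Fintype.card ι * ∑ χ : S → Option ι,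
      (∏ p, uniformWeight j (χ p)) * (if Covered g χ then 1 else 0) := by
    intro g hg
    obtain ⟨hg1, -, hg3⟩ := (Finset.mem_filter.1 hg).2
    rw [sum_prod_covered (fun _ => uniformWeight j) fun _ => sum_uniformWeight j hk]
    have e : ∏ p : S, (if g p = none then (1 : ℝ) else uniformWeight j (g p))
        = (1 / ((Fintype.card ι : ℝ) - 1)) ^ colorCard g := by
      rw [colorCard, ← Finset.prod_const, Finset.prod_filter]
      refine Finset.prod_congr rfl fun p _ => ?_
      rcases hgp : g p with _ | i
      · simp
      · have : i ≠ j := fun h => hg1 p (h ▸ hgp)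
        simp [uniformWeight, this]
    rw [e, div_pow, one_pow, mul_one_div, one_le_div (pow_pos (by linarith) _)]
    calc ((Fintype.card ι : ℝ) - 1) ^ colorCard g ≤ (2 ^ Fintype.card ι) ^ colorCard g := by
          refine pow_le_pow_left₀ (by linarith) ?_ _
          have : (Fintype.card ι : ℝ) ≤ 2 ^ Fintype.card ι := by
            exact_mod_cast Nat.lt_two_pow_self.le
          linarith
      _ = (2 ^ colorCard g) ^ Fintype.card ι := by rw [← pow_mul, ← pow_mul, mul_comm]
      _ ≤ K ^ Fintype.card ι := pow_le_pow_left₀ (by positivity) hg3 _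
  have htotal : ∑ g ∈ 𝒢, |Δ g| ≤ K ^ Fintype.card ι * B := by
    calc _ ≤ ∑ g ∈ 𝒢, (K ^ Fintype.card ι * ∑ χ : S → Option ι,
          (∏ p, uniformWeight j (χ p)) * (if Covered g χ then 1 else 0)) * |Δ g| :=
          Finset.sum_le_sum fun g hg => le_mul_of_one_le_left (abs_nonneg _) (hcov g hg)
      _ = K ^ Fintype.card ι * ∑ χ : S → Option ι, (∏ p, uniformWeight j (χ p)) *
          ∑ g ∈ 𝒢, (if Covered g χ then 1 else 0) * |Δ g| := by
          simp only [Finset.mul_sum, Finset.sum_mul]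
          rw [Finset.sum_comm]
          exact Finset.sum_congr rfl fun χ _ => Finset.sum_congr rfl fun g _ => by ring
      _ ≤ K ^ Fintype.card ι * ∑ χ : S → Option ι, (∏ p, uniformWeight j (χ p)) * B := by
          refine mul_le_mul_of_nonneg_left (Finset.sum_le_sum fun χ _ =>
            mul_le_mul_of_nonneg_left (hinner χ) (hm0 χ)) (by positivity)
      _ = _ := by
          rw [← Finset.sum_mul, sum_pi_prod fun (_ : S) s => uniformWeight j s]
          simp [sum_uniformWeight j hk]
  have hsum : |∑ g : S → Option ι, monoCoeff G R g * Δ g| ≤ Cm * (K ^ Fintype.card ι * B) := by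
    calc _ ≤ ∑ g : S → Option ι, |monoCoeff G R g * Δ g| := Finset.abs_sum_le_sum_abs _ _
      _ = ∑ g ∈ 𝒢, |monoCoeff G R g * Δ g| := by
          refine (Finset.sum_subset (Finset.subset_univ _) fun g _ hg => ?_).symm
          by_contra hne
          have hne := abs_ne_zero.1 hne
          obtain ⟨c1, c2, -⟩ := hc g (left_ne_zero_of_mul hne)
          refine hg (Finset.mem_filter.2 ⟨Finset.mem_univ _, fun p hp => ?_, c1, c2⟩)
          exact right_ne_zero_of_mul hne (hbad g ⟨p, hp⟩)
      _ ≤ ∑ g ∈ 𝒢, Cm * |Δ g| := by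
          refine Finset.sum_le_sum fun g _ => ?_
          rw [abs_mul]
          refine mul_le_mul_of_nonneg_right ?_ (abs_nonneg _)
          by_cases h0 : monoCoeff G R g = 0
          · rw [h0, abs_zero]; exact hCm
          · exact (hc g h0).2.2
      _ = Cm * ∑ g ∈ 𝒢, |Δ g| := by rw [Finset.mul_sum]
      _ ≤ _ := mul_le_mul_of_nonneg_left htotal hCm
  rw [expand]
  have hsplit : ∑ g : S → Option ι, monoCoeff G R g * Δ g
      = ∑ g : S → Option ι, monoCoeff G R g * coveredSum x f W h j b X Y g
        - M / W.totient * ∑ g : S → Option ι, monoCoeff G R g *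
          ∏ p : S, if g p = none then 1 else reducedWeight j ((p : ℕ) : ℝ) (g p) := by
    rw [Finset.mul_sum, ← Finset.sum_sub_distrib]
    exact Finset.sum_congr rfl fun g _ => by simp only [Δ]; ring
  rw [hsplit] at hsum
  linarith [(abs_le.1 hsum).1]

end SieveSums

/-! ### From dominating main terms to many primes in a tuple. -/

section Positivity

variable {ι : Type} [Fintype ι] [DecidableEq ι] {S : Finset ℕ}

/-- If every `n` had at most `m` primes among its shifts, then, `f` being at most the prime
indicator and `w` nonnegative, the right side would be at most `m ∑ w`. -/
theorem exists_many_primes_of_sum_pos {x : ℝ} {f : ℕ → ℝ} {h : ι → ℕ} {m : ℕ} (I : Finset ℕ)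
    (w : ℕ → ℝ) (hw : ∀ n, 0 ≤ w n)
    (hf : ∀ n ∈ dyadicBlock x, f n ≤ if n.Prime then 1 else 0)
    (hpos : m * ∑ n ∈ I, w n < ∑ j, ∑ n ∈ I,
      (if n + h j ∈ dyadicBlock x then f (n + h j) else 0) * w n) :
    ∃ n ∈ I, m < (Finset.univ.filter fun j => (n + h j).Prime).card := by
  by_contra hcon
  push Not at hcon
  refine absurd hpos (not_lt.2 ?_)
  rw [Finset.sum_comm, Finset.mul_sum]
  refine Finset.sum_le_sum fun n hn => ?_
  rw [← Finset.sum_mul]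
  refine mul_le_mul_of_nonneg_right ?_ (hw n)
  calc _ ≤ ∑ j, if (n + h j).Prime then (1 : ℝ) else 0 := by
        refine Finset.sum_le_sum fun j _ => ?_
        split_ifs with h1 h2 h2
        · simpa [h2] using hf _ h1
        · simpa [h2] using hf _ h1
        · exact zero_le_one
        · exact le_rfl
    _ = ((Finset.univ.filter fun j => (n + h j).Prime).card : ℝ) := by simp
    _ ≤ m := by exact_mod_cast hcon n hn

/-- The relative loss in the lower bound for the prime-weighted sum. -/
noncomputable def sieveLoss (k : ℕ) (s L K D : ℝ) (W N : ℕ) : ℝ :=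
  14 * k ^ 2 * s + 2 * (∑ m ∈ Finset.Icc 1 N, 1 / (m : ℝ)) ^ 2 / (L * K * logSum W N 1 L)
    + k * ((∑ m ∈ Finset.Icc 1 N, 1 / (m : ℝ)) ^ 2 / (L ^ 2 * K * logSum W N 2 L))
    + k * (Real.log N * (logSum W N 1 L / logSum W N 2 L)) / D ^ 2

/-- The sieve produces many primes in a shifted tuple as soon as the main terms dominate. -/
theorem exists_many_primes_of_main_term (hS : ∀ p ∈ S, p.Prime)
    (hk4 : ∀ p ∈ S, 4 * Fintype.card ι ≤ p) (hk : 2 ≤ Fintype.card ι) {W N : ℕ} (hW0 : 0 < W)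
    (hW : ∀ p ∈ S, p.Coprime W) (hWS : ∀ p, p.Prime → p ≤ N → p.Coprime W → p ∈ S)
    {h : ι → ℕ} (hh : SeparatesShifts S h) {x : ℝ} {f : ℕ → ℝ}
    (hf1 : ∀ n ∈ dyadicBlock x, f n ≤ if n.Prime then 1 else 0)
    (hf : ∀ n ∈ dyadicBlock x, f n ≠ 0 → n.Coprime (W * ∏ p ∈ S, p))
    (hM : 0 ≤ ∑ n ∈ dyadicBlock x, f n)
    {b : ℤ} (hb : ∀ j, IsCoprime (b + h j) (W : ℤ)) {X Y : ℕ} (hXY' : X ≤ Y + 1)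
    (hXY : ∀ j, ∀ n ∈ dyadicBlock x, X + h j ≤ n ∧ n ≤ Y + h j)
    {L K R D Q B Cm : ℝ} (hL : 1 ≤ L) (hK : 1 ≤ K) (hN : 1 ≤ N) (hR : 0 < R)
    (hI1 : 0 < logSum W N 1 L) (hI2 : 0 < logSum W N 2 L) (hD : 0 < D)
    (hDR : D + Fintype.card ι * (logSum W N 1 L / logSum W N 2 L) ≤ Real.log R - Real.log N)
    (hCm : Cm = (∑ m ∈ Finset.Icc 1 N, 1 / (m : ℝ)) ^ (2 * Fintype.card ι)
      * K ^ (4 * Fintype.card ι))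
    (hB : 0 ≤ B) (hQ : W * R ^ 2 ≤ Q)
    (hdist : ∀ a : ℤ, IsCoprime a ((W * ∏ p ∈ S, p : ℕ) : ℤ) →
      ∑ q ∈ (W * ∏ p ∈ S, p).divisors with ((q : ℕ) : ℝ) ≤ Q, |discrepancy x f q a| ≤ B)
    {m : ℕ}
    (hmain : m * (((Y : ℝ) + 1 - X) / W * logSum W N 2 L ^ Fintype.card ι
        + Cm * (R ^ 2 * (∑ m ∈ Finset.Icc 1 ⌊R ^ 2⌋₊, 1 / (m : ℝ)) ^ Fintype.card ι))
      < Fintype.card ι * ((∑ n ∈ dyadicBlock x, f n) / W.totient *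
        (logSum W N 2 L ^ (Fintype.card ι - 1) * (logSum W N 1 L ^ 2 *
          (1 - sieveLoss (Fintype.card ι) (∑ p ∈ S, 1 / (p : ℝ) ^ 2) L K D W N)))
        - Cm * ((K ^ (2 * Fintype.card ι)) ^ Fintype.card ι * B))) :
    ∃ n ∈ Finset.Icc X Y, m < (Finset.univ.filter fun j => (n + h j).Prime).card := by
  have hL0 : 0 < L := by linarith
  have hK0 : 0 ≤ K := by linarith
  set G := truncG L K N with hG
  have hG0 : ∀ m, 0 ≤ G m := truncG_nonneg hL0.le K N
  have hGne : ∀ m, G m ≠ 0 → m ≤ N ∧ (2 : ℝ) ^ m.primeFactors.card ≤ K := fun m hm =>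
    (ite_ne_right_iff.1 hm).1
  have hG1 : ∀ m, G m ≤ 1 := by
    intro m
    have := Real.log_natCast_nonneg m
    rw [hG, truncG]
    split_ifs
    · rw [div_le_one (by linarith)]; linarith
    · exact zero_le_one
  have hc := fun g : S → Option ι => monoCoeff_bounds (g := g) hS hK0 hR.le hG0 hG1
    (fun m hm => (hGne m hm).1) (fun m hm => (hGne m hm).2)
  rw [← hCm] at hc
  have hCm0 : 0 ≤ Cm := by rw [hCm]; positivity
  have hW0' : (0 : ℝ) < W := by exact_mod_cast hW0
  have up := sum_sieveWeight_le hS hW0 hW hh hXY' b G (R := R) (Q := R ^ 2) (sq_nonneg R) hCm0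
    fun g hg => ⟨(hc g hg).1, (hc g hg).2.2⟩
  have upE := expect_sieveWeight_le (ι := ι) hS (fun p hp => by have := hk4 p hp; omega) G R
    (coprimeUpto W N) fun d i hd => mem_coprimeUpto.2
      ⟨⟨colorPart_pos hS d i, (hGne _ hd).1⟩, coprime_subsetProd hW _⟩
  -- For an upper bound the truncation of `G` may be dropped.
  have upI : ∑ m ∈ coprimeUpto W N, G m ^ 2 / m ≤ logSum W N 2 L := by
    refine Finset.sum_le_sum fun m hm => ?_
    have hlog := Real.log_natCast_nonneg m
    have hm0 : (0 : ℝ) < m := by exact_mod_cast (mem_coprimeUpto.1 hm).1.1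
    rw [hG, truncG, logWeight]
    split_ifs
    · rw [div_pow, one_pow, div_div, mul_comm]
    · simp only [ne_eq, OfNat.ofNat_ne_zero, not_false_eq_true, zero_pow, zero_div]
      positivity
  have up2 : ∑ n ∈ (Finset.Icc X Y).filter (fun n : ℕ => (n : ℤ) ≡ b [ZMOD W]),
        sieveWeight G R (shiftColoring S h n) ≤
      ((Y : ℝ) + 1 - X) / W * logSum W N 2 L ^ Fintype.card ι
        + Cm * (R ^ 2 * (∑ m ∈ Finset.Icc 1 ⌊R ^ 2⌋₊, 1 / (m : ℝ)) ^ Fintype.card ι) := by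
    have hXY0 : 0 ≤ ((Y : ℝ) + 1 - X) / W := by
      refine div_nonneg ?_ hW0'.le
      have : (X : ℝ) ≤ Y + 1 := by exact_mod_cast hXY'
      linarith
    have : ∑ χ : S → Option ι, (∏ p : S, residueWeight ((p : ℕ) : ℝ) (χ p)) * sieveWeight G R χ
        ≤ logSum W N 2 L ^ Fintype.card ι :=
      upE.trans (pow_le_pow_left₀ (Finset.sum_nonneg fun m _ => by positivity) upI _)
    have := mul_le_mul_of_nonneg_left this hXY0
    linarith
  have low : ∀ j, (∑ n ∈ dyadicBlock x, f n) / W.totient *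
        (logSum W N 2 L ^ (Fintype.card ι - 1) * (logSum W N 1 L ^ 2 *
          (1 - sieveLoss (Fintype.card ι) (∑ p ∈ S, 1 / (p : ℝ) ^ 2) L K D W N)))
        - Cm * ((K ^ (2 * Fintype.card ι)) ^ Fintype.card ι * B) ≤
      ∑ n ∈ (Finset.Icc X Y).filter (fun n : ℕ => (n : ℤ) ≡ b [ZMOD W]),
        (if n + h j ∈ dyadicBlock x then f (n + h j) else 0) *
          sieveWeight G R (shiftColoring S h n) := by
    intro j
    have h1 := sum_mul_sieveWeight_ge hS hW0 hW hh hk (hb j) (hXY j) hf (G := G) (R := R) (Q := Q)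
      (K := K ^ (2 * Fintype.card ι)) (one_le_pow₀ hK) hCm0 hB hdist fun g hg =>
        ⟨by
          push_cast
          exact (mul_le_mul_of_nonneg_left (hc g hg).1 hW0'.le).trans hQ, (hc g hg).2⟩
    have h2 := expect_sieveWeight_ge hS hk4 hWS hL0 hK hN hR hI1 hI2 hD hDR j
    have h3 := mul_le_mul_of_nonneg_left h2
      (show 0 ≤ (∑ n ∈ dyadicBlock x, f n) / W.totient from div_nonneg hM (Nat.cast_nonneg _))
    have e : 1 - sieveLoss (Fintype.card ι) (∑ p ∈ S, 1 / (p : ℝ) ^ 2) L K D W N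
      = 1 - 14 * Fintype.card ι ^ 2 * ∑ p ∈ S, 1 / (p : ℝ) ^ 2
        - 2 * (∑ m ∈ Finset.Icc 1 N, 1 / (m : ℝ)) ^ 2 / (L * K * logSum W N 1 L)
        - Fintype.card ι * ((∑ m ∈ Finset.Icc 1 N, 1 / (m : ℝ)) ^ 2 / (L ^ 2 * K * logSum W N 2 L))
        - Fintype.card ι * (Real.log N * (logSum W N 1 L / logSum W N 2 L)) / D ^ 2 := by
      unfold sieveLoss; ring
    rw [← e] at h3
    linarith
  obtain ⟨n, hn, hcard⟩ := exists_many_primes_of_sum_pos (m := m) (h := h)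
    ((Finset.Icc X Y).filter (fun n : ℕ => (n : ℤ) ≡ b [ZMOD W]))
    (fun n => sieveWeight G R (shiftColoring S h n)) (fun n => sq_nonneg _) hf1 (by
      refine lt_of_le_of_lt (mul_le_mul_of_nonneg_left up2 (Nat.cast_nonneg _)) (hmain.trans_le ?_)
      rw [← nsmul_eq_mul, ← Finset.card_univ]
      exact Finset.card_nsmul_le_sum _ _ _ fun j _ => low j)
  exact ⟨n, (Finset.mem_filter.1 hn).1, hcard⟩

theorem sum_inv_sq_primes_le {D N : ℕ} (hD : 0 < D) :
    ∑ p ∈ (Finset.Ioc D N).filter Nat.Prime, 1 / (p : ℝ) ^ 2 ≤ 1 / (D : ℝ) := by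
  calc _ ≤ ∑ p ∈ Finset.Ioc D N, ((p : ℝ) ^ 2)⁻¹ := by
        simp only [one_div]
        exact Finset.sum_le_sum_of_subset_of_nonneg (Finset.filter_subset _ _)
          fun _ _ _ => by positivity
    _ ≤ 1 / (D : ℝ) := by
        rcases le_or_gt D N with h | h
        · refine (sum_Ioc_inv_sq_le_sub hD.ne' h).trans ?_
          rw [one_div]
          have : (0 : ℝ) ≤ (N : ℝ)⁻¹ := by positivity
          linarith
        · rw [Finset.Ioc_eq_empty_of_le h.le, Finset.sum_empty]; positivity

theorem sum_one_div_le (N : ℕ) : ∑ m ∈ Finset.Icc 1 N, 1 / (m : ℝ) ≤ 1 + Real.log N := by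
  have := harmonic_le_one_add_log N
  rw [harmonic_eq_sum_Icc] at this
  push_cast at this
  simpa [one_div] using this

end Positivity

/-! ### Comparison of the main terms as `L → ∞`. -/

section Asymptotics

/-- `1 + β L ≤ (1 + β) L` for `L ≥ 1`, raised to a power. -/
theorem one_add_mul_pow_le {β L : ℝ} (hβ : 0 ≤ β) (hL : 1 ≤ L) (n : ℕ) :
    (1 + β * L) ^ n ≤ (1 + β) ^ n * L ^ n := by
  rw [← mul_pow]
  exact pow_le_pow_left₀ (by positivity) (by nlinarith) n

/-- Polynomial factors are negligible against an exponentially decaying one. -/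
theorem tendsto_poly_mul_exp_neg {β κ s : ℝ} (hβ : 0 ≤ β) (hκ : 0 ≤ κ) (h : 2 * κ < s) (k : ℕ) :
    Tendsto (fun L : ℝ => ((1 + β * L) ^ (2 * k) * (L ^ 2) ^ (4 * k)) *
      (Real.exp (κ * L) ^ 2 * (1 + 2 * κ * L) ^ k) * L ^ k / Real.exp (s * L)) atTop (𝓝 0) := by
  -- The degree is `2k + 8k + k + k = 12k`.
  have h0 : Tendsto (fun L : ℝ => ((1 + β) ^ (2 * k) * (1 + 2 * κ) ^ k) *
      (L ^ (12 * k) / Real.exp ((s - 2 * κ) * L))) atTop (𝓝 0) := by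
    have := (isLittleO_pow_exp_pos_mul_atTop (12 * k) (sub_pos.2 h)).tendsto_div_nhds_zero
    simpa using this.const_mul ((1 + β) ^ (2 * k) * (1 + 2 * κ) ^ k)
  refine squeeze_zero' ?_ ?_ h0
  · filter_upwards [eventually_ge_atTop (1 : ℝ)] with L hL
    positivity
  · filter_upwards [eventually_ge_atTop (1 : ℝ)] with L hL
    have e1 : Real.exp (κ * L) ^ 2 / Real.exp (s * L) = 1 / Real.exp ((s - 2 * κ) * L) := by
      rw [← Real.exp_nat_mul, ← Real.exp_sub, one_div, ← Real.exp_neg]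
      congr 1; push_cast; ring
    have e2 := one_add_mul_pow_le hβ hL (2 * k)
    have e3 := one_add_mul_pow_le (β := 2 * κ) (by positivity) hL k
    calc _ = (1 + β * L) ^ (2 * k) * (1 + 2 * κ * L) ^ k * (L ^ (9 * k)) *
          (Real.exp (κ * L) ^ 2 / Real.exp (s * L)) := by ring
      _ ≤ ((1 + β) ^ (2 * k) * L ^ (2 * k)) * ((1 + 2 * κ) ^ k * L ^ k) * (L ^ (9 * k)) *
          (Real.exp (κ * L) ^ 2 / Real.exp (s * L)) := by gcongr
      _ = _ := by rw [e1]; ring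

/-- A power saving in `L` beats the polynomial factors of the error term. -/
theorem tendsto_poly_mul_rpow_neg {β s C : ℝ} (hβ : 0 ≤ β) (hs : 0 < s) (hC : 0 ≤ C) (k : ℕ) :
    Tendsto (fun L : ℝ => ((1 + β * L) ^ (2 * k) * (L ^ 2) ^ (4 * k)) *
      (((L ^ 2) ^ (2 * k)) ^ k * (C * (Real.exp (s * L) *
        (s * L) ^ (-((11 * k + 4 * k * k + 1 : ℕ) : ℝ))))) * L ^ k / Real.exp (s * L))
      atTop (𝓝 0) := by
  -- The polynomial factors have degree `2k + 8k + 4k^2 + k = 11k + 4k^2`; one further power of `log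
  -- x` makes the error vanish.
  set A := 11 * k + 4 * k * k + 1 with hA
  have h0 : Tendsto (fun L : ℝ => ((1 + β) ^ (2 * k) * C / s ^ A) * L⁻¹) atTop (𝓝 0) := by
    simpa using tendsto_inv_atTop_zero.const_mul ((1 + β) ^ (2 * k) * C / s ^ A)
  refine squeeze_zero' ?_ ?_ h0
  · filter_upwards [eventually_ge_atTop (1 : ℝ)] with L hL
    positivity
  · filter_upwards [eventually_ge_atTop (1 : ℝ)] with L hL
    have e2 := one_add_mul_pow_le hβ hL (2 * k)
    have hL0 : 0 < L := by linarith
    rw [Real.rpow_neg (by positivity), Real.rpow_natCast]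
    have he : Real.exp (s * L) ≠ 0 := (Real.exp_pos _).ne'
    calc _ = (1 + β * L) ^ (2 * k) * (L ^ (9 * k + 4 * k * k)) * C * ((s * L) ^ A)⁻¹ := by
          field_simp; ring
      _ ≤ ((1 + β) ^ (2 * k) * L ^ (2 * k)) * (L ^ (9 * k + 4 * k * k)) * C * ((s * L) ^ A)⁻¹ := by
          gcongr
      _ = (1 + β) ^ (2 * k) * C * (L ^ (11 * k + 4 * k * k) / ((s * L) ^ A)) := by ring
      _ = _ := by
          rw [mul_pow, hA, pow_succ L]
          field_simp

/-- An explicit upper bound for the relative loss in the sieve, at the parameters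
`N = ⌊exp (β L)⌋`, `R = exp (κ L)`, `K = L ^ 2`. -/
noncomputable def lossBound (k D₀ W : ℕ) (β κ L : ℝ) : ℝ :=
  14 * k ^ 2 * (1 / (D₀ : ℝ))
    + 2 * (1 + β * L) ^ 2 / (L * L ^ 2 * logSum W (expFloor β L) 1 L)
    + k * ((1 + β * L) ^ 2 / (L ^ 2 * L ^ 2 * logSum W (expFloor β L) 2 L))
    + k * (β * L * (logSum W (expFloor β L) 1 L / logSum W (expFloor β L) 2 L)) /
      (κ * L - β * L - k * (logSum W (expFloor β L) 1 L / logSum W (expFloor β L) 2 L)) ^ 2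

variable {W : ℕ} {β : ℝ}

/-- The ratio bounds the mean logarithm of a random entry, so entries typically have size `exp
(O(L))`. The factor `φ(W)/W` cancels. -/
theorem tendsto_logSum_ratio (hW : 0 < W) (hβ : 0 < β) :
    Tendsto (fun L => (logSum W (expFloor β L) 1 L / logSum W (expFloor β L) 2 L) / L) atTop
      (𝓝 (Real.log (1 + β) * (1 + β) / β)) := by
  have hφ : (0 : ℝ) < W.totient := by exact_mod_cast Nat.totient_pos.2 hW
  have hW' : (0 : ℝ) < W := by exact_mod_cast hW
  have h := (tendsto_logSum_one hW hβ.le).div (tendsto_logSum_two hW hβ.le) (by positivity)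
  have e : (W.totient / W * Real.log (1 + β)) / (W.totient / W * (β / (1 + β)))
      = Real.log (1 + β) * (1 + β) / β := by field_simp
  rw [e] at h
  refine h.congr' ?_
  filter_upwards with L
  rw [Pi.div_apply]
  rw [div_div, mul_comm L]

/-- With `K = L^2` the two losses from many prime factors are `O(1/L)`. The tail of `1/p^2` and the
Chebyshev term are scale invariant and survive in the limit; they are made small later through `D₀`
and `k`. -/
theorem tendsto_lossBound (hW : 0 < W) (hβ : 0 < β) (k D₀ : ℕ) {κ : ℝ}
    (hκ : β + k * (Real.log (1 + β) * (1 + β) / β) < κ) :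
    Tendsto (lossBound k D₀ W β κ) atTop
      (𝓝 (14 * k ^ 2 * (1 / (D₀ : ℝ)) + k * β * (Real.log (1 + β) * (1 + β) / β) /
        (κ - β - k * (Real.log (1 + β) * (1 + β) / β)) ^ 2)) := by
  have hφ : (0 : ℝ) < W.totient := by exact_mod_cast Nat.totient_pos.2 hW
  have hW' : (0 : ℝ) < W := by exact_mod_cast hW
  have hlog : 0 < Real.log (1 + β) := Real.log_pos (by linarith)
  have hinv : Tendsto (fun L : ℝ => L⁻¹) atTop (𝓝 0) := tendsto_inv_atTop_zero
  have hlin : Tendsto (fun L : ℝ => (1 + β * L) / L) atTop (𝓝 β) := by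
    have h1 : Tendsto (fun L : ℝ => L⁻¹ + β) atTop (𝓝 β) := by simpa using hinv.add_const β
    refine h1.congr' ?_
    filter_upwards [eventually_gt_atTop (0 : ℝ)] with L hL
    field_simp
  have h1 := tendsto_logSum_one hW hβ.le
  have h2 := tendsto_logSum_two hW hβ.le
  have hr := tendsto_logSum_ratio hW hβ
  have t1 : Tendsto (fun L => 2 * (1 + β * L) ^ 2 / (L * L ^ 2 * logSum W (expFloor β L) 1 L))
      atTop (𝓝 0) := by
    have := ((hlin.pow 2).const_mul 2).mul (hinv.div h1 (by positivity))
    rw [zero_div, mul_zero] at this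
    refine this.congr' ?_
    filter_upwards [eventually_gt_atTop (0 : ℝ), h1.eventually_const_lt
      (show 0 < (W.totient : ℝ) / W * Real.log (1 + β) by positivity)] with L hL hI
    rw [Pi.div_apply]
    field_simp
  have t2 : Tendsto (fun L => (k : ℝ) * ((1 + β * L) ^ 2 /
      (L ^ 2 * L ^ 2 * logSum W (expFloor β L) 2 L))) atTop (𝓝 0) := by
    have := (((hlin.pow 2).mul (hinv.div h2 (by positivity)))).const_mul (k : ℝ)
    rw [zero_div, mul_zero, mul_zero] at this
    refine this.congr' ?_
    filter_upwards [eventually_gt_atTop (0 : ℝ), h2.eventually_const_lt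
      (show 0 < (W.totient : ℝ) / W * (β / (1 + β)) by positivity)] with L hL hI
    have : 0 < logSum W (expFloor β L) 2 L := pos_of_mul_pos_right hI hL.le
    rw [Pi.div_apply]
    field_simp
  have t3 : Tendsto (fun L => k * (β * L *
      (logSum W (expFloor β L) 1 L / logSum W (expFloor β L) 2 L)) /
      (κ * L - β * L - k * (logSum W (expFloor β L) 1 L / logSum W (expFloor β L) 2 L)) ^ 2)
      atTop (𝓝 (k * β * (Real.log (1 + β) * (1 + β) / β) /
        (κ - β - k * (Real.log (1 + β) * (1 + β) / β)) ^ 2)) := by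
    have hne : (κ - β - k * (Real.log (1 + β) * (1 + β) / β)) ^ 2 ≠ 0 :=
      pow_ne_zero _ (by linarith)
    have := (hr.const_mul (k * β)).div (((hr.const_mul (k : ℝ)).const_sub (κ - β)).pow 2) hne
    refine this.congr' ?_
    filter_upwards [eventually_gt_atTop (0 : ℝ)] with L hL
    rw [Pi.div_apply]
    set u := logSum W (expFloor β L) 1 L / logSum W (expFloor β L) 2 L
    have e : κ * L - β * L - k * u = L * (κ - β - k * (u / L)) := by field_simp
    rw [e, mul_pow]
    have e2 : k * (β * L * u) = L ^ 2 * (k * β * (u / L)) := by field_simp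
    rw [e2, mul_div_mul_left _ _ (by positivity)]
  have := ((t1.const_add (14 * (k : ℝ) ^ 2 * (1 / (D₀ : ℝ)))).add t2).add t3
  rw [add_zero, add_zero] at this
  exact this

/-- Undoes the normalization by `L^k/x` under which the limits are taken. -/
theorem main_normalization_left (m len W I E : ℝ) {x L : ℝ} (hx : x ≠ 0) (hL : L ≠ 0) (k : ℕ) :
    m * (len / x / W * (L * I) ^ k + E * L ^ k / x) * (x / L ^ k) = m * (len / W * I ^ k + E) := by
  have := pow_ne_zero k hL
  rw [mul_pow]
  generalize L ^ k = t at *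
  generalize I ^ k = u at *
  field_simp

theorem main_normalization_right (a F w I J E : ℝ) {x L s : ℝ} (hx : x ≠ 0) (hL : L ≠ 0)
    (hs : s ≠ 0) {k : ℕ} (hk : 1 ≤ k) :
    a * (F / (x / (s * L)) / (s * w) * ((L * I) ^ (k - 1) * J) - E * L ^ k / x) * (x / L ^ k)
      = a * (F / w * (I ^ (k - 1) * J) - E) := by
  obtain ⟨j, rfl⟩ : ∃ j, k = j + 1 := ⟨k - 1, by omega⟩
  have := pow_ne_zero j hL
  rw [Nat.add_sub_cancel, mul_pow, pow_succ]
  generalize L ^ j = t at *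
  generalize I ^ j = u at *
  rw [div_div_eq_mul_div, div_div]
  rcases eq_or_ne w 0 with rfl | hw
  · simp only [mul_zero, div_zero, zero_mul, zero_sub]
    field_simp
  · field_simp

/-- The main terms of the two sieve sums, compared as `L → ∞`. -/
theorem eventually_main_lt (hW : 0 < W) (hβ : 0 < β) {k D₀ m : ℕ} (hk : 1 ≤ k) {κ s c C : ℝ}
    (hκ : β + k * (Real.log (1 + β) * (1 + β) / β) < κ) (hκs : 2 * κ < s) (hC : 0 ≤ C)
    {F len : ℝ → ℝ}
    (hF : Tendsto (fun L => F L / (Real.exp (s * L) / (s * L))) atTop (𝓝 c))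
    (hlen : Tendsto (fun L => len L / Real.exp (s * L)) atTop (𝓝 1))
    (hm : m < k * (c / s) * (Real.log (1 + β) ^ 2 * (1 + β) / β) *
      (1 - (14 * k ^ 2 * (1 / (D₀ : ℝ)) + k * β * (Real.log (1 + β) * (1 + β) / β) /
        (κ - β - k * (Real.log (1 + β) * (1 + β) / β)) ^ 2))) :
    ∀ᶠ L in atTop, m * (len L / W * logSum W (expFloor β L) 2 L ^ k
        + ((1 + β * L) ^ (2 * k) * (L ^ 2) ^ (4 * k)) *
          (Real.exp (κ * L) ^ 2 * (1 + 2 * κ * L) ^ k))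
      < k * (F L / W.totient * (logSum W (expFloor β L) 2 L ^ (k - 1) *
          (logSum W (expFloor β L) 1 L ^ 2 * (1 - lossBound k D₀ W β κ L)))
        - ((1 + β * L) ^ (2 * k) * (L ^ 2) ^ (4 * k)) *
          (((L ^ 2) ^ (2 * k)) ^ k * (C * (Real.exp (s * L) *
        (s * L) ^ (-((11 * k + 4 * k * k + 1 : ℕ) : ℝ)))))) := by
  have hφ : (0 : ℝ) < W.totient := by exact_mod_cast Nat.totient_pos.2 hW
  have hW' : (0 : ℝ) < W := by exact_mod_cast hW
  have hlog : 0 < Real.log (1 + β) := Real.log_pos (by linarith)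
  have hκ0 : 0 < κ := lt_trans (by positivity) hκ
  have hs : 0 < s := by linarith
  have h1 := tendsto_logSum_one hW hβ.le
  have h2 := tendsto_logSum_two hW hβ.le
  have hl := tendsto_lossBound hW hβ k D₀ hκ
  set ℓ := 14 * k ^ 2 * (1 / (D₀ : ℝ)) + k * β * (Real.log (1 + β) * (1 + β) / β) /
        (κ - β - k * (Real.log (1 + β) * (1 + β) / β)) ^ 2
  have hA := (((hlen.div_const (W : ℝ)).mul (h2.pow k)).add
    (tendsto_poly_mul_exp_neg hβ.le hκ0.le hκs k)).const_mul (m : ℝ)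
  have hB := (((((hF.div_const (s * W.totient)).mul
    ((h2.pow (k - 1)).mul ((h1.pow 2).mul (hl.const_sub 1))))).sub
      (tendsto_poly_mul_rpow_neg hβ.le hs hC k))).const_mul (k : ℝ)
  -- The two limits share the factor `1/W · (φ(W)/W · β/(1+β))^k`; dividing it out leaves exactly
  -- the assumed inequality, free of `W`.
  have hlt : m * (1 / (W : ℝ) * (W.totient / W * (β / (1 + β))) ^ k + 0) <
      k * (c / (s * W.totient) * ((W.totient / W * (β / (1 + β))) ^ (k - 1) *
        ((W.totient / W * Real.log (1 + β)) ^ 2 * (1 - ℓ))) - 0) := by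
    obtain ⟨j, rfl⟩ : ∃ j, k = j + 1 := ⟨k - 1, by omega⟩
    rw [Nat.add_sub_cancel, add_zero, sub_zero, pow_succ]
    set t := (W.totient / W * (β / (1 + β))) ^ j with ht
    have ht0 : 0 < t := by positivity
    have hpos : 0 < 1 / (W : ℝ) * (t * (W.totient / W * (β / (1 + β)))) := by positivity
    have := mul_lt_mul_of_pos_right hm hpos
    refine (lt_of_eq_of_lt (by ring) this).trans_eq ?_
    field_simp
  have hev := hA.eventually_lt hB hlt
  filter_upwards [hev, eventually_gt_atTop (0 : ℝ)] with L hL hL0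
  have hx : 0 < Real.exp (s * L) := Real.exp_pos _
  have key := mul_lt_mul_of_pos_right hL (show 0 < Real.exp (s * L) / L ^ k by positivity)
  rwa [main_normalization_left _ _ _ _ _ hx.ne' hL0.ne',
    main_normalization_right _ _ _ _ _ _ hx.ne' hL0.ne' hs.ne' hk] at key

end Asymptotics

/-! ### Primorials and admissible residue classes. -/

section PrimorialFacts

theorem primorial_mul_prod_Ioc {D N : ℕ} (h : D ≤ N) :
    primorial D * ∏ p ∈ (Finset.Ioc D N).filter Nat.Prime, p = primorial N := by
  unfold primorial
  rw [← Finset.prod_union]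
  · congr 1
    ext p
    simp only [Finset.mem_union, Finset.mem_filter, Finset.mem_range, Finset.mem_Ioc]
    constructor
    · rintro (⟨h1, h2⟩ | ⟨h1, h2⟩)
      · exact ⟨by omega, h2⟩
      · exact ⟨by omega, h2⟩
    · rintro ⟨h1, h2⟩
      rcases le_or_gt p D with h3 | h3
      · exact Or.inl ⟨by omega, h2⟩
      · exact Or.inr ⟨by omega, h2⟩
  · rw [Finset.disjoint_left]
    intro p h1 h2
    simp only [Finset.mem_filter, Finset.mem_range, Finset.mem_Ioc] at h1 h2
    omega

/-- An admissible tuple has a translate all of whose entries are coprime to a primorial. -/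
theorem exists_isCoprime_primorial {ι : Type} (h : ι → ℕ)
    (hadm : ∀ p : ℕ, p.Prime → ∃ b : ℤ, ∀ i, ¬ (p : ℤ) ∣ b + h i) (D : ℕ) :
    ∃ b : ℤ, ∀ i, IsCoprime (b + h i) (primorial D : ℤ) := by
  choose! r hr using hadm
  obtain ⟨b, -, hb⟩ := exists_modEq_primes (W := 1) ((Finset.range (D + 1)).filter Nat.Prime)
    (fun p hp => (Finset.mem_filter.1 hp).2) (fun p _ => Nat.coprime_one_right p) 0 r
  refine ⟨b, fun i => ?_⟩
  unfold primorial
  push_cast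
  refine IsCoprime.prod_right fun p hp => ?_
  have hpp := (Finset.mem_filter.1 hp).2
  refine ((Nat.prime_iff_prime_int.1 hpp).coprime_iff_not_dvd.2 fun hd => ?_).symm
  refine hr p hpp i ?_
  have := (hb p hp).add_right (h i : ℤ)
  exact (Int.ModEq.dvd_iff this).1 hd

end PrimorialFacts

/-! ### The sieve on one dyadic block. -/

section LargeTuples

theorem exp_sq_floor_harmonic_le {κ L : ℝ} (hκ : 0 ≤ κ) (hL : 0 ≤ L) :
    ∑ m ∈ Finset.Icc 1 ⌊Real.exp (κ * L) ^ 2⌋₊, 1 / (m : ℝ) ≤ 1 + 2 * κ * L := by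
  have e : Real.exp (κ * L) ^ 2 = Real.exp (2 * κ * L) := by
    rw [← Real.exp_nat_mul]; congr 1; push_cast; ring
  rw [e]
  have := log_expFloor_le (β := 2 * κ) (L := L) (by positivity) hL
  unfold expFloor at this
  linarith [sum_one_div_le ⌊Real.exp (2 * κ * L)⌋₊]

theorem sieveLoss_le_lossBound {k D₀ W : ℕ} (hD₀ : 0 < D₀) {β κ L : ℝ} (hβ : 0 ≤ β) (hL : 0 < L)
    (h1 : 0 < logSum W (expFloor β L) 1 L) (h2 : 0 < logSum W (expFloor β L) 2 L) :
    sieveLoss k (∑ p ∈ (Finset.Ioc D₀ (expFloor β L)).filter Nat.Prime, 1 / (p : ℝ) ^ 2) L (L ^ 2)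
      (κ * L - β * L - k * (logSum W (expFloor β L) 1 L / logSum W (expFloor β L) 2 L))
      W (expFloor β L) ≤ lossBound k D₀ W β κ L := by
  unfold sieveLoss lossBound
  have hlog := log_expFloor_le hβ hL.le
  have hH : ∑ m ∈ Finset.Icc 1 (expFloor β L), 1 / (m : ℝ) ≤ 1 + β * L := by
    linarith [sum_one_div_le (expFloor β L)]
  have hs := sum_inv_sq_primes_le (N := expFloor β L) hD₀
  have hH0 : 0 ≤ ∑ m ∈ Finset.Icc 1 (expFloor β L), 1 / (m : ℝ) :=
    Finset.sum_nonneg fun _ _ => by positivity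
  gcongr

/-- Monotonicity only: the strict inequality proved for explicit majorants passes to the quantities
that occur in the sieve. -/
theorem main_lt_of_bounds {a y y' W I J G G' M E E' F w l l' B : ℝ} {m k : ℕ} (hW : 0 ≤ W)
    (hw : 0 ≤ w) (hF : 0 ≤ F) (hI : 0 ≤ I) (hy : y ≤ y') (hEE : 0 ≤ E) (hE : E ≤ E')
    (hGG : 0 ≤ G) (hG : G ≤ G') (ha : 0 ≤ a) (hl : l ≤ l') (hB : 0 ≤ B)
    (h : m * (y' / W * I ^ k + E' * (M ^ 2 * G' ^ k))
      < a * (F / w * (I ^ (k - 1) * (J ^ 2 * (1 - l'))) - E' * B)) :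
    m * (y / W * I ^ k + E * (M ^ 2 * G ^ k))
      < a * (F / w * (I ^ (k - 1) * (J ^ 2 * (1 - l))) - E * B) := by
  have hE' : 0 ≤ E' := hEE.trans hE
  have h1 : y / W * I ^ k ≤ y' / W * I ^ k := by gcongr
  have h2 : E * (M ^ 2 * G ^ k) ≤ E' * (M ^ 2 * G' ^ k) := by gcongr
  have h3 : F / w * (I ^ (k - 1) * (J ^ 2 * (1 - l'))) ≤ F / w * (I ^ (k - 1) * (J ^ 2 * (1 - l))) :=
    by gcongr
  have h4 : E * B ≤ E' * B := by gcongr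
  refine lt_of_le_of_lt ?_ (h.trans_le ?_)
  · exact mul_le_mul_of_nonneg_left (by linarith) (Nat.cast_nonneg m)
  · exact mul_le_mul_of_nonneg_left (by linarith) ha

variable {ρ : ℝ → ℕ → ℝ} {c₁ ξ δ ϑ : ℝ}

/-- The sieve applied to the dyadic block `[x, 2x]`, `x = exp (s L)`, for large `L`. -/
theorem exists_many_primes_of_parameters (hc₁ : c₁ < 1)
    (h_minorant : ∀ᶠ x : ℝ in atTop, ∀ n ∈ dyadicBlock x, ρ x n ≤ if n.Prime then 1 else 0)
    (h_rough : ∀ᶠ x : ℝ in atTop, ∀ n ∈ dyadicBlock x, ρ x n ≠ 0 →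
      ∀ p : ℕ, p.Prime → p ∣ n → x ^ ξ < (p : ℝ))
    (h_dist : ∀ A : ℝ, 0 < A → ∃ C : ℝ, ∀ᶠ x : ℝ in atTop,
      ∀ P : ℕ, Squarefree P → (∀ p : ℕ, p.Prime → p ∣ P → (p : ℝ) < x ^ δ) →
        ∀ a : ℤ, IsCoprime a (P : ℤ) →
          ∑ q ∈ P.divisors with ((q : ℕ) : ℝ) ≤ x ^ ϑ, |discrepancy x (ρ x) q a|
            ≤ C * (x * (Real.log x) ^ (-A)))
    (h_sum : Tendsto (fun x : ℝ => (∑ n ∈ dyadicBlock x, ρ x n) / (x / Real.log x))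
      atTop (𝓝 (1 - c₁)))
    {ι : Type} [Fintype ι] [DecidableEq ι] {k : ℕ} (hkι : Fintype.card ι = k) (hk : 2 ≤ k)
    {h : ι → ℕ} (hinj : Function.Injective h)
    (hadm : ∀ p : ℕ, p.Prime → ∃ b : ℤ, ∀ i, ¬ (p : ℤ) ∣ b + h i)
    {D₀ : ℕ} (hD₀ : 4 * k ≤ D₀) (hD₀h : ∀ i, h i ≤ D₀) {β κ s : ℝ} (hβ : 0 < β)
    (hκ : β + k * (Real.log (1 + β) * (1 + β) / β) < κ) (hκs : 2 * κ < s) (hκϑ : 2 * κ < ϑ * s)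
    (hβδ : β < δ * s) (hβξ : β < ξ * s) {m : ℕ}
    (hm : m < k * ((1 - c₁) / s) * (Real.log (1 + β) ^ 2 * (1 + β) / β) *
      (1 - (14 * k ^ 2 * (1 / (D₀ : ℝ)) + k * β * (Real.log (1 + β) * (1 + β) / β) /
        (κ - β - k * (Real.log (1 + β) * (1 + β) / β)) ^ 2))) (T : ℕ) :
    ∃ n, T ≤ n ∧ m < (Finset.univ.filter fun j => (n + h j).Prime).card := by
  set W := primorial D₀ with hWdef
  have hW : 0 < W := primorial_pos D₀
  have hlogβ : 0 < Real.log (1 + β) := Real.log_pos (by linarith)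
  have hκ0 : 0 < κ := lt_trans (by positivity) hκ
  have hs : 0 < s := by linarith
  have hφ : (0 : ℝ) < W.totient := by exact_mod_cast Nat.totient_pos.2 hW
  have hW' : (0 : ℝ) < W := by exact_mod_cast hW
  -- The saving is chosen to beat the polynomial factors of `tendsto_poly_mul_rpow_neg`.
  obtain ⟨C, hC⟩ := h_dist ((11 * k + 4 * k * k + 1 : ℕ) : ℝ) (by positivity)
  have hlin : Tendsto (fun L : ℝ => s * L) atTop atTop := tendsto_id.const_mul_atTop hs
  have hx : Tendsto (fun L : ℝ => Real.exp (s * L)) atTop atTop := Real.tendsto_exp_atTop.comp hlin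
  obtain ⟨b, hb⟩ := exists_isCoprime_primorial h hadm D₀
  have hF : Tendsto (fun L => (∑ n ∈ dyadicBlock (Real.exp (s * L)), ρ (Real.exp (s * L)) n) /
      (Real.exp (s * L) / (s * L))) atTop (𝓝 (1 - c₁)) := by
    simpa [Function.comp_def] using h_sum.comp hx
  have hlen : Tendsto (fun L => (Real.exp (s * L) + (D₀ + 1)) / Real.exp (s * L)) atTop (𝓝 1) := by
    have h1 := (hx.inv_tendsto_atTop.const_mul ((D₀ : ℝ) + 1)).const_add 1
    rw [mul_zero, add_zero] at h1
    refine h1.congr fun L => ?_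
    rw [Pi.inv_apply, add_div, div_self (Real.exp_pos _).ne']
    rfl
  have hmain := eventually_main_lt (D₀ := D₀) (m := m) hW hβ (by omega : 1 ≤ k) hκ hκs
    (le_max_right C 0) hF hlen hm
  have hI1 := (tendsto_logSum_one hW hβ.le).eventually_const_lt
    (show 0 < (W.totient : ℝ) / W * Real.log (1 + β) by positivity)
  have hI2 := (tendsto_logSum_two hW hβ.le).eventually_const_lt
    (show 0 < (W.totient : ℝ) / W * (β / (1 + β)) by positivity)
  have hDpos := (tendsto_logSum_ratio hW hβ).eventually_lt_const
    (show Real.log (1 + β) * (1 + β) / β < (κ - β) / k by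
      rw [lt_div_iff₀ (by positivity)]; linarith)
  have hFpos := hF.eventually_const_lt (sub_pos.2 hc₁)
  have hexp : ∀ {c d : ℝ}, c < d → ∀ y : ℝ,
      ∀ᶠ L : ℝ in atTop, y * Real.exp (c * L) ≤ Real.exp (d * L) := by
    intro c d hcd y
    have : Tendsto (fun L : ℝ => Real.exp ((d - c) * L)) atTop atTop :=
      Real.tendsto_exp_atTop.comp (tendsto_id.const_mul_atTop (sub_pos.2 hcd))
    filter_upwards [this.eventually_ge_atTop y] with L hL
    calc y * Real.exp (c * L) ≤ Real.exp ((d - c) * L) * Real.exp (c * L) := by gcongr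
      _ = _ := by rw [← Real.exp_add]; congr 1; ring
  have hNlarge : ∀ᶠ L in atTop, D₀ ≤ expFloor β L := by
    have : Tendsto (fun L : ℝ => Real.exp (β * L)) atTop atTop :=
      Real.tendsto_exp_atTop.comp (tendsto_id.const_mul_atTop hβ)
    filter_upwards [this.eventually_ge_atTop (D₀ : ℝ)] with L hL
    exact Nat.le_floor hL
  -- The factor `2` yields the strict bound `p < x ^ δ` required of the moduli. Roughness is already
  -- strict, so the factor `1` suffices for `ξ`.
  have hNδ := hexp hβδ 2
  have hNξ := hexp hβξ 1
  have hQ := hexp hκϑ W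
  obtain ⟨L, hLmain, hLI1, hLI2, hLD, hLF, hLC, hLmin, hLrough, hLN, hLδ, hLξ, hLQ, hLx, hL1⟩ :=
    (hmain.and <| hI1.and <| hI2.and <| hDpos.and <| hFpos.and <| (hx.eventually hC).and <|
      (hx.eventually h_minorant).and <| (hx.eventually h_rough).and <| hNlarge.and <| hNδ.and <|
      hNξ.and <| hQ.and <| (hx.eventually_ge_atTop ((T : ℝ) + D₀ + 1)).and <|
      eventually_ge_atTop (1 : ℝ)).exists
  have hL0 : 0 < L := by linarith
  set x := Real.exp (s * L) with hxdef
  have hx0 : 0 < x := Real.exp_pos _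
  set N := expFloor β L with hNdef
  set S := (Finset.Ioc D₀ N).filter Nat.Prime with hSdef
  have hmemS : ∀ p, p ∈ S ↔ (D₀ < p ∧ p ≤ N) ∧ p.Prime := by
    intro p; simp [hSdef, Finset.mem_filter, Finset.mem_Ioc]
  have hP : W * ∏ p ∈ S, p = primorial N := primorial_mul_prod_Ioc hLN
  have hNle : (N : ℝ) ≤ Real.exp (β * L) := Nat.floor_le (Real.exp_pos _).le
  have hlogx : Real.log x = s * L := Real.log_exp _
  have hrpow : ∀ t : ℝ, x ^ t = Real.exp (t * s * L) := by
    intro t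
    rw [hxdef, ← Real.exp_mul]; congr 1; ring
  have hI2' : 0 < logSum W N 2 L := pos_of_mul_pos_right hLI2 hL0.le
  have hD : 0 < κ * L - β * L - k * (logSum W N 1 L / logSum W N 2 L) := by
    have hk0 : (0 : ℝ) < k := by positivity
    rw [div_lt_div_iff₀ hL0 hk0] at hLD
    nlinarith
  have hX : D₀ ≤ ⌈x⌉₊ := by
    have : (D₀ : ℝ) ≤ ⌈x⌉₊ := (by linarith [Nat.cast_nonneg (α := ℝ) T] : (D₀ : ℝ) ≤ x).trans
      (Nat.le_ceil x)
    exact_mod_cast this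
  have hXY' : ⌈x⌉₊ ≤ ⌊2 * x⌋₊ := by
    have h1 : ⌈x⌉₊ ≤ ⌊x⌋₊ + 1 := Nat.ceil_le_floor_add_one x
    have h2 : ⌊x⌋₊ + 1 ≤ ⌊2 * x⌋₊ := by
      refine Nat.le_floor ?_
      push_cast
      have := Nat.floor_le hx0.le
      have hT : (0 : ℝ) ≤ T := Nat.cast_nonneg T
      have hD' : (0 : ℝ) ≤ D₀ := Nat.cast_nonneg _
      linarith
    omega
  -- Starting at `⌈x⌉₊ - D₀` leaves room for all shifts `h j ≤ D₀`, so that every integer of the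
  -- block is reached. The length becomes at most `x + D₀ + 1`, which is asymptotic to `x`.
  obtain ⟨n, hn, hcard⟩ := exists_many_primes_of_main_term (S := S) (W := W) (N := N) (h := h)
    (x := x) (f := ρ x) (b := b) (X := ⌈x⌉₊ - D₀) (Y := ⌊2 * x⌋₊) (L := L) (K := L ^ 2)
    (R := Real.exp (κ * L)) (Q := x ^ ϑ)
    (D := κ * L - β * L - k * (logSum W N 1 L / logSum W N 2 L))
    (B := max C 0 * (x * (s * L) ^ (-((11 * k + 4 * k * k + 1 : ℕ) : ℝ)))) (m := m)
    (Cm := (∑ m ∈ Finset.Icc 1 N, 1 / (m : ℝ)) ^ (2 * Fintype.card ι)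
      * (L ^ 2) ^ (4 * Fintype.card ι))
    (fun p hp => ((hmemS p).1 hp).2)
    (fun p hp => by have := ((hmemS p).1 hp).1; omega)
    (by omega) hW
    (fun p hp => by
      rw [((hmemS p).1 hp).2.coprime_iff_not_dvd, ((hmemS p).1 hp).2.dvd_primorial_iff]
      have := ((hmemS p).1 hp).1; omega)
    (fun p hp hpN hpW => by
      rw [hp.coprime_iff_not_dvd, hp.dvd_primorial_iff] at hpW
      exact (hmemS p).2 ⟨⟨by omega, hpN⟩, hp⟩)
    (by
      intro p hp i l hil hmod
      have hp' := ((hmemS p).1 hp).1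
      have h3 := (Int.natCast_modEq_iff.1 hmod)
      exact hil (hinj (Nat.ModEq.eq_of_lt_of_lt h3 ((hD₀h i).trans_lt hp'.1)
        ((hD₀h l).trans_lt hp'.1))))
    hLmin
    (by
      intro n hn hne
      rw [hP]
      refine Nat.Coprime.symm (Nat.coprime_of_dvd fun p hp hpd hpn => ?_)
      have h1 := hLrough n hn hne p hp hpn
      have h2 : (p : ℝ) ≤ N := by exact_mod_cast hp.dvd_primorial_iff.1 hpd
      rw [hrpow] at h1
      linarith)
    (by
      have : 0 < x / (s * L) := by positivity
      exact ((div_pos_iff_of_pos_right this).1 hLF).le)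
    hb (by omega)
    (by
      intro j n hn
      have := Finset.mem_Icc.1 hn
      have := hD₀h j
      omega)
    hL1 (one_le_pow₀ hL1) (one_le_expFloor hβ.le hL0.le) (Real.exp_pos _) hLI1 hI2' hD
    (by
      rw [hkι, Real.log_exp]
      linarith [log_expFloor_le hβ.le hL0.le])
    rfl (by positivity)
    (by
      rw [hrpow]
      refine le_trans (le_of_eq ?_) hLQ
      rw [← Real.exp_nat_mul]; congr 2; push_cast; ring)
    (by
      rw [hP]
      intro a ha
      refine (hLC (primorial N) (squarefree_primorial N) ?_ a ha).trans ?_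
      · intro p hp hpd
        have h2 : (p : ℝ) ≤ N := by exact_mod_cast hp.dvd_primorial_iff.1 hpd
        rw [hrpow]
        have := Real.exp_pos (β * L)
        linarith
      · rw [hlogx]
        gcongr
        exact le_max_left _ _)
    (by
      rw [hkι]
      have hlog := log_expFloor_le hβ.le hL0.le
      have hH : ∑ m ∈ Finset.Icc 1 N, 1 / (m : ℝ) ≤ 1 + β * L := by
        linarith [sum_one_div_le N]
      have hH0 : 0 ≤ ∑ m ∈ Finset.Icc 1 N, 1 / (m : ℝ) :=
        Finset.sum_nonneg fun _ _ => by positivity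
      have hH2 := exp_sq_floor_harmonic_le hκ0.le hL0.le
      have hH20 : 0 ≤ ∑ m ∈ Finset.Icc 1 ⌊Real.exp (κ * L) ^ 2⌋₊, 1 / (m : ℝ) :=
        Finset.sum_nonneg fun _ _ => by positivity
      have hloss := sieveLoss_le_lossBound (k := k) (κ := κ) (W := W) (by omega : 0 < D₀) hβ.le hL0
        hLI1 hI2'
      have hF0 : 0 < ∑ n ∈ dyadicBlock x, ρ x n :=
        (div_pos_iff_of_pos_right (show 0 < x / (s * L) by positivity)).1 hLF
      have hYX : ((⌊2 * x⌋₊ : ℕ) : ℝ) + 1 - ((⌈x⌉₊ - D₀ : ℕ) : ℝ) ≤ x + (D₀ + 1) := by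
        rw [Nat.cast_sub hX]
        linarith [Nat.floor_le (show 0 ≤ 2 * x by positivity), Nat.le_ceil x]
      have hE : (∑ m ∈ Finset.Icc 1 N, 1 / (m : ℝ)) ^ (2 * k) * (L ^ 2) ^ (4 * k) ≤
          (1 + β * L) ^ (2 * k) * (L ^ 2) ^ (4 * k) :=
        mul_le_mul_of_nonneg_right (pow_le_pow_left₀ hH0 hH _) (by positivity)
      have hB : 0 ≤ ((L ^ 2) ^ (2 * k)) ^ k *
          (max C 0 * (x * (s * L) ^ (-((11 * k + 4 * k * k + 1 : ℕ) : ℝ)))) := by positivity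
      exact main_lt_of_bounds hW'.le hφ.le hF0.le hI2'.le hYX
        (mul_nonneg (pow_nonneg hH0 _) (by positivity)) hE hH20 hH2
        (Nat.cast_nonneg k) hloss hB hLmain)
  refine ⟨n, ?_, hcard⟩
  have h1 := (Finset.mem_Icc.1 hn).1
  have h2 : T + D₀ ≤ ⌈x⌉₊ := by
    have : ((T + D₀ : ℕ) : ℝ) ≤ ⌈x⌉₊ := le_trans (by push_cast; linarith) (Nat.le_ceil x)
    exact_mod_cast this
  omega

end LargeTuples

/-! ### Choice of `β` and `κ` in terms of `k`. -/

section Parameters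

variable {η : ℝ}

theorem tendsto_rpow_mul_log (hη1 : η < 1) :
    Tendsto (fun y : ℝ => y ^ (1 - η) * Real.log y) atTop atTop :=
  (tendsto_rpow_atTop (sub_pos.2 hη1)).atTop_mul_atTop₀ Real.tendsto_log_atTop

/-- `log β = (1 - η) log y + log log y`, and the second term is negligible. -/
theorem tendsto_log_one_add_div_log (hη1 : η < 1) :
    Tendsto (fun y : ℝ => Real.log (1 + y ^ (1 - η) * Real.log y) / Real.log y) atTop
      (𝓝 (1 - η)) := by
  have hβ := tendsto_rpow_mul_log hη1
  have h1 : Tendsto (fun y : ℝ => Real.log (Real.log y) / Real.log y) atTop (𝓝 0) :=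
    (Real.isLittleO_log_id_atTop.tendsto_div_nhds_zero).comp Real.tendsto_log_atTop
  have h2 : Tendsto (fun y : ℝ => Real.log (1 + (y ^ (1 - η) * Real.log y)⁻¹) / Real.log y) atTop
      (𝓝 0) := by
    refine Tendsto.div_atTop (a := Real.log (1 + 0)) ?_ Real.tendsto_log_atTop
    exact (hβ.inv_tendsto_atTop.const_add 1).log (by norm_num)
  have h3 := (h1.const_add (1 - η)).add h2
  rw [add_zero, add_zero] at h3
  refine h3.congr' ?_
  filter_upwards [eventually_gt_atTop (0 : ℝ), Real.tendsto_log_atTop.eventually_gt_atTop 0]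
    with y hy hl
  have hp : 0 < y ^ (1 - η) := Real.rpow_pos_of_pos hy _
  have e : 1 + y ^ (1 - η) * Real.log y =
      (y ^ (1 - η) * Real.log y) * (1 + (y ^ (1 - η) * Real.log y)⁻¹) := by
    field_simp
    ring
  rw [e, Real.log_mul (by positivity) (by positivity), Real.log_mul hp.ne' hl.ne',
    Real.log_rpow hy]
  field_simp

/-- For large `y`, the choice `β = y ^ (1 - η) log y`, `κ = y log y` meets all the constraints of
the sieve with a small loss. -/
theorem eventually_parameters (hη : 0 < η) (hη1 : η < 1) {γ τ : ℝ} (hγ : 0 < γ) (hτ : 0 < τ) :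
    ∀ᶠ y : ℝ in atTop, ∃ β : ℝ, 0 < β ∧ β < γ * (y * Real.log y) ∧
      β + y * (Real.log (1 + β) * (1 + β) / β) < y * Real.log y ∧
      y * β * (Real.log (1 + β) * (1 + β) / β) /
        (y * Real.log y - β - y * (Real.log (1 + β) * (1 + β) / β)) ^ 2 < τ ∧
      (1 - η) * Real.log y ≤ Real.log (1 + β) := by
  have hβ := tendsto_rpow_mul_log hη1
  have hu := tendsto_log_one_add_div_log hη1
  have hv : Tendsto (fun y : ℝ => Real.log (1 + y ^ (1 - η) * Real.log y) / Real.log y *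
      (1 + (y ^ (1 - η) * Real.log y)⁻¹)) atTop (𝓝 (1 - η)) := by
    have := hu.mul (hβ.inv_tendsto_atTop.const_add 1)
    simpa using this
  have hr : Tendsto (fun y : ℝ => y ^ (-η)) atTop (𝓝 0) := tendsto_rpow_neg_atTop hη
  have hden : Tendsto (fun y : ℝ => 1 - y ^ (-η) -
      Real.log (1 + y ^ (1 - η) * Real.log y) / Real.log y *
      (1 + (y ^ (1 - η) * Real.log y)⁻¹)) atTop (𝓝 η) := by
    have := (hr.const_sub 1).sub hv
    simpa using this
  have hloss := (hr.mul hv).div (hden.pow 2) (pow_ne_zero 2 hη.ne')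
  rw [zero_mul, zero_div] at hloss
  filter_upwards [hβ.eventually_gt_atTop 0, hr.eventually_lt_const hγ,
    hden.eventually_const_lt hη, hloss.eventually_lt_const hτ, eventually_gt_atTop (0 : ℝ),
    Real.tendsto_log_atTop.eventually_ge_atTop 1] with y h1 h2 h3 h4 hy hl
  have hl0 : 0 < Real.log y := by linarith
  have hp : 0 < y ^ (1 - η) := Real.rpow_pos_of_pos hy _
  have e1 : y ^ (1 - η) * Real.log y = y ^ (-η) * (y * Real.log y) := by
    rw [sub_eq_add_neg, Real.rpow_add hy, Real.rpow_one]; ring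
  -- In units of `κ = y log y`: `β` is `y^(-η)` and the total mean is `v → 1 - η`. The gap to `κ`
  -- therefore tends to `η`, while the variance bound is `y^(-η) v → 0`, so the Chebyshev loss
  -- disappears.
  set β := y ^ (1 - η) * Real.log y with hβdef
  set v := Real.log (1 + β) / Real.log y * (1 + β⁻¹) with hvdef
  have e2 : Real.log (1 + β) * (1 + β) / β = Real.log y * v := by
    rw [hvdef]; field_simp; ring
  have e3 : y * Real.log y - β - y * (Real.log y * v) = (y * Real.log y) * (1 - y ^ (-η) - v) := by
    rw [e1]; ring
  have hκ : 0 < y * Real.log y := by positivity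
  refine ⟨β, h1, ?_, ?_, ?_, ?_⟩
  · rw [e1]; exact mul_lt_mul_of_pos_right h2 hκ
  · rw [e2]
    have := mul_pos hκ h3
    rw [← e3] at this
    linarith
  · rw [e2, e3]
    refine lt_of_eq_of_lt ?_ h4
    rw [Pi.div_apply, mul_pow]
    have : y * β * (Real.log y * v) = (y * Real.log y) ^ 2 * (y ^ (-η) * v) := by rw [e1]; ring
    rw [this, mul_div_mul_left _ _ (by positivity)]
  · rw [← Real.log_rpow hy]
    refine Real.log_le_log hp ?_
    have : y ^ (1 - η) ≤ β := le_mul_of_one_le_right hp.le hl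
    linarith

end Parameters

/-! ### Many primes in every large admissible tuple. -/

section ManyPrimes

variable {ρ : ℝ → ℕ → ℝ} {θ c₁ ξ η : ℝ}

/-- If `m` is smaller than about `θ (1 - c₁) / 2 * log k`, every admissible `k`-tuple has infinitely
many translates containing more than `m` primes. -/
theorem eventually_exists_many_primes (hθ : 0 < θ) (hθ1 : θ ≤ 1) (hc₁ : c₁ < 1) (hξ : 0 < ξ)
    (h_minorant : ∀ᶠ x : ℝ in atTop, ∀ n ∈ dyadicBlock x, ρ x n ≤ if n.Prime then 1 else 0)
    (h_rough : ∀ᶠ x : ℝ in atTop, ∀ n ∈ dyadicBlock x, ρ x n ≠ 0 →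
      ∀ p : ℕ, p.Prime → p ∣ n → x ^ ξ < (p : ℝ))
    (h_exponent : HasSmoothExponentOfDistribution ρ θ)
    (h_sum : Tendsto (fun x : ℝ => (∑ n ∈ dyadicBlock x, ρ x n) / (x / Real.log x))
      atTop (𝓝 (1 - c₁)))
    (hη : 0 < η) (hη1 : η < 1) :
    ∀ᶠ k : ℕ in atTop, ∀ h : Fin k → ℕ, Function.Injective h →
      (∀ p : ℕ, p.Prime → ∃ b : ℤ, ∀ i, ¬ (p : ℤ) ∣ b + h i) → ∀ m : ℕ,
      m ≤ θ * (1 - c₁) / 2 * ((1 - η) ^ 4 / (1 + η)) * Real.log k → ∀ T : ℕ,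
      ∃ n, T ≤ n ∧ m < (Finset.univ.filter fun j => (n + h j).Prime).card := by
  obtain ⟨δ, hδ, hdist⟩ := h_exponent (η * θ) (by positivity)
  have hcast : Tendsto (fun k : ℕ => (k : ℝ)) atTop atTop := tendsto_natCast_atTop_atTop
  filter_upwards [hcast.eventually (eventually_parameters hη hη1 (lt_min hδ hξ) (half_pos hη)),
    eventually_ge_atTop 2] with k hk hk2 h hinj hadm m hm T
  obtain ⟨β, hβ, hβγ, hβκ, hloss, hlog⟩ := hk
  have hk0 : (0 : ℝ) < k := by positivity
  have hlk : 0 < Real.log k := Real.log_pos (by exact_mod_cast hk2)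
  have hκ : 0 < k * Real.log k := by positivity
  have hη' : 0 < 1 - η := by linarith
  have hc : 0 < 1 - c₁ := by linarith
  set κ := (k : ℝ) * Real.log k with hκdef
  -- The least `s` with `2κ < (θ - ηθ) s`, up to the factor `1 + η`. Because `θ ≤ 1` it also gives
  -- `2κ < s`, that is, `R^2` is below `x`.
  set s := 2 * κ * (1 + η) / (θ * (1 - η)) with hs
  have hs2 : 2 * κ < s := by
    rw [hs, lt_div_iff₀ (by positivity)]
    have h1 : θ * (1 - η) < 1 + η := by nlinarith
    exact mul_lt_mul_of_pos_left h1 (by positivity)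
  have hγs : min δ ξ * κ < min δ ξ * s := mul_lt_mul_of_pos_left (by linarith) (lt_min hδ hξ)
  have hs0 : 0 < s := by linarith
  -- `D₀` exceeds `28 k^2/η`, which makes the `1/p^2` loss less than `η/2`, and also exceeds `4k`
  -- and every shift.
  obtain ⟨D₀, hD₀⟩ := exists_nat_gt (max (28 * (k : ℝ) ^ 2 / η)
    ((4 * k + ∑ i, h i : ℕ) : ℝ))
  have hD1 : 28 * (k : ℝ) ^ 2 / η < D₀ := (le_max_left _ _).trans_lt hD₀
  have hD2 : 4 * k + ∑ i, h i < D₀ := by exact_mod_cast (le_max_right _ _).trans_lt hD₀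
  have hD0 : (0 : ℝ) < D₀ := lt_of_le_of_lt (by positivity) hD1
  refine exists_many_primes_of_parameters (δ := δ) (ϑ := θ - η * θ) hc₁ h_minorant h_rough hdist
    h_sum (Fintype.card_fin k) hk2 hinj hadm (D₀ := D₀) (by omega) (fun i => ?_) hβ hβκ hs2 ?_ ?_ ?_
    ?_ T
  · have := Finset.single_le_sum (f := h) (fun _ _ => Nat.zero_le _) (Finset.mem_univ i)
    omega
  · have e : (θ - η * θ) * s = 2 * κ * (1 + η) := by
      rw [hs, show θ - η * θ = θ * (1 - η) by ring]; field_simp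
    rw [e]; nlinarith
  · exact (hβγ.trans hγs).trans_le (mul_le_mul_of_nonneg_right (min_le_left _ _) hs0.le)
  · exact (hβγ.trans hγs).trans_le (mul_le_mul_of_nonneg_right (min_le_right _ _) hs0.le)
  · have hl1 : 14 * (k : ℝ) ^ 2 * (1 / (D₀ : ℝ)) < η / 2 := by
      rw [div_lt_iff₀ hη] at hD1
      rw [mul_one_div, div_lt_iff₀ hD0]
      linarith
    have hlb : 0 ≤ Real.log (1 + β) := (mul_pos hη' hlk).le.trans hlog
    refine hm.trans_lt ?_
    -- Of the four factors `1 - η`, one comes from the level `θ - ηθ`, two from `log (1 + β) ≥ (1 -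
    -- η) log k`, and one from the total relative loss below `η`; `1 + η` is the slack in `s`.
    have hfac : θ * (1 - c₁) / 2 * ((1 - η) ^ 4 / (1 + η)) * Real.log k =
        k * ((1 - c₁) / s) * ((1 - η) * Real.log k) ^ 2 * (1 - η) := by
      rw [hs, hκdef]; field_simp
    rw [hfac]
    have h1 : ((1 - η) * Real.log k) ^ 2 < Real.log (1 + β) ^ 2 * (1 + β) / β := by
      rw [lt_div_iff₀ hβ]
      have hsq : ((1 - η) * Real.log k) ^ 2 ≤ Real.log (1 + β) ^ 2 :=
        pow_le_pow_left₀ (mul_pos hη' hlk).le hlog 2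
      have hsq0 : 0 < ((1 - η) * Real.log k) ^ 2 := pow_pos (mul_pos hη' hlk) 2
      nlinarith
    have h2 : 0 < k * ((1 - c₁) / s) := by positivity
    refine mul_lt_mul (mul_lt_mul_of_pos_left h1 h2) (by linarith) hη' ?_
    positivity

end ManyPrimes

/-! ### Tuples of primes, their diameter, and prime gaps. -/

section PrimeTuples

/-- A Chebyshev lower bound for the number of primes up to `x`. -/
theorem eventually_primeCounting_ge :
    ∀ᶠ x : ℝ in atTop, x / (2 * Real.log x) ≤ (Nat.primeCounting ⌊x⌋₊ : ℝ) := by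
  have h1 : Tendsto (fun x : ℝ => Real.log x / x) atTop (𝓝 0) :=
    Real.isLittleO_log_id_atTop.tendsto_div_nhds_zero
  filter_upwards [h1.eventually_lt_const (show (0 : ℝ) < 1 / 20 by norm_num),
    eventually_ge_atTop (20 : ℝ)] with x hx hx20
  have hl : 0 < Real.log x := Real.log_pos (by linarith)
  refine le_trans ?_ (Chebyshev.pi_ge' (by linarith : 1 < x))
  rw [div_lt_iff₀ (by linarith)] at hx
  have h2 : Real.log (x + 2) ≤ Real.log x + 1 := by
    have : x + 2 ≤ x * 2 := by linarith
    have h3 := Real.log_le_log (by linarith) this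
    rw [Real.log_mul (by linarith) (by norm_num)] at h3
    linarith [Real.log_two_lt_d9]
  rw [show x / (2 * Real.log x) = (x / 2) / Real.log x by field_simp]
  gcongr
  have := Real.log_two_gt_d9
  nlinarith

/-- The `2k`-th prime is at most `k ^ (1 + η)` for large `k`. -/
theorem eventually_nth_prime_le {η : ℝ} (hη : 0 < η) :
    ∀ᶠ k : ℕ in atTop, (Nat.nth Nat.Prime (2 * k) : ℝ) ≤ (k : ℝ) ^ (1 + η) := by
  have hcast : Tendsto (fun k : ℕ => (k : ℝ)) atTop atTop := tendsto_natCast_atTop_atTop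
  have hpow := (tendsto_rpow_atTop (show 0 < 1 + η by linarith)).comp hcast
  have ho : Tendsto (fun x : ℝ => Real.log x / x ^ η) atTop (𝓝 0) :=
    (isLittleO_log_rpow_atTop hη).tendsto_div_nhds_zero
  filter_upwards [hpow.eventually eventually_primeCounting_ge, (ho.comp hcast).eventually_lt_const
    (show (0 : ℝ) < 1 / (4 * (1 + η)) by positivity), eventually_ge_atTop 2] with k h1 h2 hk
  simp only [Function.comp_apply] at h1 h2
  have hk0 : (0 : ℝ) < k := by positivity
  have hl : 0 < Real.log k := Real.log_pos (by exact_mod_cast hk)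
  have hp : 0 < (k : ℝ) ^ η := Real.rpow_pos_of_pos hk0 _
  rw [Real.log_rpow hk0] at h1
  have h3 : 2 * (k : ℝ) < Nat.primeCounting ⌊(k : ℝ) ^ (1 + η)⌋₊ := by
    refine lt_of_lt_of_le ?_ h1
    rw [lt_div_iff₀ (by positivity), Real.rpow_add hk0, Real.rpow_one]
    rw [div_lt_div_iff₀ hp (by positivity)] at h2
    nlinarith
  have h4 : 2 * k < Nat.count Nat.Prime (⌊(k : ℝ) ^ (1 + η)⌋₊ + 1) := by exact_mod_cast h3
  have h5 := Nat.nth_lt_of_lt_count h4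
  refine le_trans ?_ (Nat.floor_le (by positivity : 0 ≤ (k : ℝ) ^ (1 + η)))
  exact_mod_cast Nat.lt_succ_iff.1 h5

/-- Any `k` primes larger than `k` form an admissible tuple. -/
theorem exists_not_dvd_add_of_primes {k : ℕ} {h : Fin k → ℕ} (hp : ∀ i, (h i).Prime)
    (hk : ∀ i, k < h i) (p : ℕ) (hpp : p.Prime) : ∃ b : ℤ, ∀ i, ¬ (p : ℤ) ∣ b + h i := by
  -- A prime up to `k` divides none of the `h i`, which are larger primes; a prime beyond `k` has
  -- more classes than there are `h i`.
  rcases le_or_gt p k with hpk | hpk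
  · refine ⟨0, fun i hd => ?_⟩
    rw [zero_add, Int.natCast_dvd_natCast, Nat.prime_dvd_prime_iff_eq hpp (hp i)] at hd
    have := hk i
    omega
  · have : NeZero p := ⟨hpp.ne_zero⟩
    have hns : ¬ Function.Surjective (fun i : Fin k => -(h i : ZMod p)) := by
      intro hs
      have := Fintype.card_le_of_surjective _ hs
      rw [ZMod.card, Fintype.card_fin] at this
      omega
    rw [Function.Surjective] at hns
    push Not at hns
    obtain ⟨b, hb⟩ := hns
    refine ⟨b.val, fun i hd => hb i ?_⟩
    have h0 := (ZMod.intCast_zmod_eq_zero_iff_dvd _ p).2 hd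
    push_cast at h0
    rw [ZMod.natCast_zmod_val] at h0
    exact (eq_neg_of_add_eq_zero_left h0).symm

/-- Clusters of primes in translates of a tuple bound the gaps `p_{r+m} - p_r`. -/
theorem primeGapLiminf_le {k m D : ℕ} {h : Fin k → ℕ} (hinj : Function.Injective h)
    (hD : ∀ i, h i ≤ D)
    (hmany : ∀ T : ℕ, ∃ n, T ≤ n ∧ m < (Finset.univ.filter fun j => (n + h j).Prime).card) :
    primeGapLiminf m ≤ ((D : ℝ) : EReal) := by
  refine liminf_le_of_frequently_le' (frequently_atTop.2 fun r₀ => ?_)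
  obtain ⟨n, hn, hcard⟩ := hmany (Nat.nth Nat.Prime r₀)
  -- With `r` the number of primes below `n`, more than `m` primes in `[n, n + D]` give `p_{r+m} ≤ n
  -- + D`, while `p_r ≥ n`.
  have hcount : Nat.count Nat.Prime n + m < Nat.count Nat.Prime (n + (D + 1)) := by
    rw [Nat.count_add, Nat.count_eq_card_filter_range (fun t => (n + t).Prime)]
    refine Nat.add_lt_add_left (hcard.trans_le ?_) _
    refine Finset.card_le_card_of_injOn h (fun j hj => ?_) hinj.injOn
    simp only [Finset.coe_filter, Finset.mem_univ, true_and, Set.mem_ofPred_eq,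
      Finset.mem_range] at hj ⊢
    exact ⟨Nat.lt_succ_of_le (hD j), hj⟩
  refine ⟨Nat.count Nat.Prime n, ?_, ?_⟩
  · rw [← Nat.count_nth_of_infinite Nat.infinite_setOfPred_prime r₀]
    exact Nat.count_monotone _ hn
  · have h1 := Nat.nth_lt_of_lt_count hcount
    have h2 : n ≤ Nat.nth Nat.Prime (Nat.count Nat.Prime n) :=
      Nat.le_nth_count Nat.infinite_setOfPred_prime n
    have h3 : Nat.nth Nat.Prime (Nat.count Nat.Prime n + m) ≤
        D + Nat.nth Nat.Prime (Nat.count Nat.Prime n) := by omega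
    have h4 : (Nat.nth Nat.Prime (Nat.count Nat.Prime n + m) : ℝ) ≤
        D + Nat.nth Nat.Prime (Nat.count Nat.Prime n) := by exact_mod_cast h3
    exact EReal.coe_le_coe_iff.2 (by linarith)

end PrimeTuples

/-! ### The exponential bound for `H_m`. -/

section BoundedGaps

variable {ρ : ℝ → ℕ → ℝ} {θ c₁ ξ c₀ : ℝ}

/-- At `η = 0` the inequality is strict, so it persists for small `η` by continuity. The `1 + η` on
the left is reserved for the diameter `k^(1+η)` of the tuple. -/
theorem exists_small_parameter {a : ℝ} (ha : 1 < a) :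
    ∃ η : ℝ, 0 < η ∧ η < 1 ∧ 1 + η ≤ a * ((1 - η) ^ 4 / (1 + η)) := by
  have hcont : Tendsto (fun η : ℝ => a * (1 - η) ^ 4 - (1 + η) ^ 2) (𝓝[>] 0) (𝓝 (a - 1)) := by
    have : Continuous (fun η : ℝ => a * (1 - η) ^ 4 - (1 + η) ^ 2) := by fun_prop
    have h := (this.tendsto 0).mono_left (nhdsWithin_le_nhds (s := Set.Ioi 0))
    simpa using h
  obtain ⟨η, h1, h2, h3⟩ := ((hcont.eventually_const_lt (sub_pos.2 ha)).and <|
    (eventually_mem_nhdsWithin).and <| Ioo_mem_nhdsGT (show (0 : ℝ) < 1 by norm_num)).exists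
  refine ⟨η, h2, h3.2, ?_⟩
  have : 0 < 1 + η := by linarith [h3.1]
  rw [← mul_div_assoc, le_div_iff₀ this]
  nlinarith

theorem exists_primeGapLiminf_le_of_le_one (hθ : 0 < θ) (hθ1 : θ ≤ 1) (hc₁ : c₁ < 1) (hξ : 0 < ξ)
    (h_minorant : ∀ᶠ x : ℝ in atTop, ∀ n ∈ dyadicBlock x, ρ x n ≤ if n.Prime then 1 else 0)
    (h_rough : ∀ᶠ x : ℝ in atTop, ∀ n ∈ dyadicBlock x, ρ x n ≠ 0 →
      ∀ p : ℕ, p.Prime → p ∣ n → x ^ ξ < (p : ℝ))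
    (h_exponent : HasSmoothExponentOfDistribution ρ θ)
    (h_sum : Tendsto (fun x : ℝ => (∑ n ∈ dyadicBlock x, ρ x n) / (x / Real.log x))
      atTop (𝓝 (1 - c₁)))
    (hc₀ : 2 / (θ * (1 - c₁)) < c₀) :
    ∃ C : ℝ, ∀ m : ℕ, 1 ≤ m →
      primeGapLiminf m ≤ ((C * Real.exp (c₀ * (m : ℝ)) : ℝ) : EReal) := by
  have hc : 0 < θ * (1 - c₁) := mul_pos hθ (by linarith)
  have hc₀0 : 0 < c₀ := lt_trans (by positivity) hc₀
  obtain ⟨η, hη, hη1, hηc⟩ := exists_small_parameter (a := c₀ * (θ * (1 - c₁) / 2)) (by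
    rw [div_lt_iff₀ hc] at hc₀; linarith)
  obtain ⟨k₀, hk₀⟩ := eventually_atTop.1 ((eventually_exists_many_primes hθ hθ1 hc₁ hξ h_minorant
    h_rough h_exponent h_sum hη hη1).and (eventually_nth_prime_le hη))
  refine ⟨((k₀ : ℝ) + 2) ^ (1 + η), fun m _ => ?_⟩
  have hη0 : 0 < 1 + η := by linarith
  -- `t^(1+η) = exp (c₀ m)`. With `k = k₀ + ⌈t⌉₊` the threshold `k₀` is respected for every `m`, and
  -- `k ≤ (k₀ + 2) t` as `t ≥ 1`, which explains the constant.
  set t := Real.exp (c₀ / (1 + η) * m) with ht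
  have ht1 : 1 ≤ t := Real.one_le_exp (by positivity)
  set k := k₀ + ⌈t⌉₊ with hk
  obtain ⟨hmany, hnth⟩ := hk₀ k (by omega)
  have htk : t ≤ k := (Nat.le_ceil t).trans (by rw [hk]; push_cast; linarith [k₀.cast_nonneg (α := ℝ)])
  have hkt : (k : ℝ) ≤ (k₀ + 2) * t := by
    have := Nat.ceil_lt_add_one (by linarith : 0 ≤ t)
    rw [hk]; push_cast
    nlinarith [k₀.cast_nonneg (α := ℝ)]
  have hsm := Nat.nth_strictMono Nat.infinite_setOfPred_prime
  have hlog : m ≤ θ * (1 - c₁) / 2 * ((1 - η) ^ 4 / (1 + η)) * Real.log k := by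
    have h1 : c₀ / (1 + η) * m ≤ Real.log k := by
      rw [← Real.log_exp (c₀ / (1 + η) * m)]
      exact Real.log_le_log (Real.exp_pos _) htk
    have h2 : 0 ≤ (1 - η) ^ 4 / (1 + η) := by positivity
    calc (m : ℝ) = (1 + η) * (1 / (1 + η) * m) := by field_simp
      _ ≤ c₀ * (θ * (1 - c₁) / 2) * ((1 - η) ^ 4 / (1 + η)) * (1 / (1 + η) * m) := by gcongr
      _ = θ * (1 - c₁) / 2 * ((1 - η) ^ 4 / (1 + η)) * (c₀ / (1 + η) * m) := by ring
      _ ≤ _ := by gcongr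
  -- The tuple consists of the `k` primes with indices `k, …, 2k - 1` (counted from `0`); they all
  -- exceed `k`.
  have hfin := primeGapLiminf_le (k := k) (m := m) (D := Nat.nth Nat.Prime (2 * k))
    (h := fun i => Nat.nth Nat.Prime (k + i)) (fun i j hij => Fin.ext (by
      have := hsm.injective hij; omega))
    (fun i => hsm.monotone (by omega))
    (hmany _ (fun i j hij => Fin.ext (by have := hsm.injective hij; omega))
      (exists_not_dvd_add_of_primes
        (fun i => Nat.nth_mem_of_infinite Nat.infinite_setOfPred_prime _)
        (fun i => lt_of_lt_of_le (by omega) (Nat.add_two_le_nth_prime (k + i)))) m hlog)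
  refine hfin.trans (EReal.coe_le_coe_iff.2 (hnth.trans ?_))
  calc (k : ℝ) ^ (1 + η) ≤ ((k₀ + 2) * t) ^ (1 + η) := by gcongr
    _ = (k₀ + 2 : ℝ) ^ (1 + η) * t ^ (1 + η) := Real.mul_rpow (by positivity) (by positivity)
    _ = _ := by
      rw [ht, ← Real.exp_mul]
      congr 2
      field_simp

end BoundedGaps

/-! ### Exclusion of exponents of distribution above `1`. -/

section LevelBeyondOne

/-- There are many products of exactly `J` distinct primes up to `M` that exceed `z`. -/
theorem card_prime_products_ge (J M : ℕ) {z : ℝ} (hz : 0 ≤ z) :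
    ((Nat.primeCounting M).choose J : ℝ) - z ≤
      (((primorial M).divisors.filter fun q : ℕ => z < (q : ℝ) ∧ (q : ℝ) ≤ (M : ℝ) ^ J).card : ℝ) := by
  classical
  set Pr := (Finset.range (M + 1)).filter Nat.Prime with hPr
  set U := (Pr.powersetCard J).image (fun s => ∏ p ∈ s, p) with hU
  have hprime : ∀ s ∈ Pr.powersetCard J, ∀ p ∈ s, p.Prime := fun s hs p hp =>
    (Finset.mem_filter.1 ((Finset.mem_powersetCard.1 hs).1 hp)).2
  have hUcard : U.card = (Nat.primeCounting M).choose J := by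
    rw [hU, Finset.card_image_of_injOn, Finset.card_powersetCard, hPr,
      ← Nat.count_eq_card_filter_range]
    · rfl
    · intro s hs t ht hst
      rw [← Nat.primeFactors_prod (hprime s hs), ← Nat.primeFactors_prod (hprime t ht)]
      exact congrArg _ hst
  have hsmall : ((U.filter fun q : ℕ => ¬ z < (q : ℝ)).card : ℝ) ≤ z := by
    have : U.filter (fun q : ℕ => ¬ z < (q : ℝ)) ⊆ Finset.Icc 1 ⌊z⌋₊ := by
      intro q hq
      obtain ⟨hq1, hq2⟩ := Finset.mem_filter.1 hq
      obtain ⟨s, hs, rfl⟩ := Finset.mem_image.1 hq1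
      exact Finset.mem_Icc.2 ⟨Finset.prod_pos fun p hp => (hprime s hs p hp).pos,
        Nat.le_floor (not_lt.1 hq2)⟩
    have h1 := Finset.card_le_card this
    rw [Nat.card_Icc, Nat.add_sub_cancel] at h1
    exact (Nat.cast_le.2 h1).trans (Nat.floor_le hz)
  have hlarge : U.filter (fun q : ℕ => z < (q : ℝ)) ⊆
      (primorial M).divisors.filter fun q : ℕ => z < (q : ℝ) ∧ (q : ℝ) ≤ (M : ℝ) ^ J := by
    intro q hq
    obtain ⟨hq1, hq2⟩ := Finset.mem_filter.1 hq
    obtain ⟨s, hs, rfl⟩ := Finset.mem_image.1 hq1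
    obtain ⟨hs1, hs2⟩ := Finset.mem_powersetCard.1 hs
    refine Finset.mem_filter.2 ⟨Nat.mem_divisors.2
      ⟨Finset.prod_dvd_prod_of_subset _ _ _ hs1, (primorial_pos M).ne'⟩, hq2, ?_⟩
    have : ∏ p ∈ s, p ≤ M ^ s.card := Finset.prod_le_pow_card _ _ _ fun p hp => by
      have := Finset.mem_range.1 (Finset.mem_filter.1 (hs1 hp)).1
      omega
    rw [hs2] at this
    exact_mod_cast this
  have hsum := Finset.card_filter_add_card_filter_not (s := U) (fun q : ℕ => z < (q : ℝ))
  have hle := Finset.card_le_card hlarge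
  have h1 : ((U.filter fun q : ℕ => z < (q : ℝ)).card : ℝ) + (U.filter fun q : ℕ => ¬ z < (q : ℝ)).card
      = (Nat.primeCounting M).choose J := by rw [← hUcard]; exact_mod_cast hsum
  have h2 : ((U.filter fun q : ℕ => z < (q : ℝ)).card : ℝ) ≤
      (((primorial M).divisors.filter fun q : ℕ => z < (q : ℝ) ∧ (q : ℝ) ≤ (M : ℝ) ^ J).card : ℝ) :=
    Nat.cast_le.2 hle
  linarith

/-- For a modulus beyond the block, the residue class of `1` is empty, so the discrepancy is the
whole normalised sum. -/
theorem abs_discrepancy_one_ge {x : ℝ} (hx : 1 < x) {f : ℕ → ℝ} {q : ℕ} (hq : 2 * x < q)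
    (hf : ∀ n ∈ dyadicBlock x, f n ≠ 0 → n.Coprime q) (hF : 0 ≤ ∑ n ∈ dyadicBlock x, f n) :
    (∑ n ∈ dyadicBlock x, f n) / q ≤ |discrepancy x f q 1| := by
  have hq0 : 0 < q := by
    have : (0 : ℝ) < q := by linarith
    exact_mod_cast this
  have h1 : (dyadicBlock x).filter (fun n : ℕ => (n : ℤ) ≡ 1 [ZMOD (q : ℤ)]) = ∅ := by
    refine Finset.filter_eq_empty_iff.2 fun n hn hmod => ?_
    rw [mem_dyadicBlock (by linarith)] at hn
    have hn1 : (1 : ℝ) < n := by linarith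
    have hnq : (n : ℝ) < q := by linarith
    have hn1' : 1 < n := by exact_mod_cast hn1
    have hnq' : n < q := by exact_mod_cast hnq
    have h2 : n ≡ 1 [MOD q] := Int.natCast_modEq_iff.1 (by simpa using hmod)
    have := Nat.ModEq.eq_of_lt_of_lt h2 hnq' (by omega)
    omega
  have h2 : ∑ n ∈ (dyadicBlock x).filter (fun n : ℕ => n.Coprime q), f n =
      ∑ n ∈ dyadicBlock x, f n :=
    Finset.sum_filter_of_ne fun n hn hne => hf n hn hne
  unfold discrepancy
  rw [h1, h2, Finset.sum_empty, zero_sub, abs_neg]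
  refine le_trans ?_ (le_abs_self _)
  rw [div_eq_mul_one_div, mul_comm]
  have hφ : (0 : ℝ) < q.totient := by exact_mod_cast Nat.totient_pos.2 hq0
  have hle : (q.totient : ℝ) ≤ q := by exact_mod_cast Nat.totient_le q
  gcongr

variable {ρ : ℝ → ℕ → ℝ} {θ c₁ ξ : ℝ}

/-- The exponent of distribution of a family of positive mean supported on rough numbers is at
most `1`. -/
theorem exponent_le_one (hc₁ : c₁ < 1) (hξ : 0 < ξ)
    (h_rough : ∀ᶠ x : ℝ in atTop, ∀ n ∈ dyadicBlock x, ρ x n ≠ 0 →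
      ∀ p : ℕ, p.Prime → p ∣ n → x ^ ξ < (p : ℝ))
    (h_exponent : HasSmoothExponentOfDistribution ρ θ)
    (h_sum : Tendsto (fun x : ℝ => (∑ n ∈ dyadicBlock x, ρ x n) / (x / Real.log x))
      atTop (𝓝 (1 - c₁))) : θ ≤ 1 := by
  by_contra! hθ
  -- Then `θ - ε = 1 + ε`, so moduli up to `x^(1+ε)` are within the level.
  set ε := (θ - 1) / 2 with hε
  have hε0 : 0 < ε := by linarith
  obtain ⟨δ, hδ, hdist⟩ := h_exponent ε hε0
  have hγ : 0 < min δ ξ := lt_min hδ hξ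
  -- Moduli are products of `J` primes up to `x^b` with `J b = 1 + ε`. Taking `J` large makes `b`
  -- less than `δ` and `ξ`: the moduli are smooth and coprime to the support.
  obtain ⟨J, hJ⟩ := exists_nat_gt ((1 + ε) / min δ ξ)
  have hJ0 : (0 : ℝ) < J := lt_of_le_of_lt (by positivity) hJ
  -- The lower bound below has order `x / (log x)^(J+1)`, so a saving of `J + 2` powers contradicts
  -- it.
  obtain ⟨C, hC⟩ := hdist (J + 2 : ℕ) (by positivity)
  set b := (1 + ε) / J with hb
  have hb0 : 0 < b := by positivity
  have hbγ : b < min δ ξ := by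
    rw [hb, div_lt_iff₀ hJ0]; rw [div_lt_iff₀ hγ] at hJ; linarith
  have hy : Tendsto (fun x : ℝ => x ^ b) atTop atTop := tendsto_rpow_atTop hb0
  set c := 1 / ((4 * b) ^ J * J.factorial) with hc
  have hc0 : 0 < c := by positivity
  have hlogy : Tendsto (fun y : ℝ => Real.log y / y) atTop (𝓝 0) :=
    Real.isLittleO_log_id_atTop.tendsto_div_nhds_zero
  have hlogpow : Tendsto (fun x : ℝ => Real.log x ^ (J : ℝ) / x ^ ε) atTop (𝓝 0) :=
    (isLittleO_log_rpow_rpow_atTop (J : ℝ) hε0).tendsto_div_nhds_zero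
  obtain ⟨x, h1, h2, h3, h4, h5, h6, h7, h8⟩ := ((hy.eventually eventually_primeCounting_ge).and <|
    ((hlogy.comp hy).eventually_lt_const (show 0 < 1 / (4 * (J : ℝ)) by positivity)).and <|
    (hlogpow.eventually_lt_const (show 0 < c / 4 by positivity)).and <|
    (h_sum.eventually_const_lt (show (1 - c₁) / 2 < 1 - c₁ by linarith)).and <| hC.and <|
    h_rough.and <|
    (Real.tendsto_log_atTop.eventually_gt_atTop (max 1 (C / (c / 2 * ((1 - c₁) / 2))))).and <|
    eventually_gt_atTop (1 : ℝ)).exists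
  have hx0 : 0 < x := by linarith
  have hl1 : 1 < Real.log x := (le_max_left _ _).trans_lt h7
  have hl0 : 0 < Real.log x := by linarith
  have hlC : C / (c / 2 * ((1 - c₁) / 2)) < Real.log x := (le_max_right _ _).trans_lt h7
  set ℓ := Real.log x with hℓ
  set F := ∑ n ∈ dyadicBlock x, ρ x n with hFdef
  have hF : (1 - c₁) / 2 * (x / ℓ) < F := by
    rwa [lt_div_iff₀ (by positivity)] at h4
  have hF0 : 0 < F := lt_trans (by have : 0 < 1 - c₁ := by linarith
                                   positivity) hF
  set y := x ^ b with hydef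
  have hy0 : 0 < y := Real.rpow_pos_of_pos hx0 b
  have hy1 : 1 < y := Real.one_lt_rpow h8 hb0
  have hlogy' : Real.log y = b * ℓ := Real.log_rpow hx0 b
  have hyJ : y ^ J = x ^ (1 + ε) := by
    rw [hydef, ← Real.rpow_mul_natCast hx0.le, hb, div_mul_cancel₀ _ hJ0.ne']
  set M := ⌊y⌋₊ with hM
  have hMy : (M : ℝ) ≤ y := Nat.floor_le hy0.le
  set G := (primorial M).divisors.filter fun q : ℕ => 2 * x < (q : ℝ) ∧ (q : ℝ) ≤ (M : ℝ) ^ J with hG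
  have hpi : y / (2 * Real.log y) ≤ (Nat.primeCounting M : ℝ) := h1
  -- The Chebyshev bound gives at least `y/(2 log y)` primes, half of which absorbs the shift by `J`
  -- in the binomial estimate; this accounts for the `4b` in `c`.
  have hchoose : x ^ (1 + ε) * c / ℓ ^ J ≤ ((Nat.primeCounting M).choose J : ℝ) := by
    have hly : 0 < Real.log y := Real.log_pos hy1
    have hJy : 2 * (J : ℝ) ≤ y / (2 * Real.log y) := by
      have h2' : Real.log y / y < 1 / (4 * (J : ℝ)) := h2
      rw [div_lt_div_iff₀ hy0 (by positivity)] at h2'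
      rw [le_div_iff₀ (by positivity)]
      linarith
    have hJpi : J ≤ Nat.primeCounting M + 1 := by
      have : (J : ℝ) ≤ Nat.primeCounting M := by linarith
      have : J ≤ Nat.primeCounting M := by exact_mod_cast this
      omega
    have h9 := Nat.pow_le_choose (α := ℝ) J (Nat.primeCounting M)
    rw [Nat.cast_sub hJpi] at h9
    have h10 : y / (4 * Real.log y) ≤ ((Nat.primeCounting M + 1 : ℕ) : ℝ) - J := by
      have : y / (4 * Real.log y) = y / (2 * Real.log y) / 2 := by field_simp; norm_num
      rw [this]
      push_cast
      linarith
    have h11 : (y / (4 * Real.log y)) ^ J ≤ (((Nat.primeCounting M + 1 : ℕ) : ℝ) - J) ^ J :=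
      pow_le_pow_left₀ (by positivity) h10 J
    have hfac : (0 : ℝ) < J.factorial := by positivity
    have h12 : x ^ (1 + ε) * c / ℓ ^ J = (y / (4 * Real.log y)) ^ J / J.factorial := by
      rw [div_pow, hyJ, hlogy', hc, ← mul_assoc, mul_pow (4 * b), mul_one_div,
        div_div, div_div]
      congr 1
      ring
    rw [h12]
    exact (div_le_div_of_nonneg_right h11 hfac.le).trans h9
  -- The products not exceeding `2x` number at most `2x`, which is at most half of the total.
  have h2x : 2 * x ≤ x ^ (1 + ε) * c / ℓ ^ J / 2 := by
    rw [Real.rpow_natCast, div_lt_iff₀ (by positivity)] at h3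
    rw [Real.rpow_add hx0, Real.rpow_one, div_div, le_div_iff₀ (by positivity)]
    nlinarith
  have hcard : x ^ (1 + ε) * (c / 2) / ℓ ^ J ≤ (G.card : ℝ) := by
    have := card_prime_products_ge J M (z := 2 * x) (by linarith)
    have e : x ^ (1 + ε) * (c / 2) / ℓ ^ J = x ^ (1 + ε) * c / ℓ ^ J / 2 := by ring
    rw [e]
    linarith
  have hMJ : (M : ℝ) ^ J ≤ x ^ (1 + ε) := by
    rw [← hyJ]; exact pow_le_pow_left₀ (Nat.cast_nonneg _) hMy J
  have hMp : ∀ t, min δ ξ ≤ t → ∀ p : ℕ, p.Prime → p ∣ primorial M → (p : ℝ) < x ^ t := by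
    intro t ht p hp hpd
    have : (p : ℝ) ≤ M := by exact_mod_cast hp.dvd_primorial_iff.1 hpd
    exact (this.trans hMy).trans_lt (Real.rpow_lt_rpow_of_exponent_lt h8 (hbγ.trans_le ht))
  have hupper := h5 (primorial M) (squarefree_primorial M) (hMp δ (min_le_left _ _)) 1
    isCoprime_one_left
  have hlower : (G.card : ℝ) * (F / x ^ (1 + ε)) ≤
      ∑ q ∈ (primorial M).divisors with ((q : ℕ) : ℝ) ≤ x ^ (θ - ε), |discrepancy x (ρ x) q 1| := by
    rw [← nsmul_eq_mul, ← Finset.sum_const]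
    have hsub : G ⊆ (primorial M).divisors.filter fun q : ℕ => (q : ℝ) ≤ x ^ (θ - ε) := by
      intro q hq
      obtain ⟨hq1, -, hq3⟩ := Finset.mem_filter.1 hq
      refine Finset.mem_filter.2 ⟨hq1, ?_⟩
      rw [show θ - ε = 1 + ε by rw [hε]; ring]
      exact hq3.trans hMJ
    refine (Finset.sum_le_sum fun q hq => ?_).trans
      (Finset.sum_le_sum_of_subset_of_nonneg hsub fun _ _ _ => abs_nonneg _)
    obtain ⟨hq1, hq2, hq3⟩ := Finset.mem_filter.1 hq
    have hq0 : (0 : ℝ) < q := by linarith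
    refine le_trans ?_ (abs_discrepancy_one_ge h8 hq2 (fun n hn hne => ?_) hF0.le)
    · exact div_le_div_of_nonneg_left hF0.le hq0 (hq3.trans hMJ)
    · refine Nat.coprime_of_dvd fun p hp hpn hpq => ?_
      have := hMp ξ (min_le_right _ _) p hp (hpq.trans (Nat.dvd_of_mem_divisors hq1))
      exact absurd (h6 n hn hne p hp hpn) (not_lt.2 this.le)
  -- There are at least `x^(1+ε) (c/2)/(log x)^J` moduli, each with discrepancy at least the sum of
  -- `ρ` divided by `x^(1+ε)`.
  have hfinal : x ^ (1 + ε) * (c / 2) / ℓ ^ J * ((1 - c₁) / 2 * (x / ℓ) / x ^ (1 + ε)) ≤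
      C * (x * ℓ ^ (-((J + 2 : ℕ) : ℝ))) := by
    have hp : 0 < x ^ (1 + ε) := Real.rpow_pos_of_pos hx0 _
    refine le_trans (mul_le_mul hcard ?_ ?_ (Nat.cast_nonneg _)) (hlower.trans hupper)
    · exact div_le_div_of_nonneg_right hF.le hp.le
    · have : 0 < 1 - c₁ := by linarith
      positivity
  rw [Real.rpow_neg hl0.le, Real.rpow_natCast] at hfinal
  have hp : 0 < x ^ (1 + ε) := Real.rpow_pos_of_pos hx0 _
  have e1 : x ^ (1 + ε) * (c / 2) / ℓ ^ J * ((1 - c₁) / 2 * (x / ℓ) / x ^ (1 + ε)) =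
      (x / ℓ ^ (J + 2)) * (ℓ * (c / 2 * ((1 - c₁) / 2))) := by
    rw [pow_add]; field_simp
  have e2 : C * (x * (ℓ ^ (J + 2))⁻¹) = (x / ℓ ^ (J + 2)) * C := by ring
  rw [e1, e2] at hfinal
  have h13 := le_of_mul_le_mul_left hfinal (by positivity)
  rw [div_lt_iff₀ (mul_pos (by positivity) (by linarith))] at hlC
  linarith

end LevelBeyondOne

theorem lemma1p2 (θ c₁ ξ : ℝ) (hθ : 0 < θ) (hc₁ : c₁ < 1) (hξ : 0 < ξ)
    (ρ : ℝ → ℕ → ℝ)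
    (h_minorant : ∀ᶠ x : ℝ in atTop, ∀ n ∈ dyadicBlock x,
      ρ x n ≤ if n.Prime then 1 else 0)
    (h_rough : ∀ᶠ x : ℝ in atTop, ∀ n ∈ dyadicBlock x, ρ x n ≠ 0 →
      ∀ p : ℕ, p.Prime → p ∣ n → x ^ ξ < (p : ℝ))
    (h_exponent : HasSmoothExponentOfDistribution ρ θ)
    (h_sum : Tendsto (fun x : ℝ => (∑ n ∈ dyadicBlock x, ρ x n) / (x / Real.log x))
      atTop (𝓝 (1 - c₁)))
    (c₀ : ℝ) (hc₀ : 2 / (θ * (1 - c₁)) < c₀) :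
    ∃ C : ℝ, ∀ m : ℕ, 1 ≤ m →
      primeGapLiminf m ≤ ((C * Real.exp (c₀ * (m : ℝ)) : ℝ) : EReal) :=
  exists_primeGapLiminf_le_of_le_one hθ (exponent_le_one hc₁ hξ h_rough h_exponent h_sum) hc₁ hξ
    h_minorant h_rough h_exponent h_sum hc₀
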